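/- Conventions. Let $\mathcal A$ be a unital supercommutative $\mathbb Z_2$-graded algebra over $\mathbb C$ and $\mathcal A[\nu^{-1},\nu]]$ the space of formal Laurent series in $\nu$ over $\mathcal A$. An operator $A$ on $\mathcal A$ is a differential operator of order at most $n$ if $[f_n,[f_{n-1},\dots[f_0,A]\dots]]=0$ (graded commutators) for all $f_0,\dots,f_n\in\mathcal A$. A formal differential operator is a series $\sum_{k\ge s}\nu^kA_k$, $s\in\mathbb Z$, of differential operators $A_k$; it is natural if it has the form $\sum_{k\ge 0}\nu^kA_k$ with $A_k$ of order at most $k$. A star product on $\mathcal A[\nu^{-1},\nu]]$ is a $\nu$-linear, $\nu$-adically continuous, $\mathbb Z_2$-graded associative product with identity $1$ of the form $f\ast g=\sum_{r\ge 0}\nu^rC_r(f,g)$ with $C_0(f,g)=fg$ for $f,g\in\mathcal A$, such that for every $f\in\mathcal A$ the operators $L_fg=f\ast g$ and $R_fg=(-1)^{|f||g|}g\ast f$ are formal differential operators. It is natural if $L_f$ and $R_f$ are natural for every $f\in\mathcal A[[\nu]]$. Let $U\subset\mathbb C^m$ be open. A (possibly degenerate) star product with separation of variables on $U$ is a star product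 $\star$ for $\mathcal A=C^\infty(U)$ (trivially graded) such that $a\star f=af$ and $f\star b=fb$ for all locally defined holomorphic functions $a$ and antiholomorphic functions $b$. Let $C^\infty(U\times\mathbb C^{0|d})$ be the Grassmann algebra over $C^\infty(U)$ with odd generators $\theta^1,\dots,\theta^d,\bar\theta^1,\dots,\bar\theta^d$; its elements are written uniquely as $f=\sum_{I,J}f_{IJ}\theta^I\bar\theta^J$ with $I,J\subset\{1,\dots,d\}$ and $f_{IJ}\in C^\infty(U)$. An even formal function $u$ on $U\times\mathbb C^{0|d}$ with $u_{\emptyset\emptyset}=1$ and $u-1$ nilpotent is admissible for $\star$ if the $2^d\times 2^d$ matrix $(u_{PQ})$ is invertible over the algebra $(C^\infty(U)[\nu^{-1},\nu]],\star)$. In that case the map $$(f_K^I)\longmapsto u^{-1}\sum_{K,L}\Big(\sum_I f_K^I\star u_{IL}\Big)\theta^K\bar\theta^L$$ is a bijection from the algebra of $2^d\times2^d$ matrices over $(C^\infty(U)[\nu^{-1},\nu]],\star)$, with multiplication $(fg)_K^N=\sum_I f_K^I\star g_I^N$, onto $C^\infty(U\times\mathbb C^{0|d})[\nu^{-1},\nu]]$,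 and the product $\ast$ associated with $(\star,u)$ is the matrix product transferred along this bijection. A nondegenerate nilpotent potential is an even nilpotent formal function $Y=\nu^{-1}Y_{-1}+Y_0+\nu Y_1+\cdots$ on $U\times\mathbb C^{0|d}$ such that the $d\times d$ matrix $\big(\overrightarrow{\tfrac{\partial}{\partial\theta^\alpha}}\,Y_{-1}\,\overleftarrow{\tfrac{\partial}{\partial\bar\theta^\beta}}\big)$ is nondegenerate at every point of $U$. Corollary. Let $\star$ be a possibly degenerate star product with separation of variables on an open set $U\subset\mathbb C^m$ and let $Y$ be a nondegenerate nilpotent potential on $U\times\mathbb C^{0|d}$. Then $e^Y$ is admissible for $\star$, the product $\ast$ on $C^\infty(U\times\mathbb C^{0|d})[\nu^{-1},\nu]]$ associated with $(\star,e^Y)$ is a star product, and this star product is natural. -/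

import Mathlib

open scoped ContDiff

noncomputable section

namespace SuperStar

/-! ### Formal products on `𝒜((ν))` for a `ℤ/2`-graded algebra `𝒜`

The grading of `𝒜` is recorded by its parity operator `σ`, which is `+1` on even and `-1` on odd
elements.  The space `𝒜((ν))` of formal Laurent series is `LaurentSeries 𝒜`. -/

section General

variable {𝒜 : Type*} [Ring 𝒜] [Algebra ℂ 𝒜]

/-- The projection onto even elements. -/
def evenPart (σ : 𝒜 →ₗ[ℂ] 𝒜) : 𝒜 →ₗ[ℂ] 𝒜 := (1 / 2 : ℂ) • (LinearMap.id + σ)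

/-- The projection onto odd elements. -/
def oddPart (σ : 𝒜 →ₗ[ℂ] 𝒜) : 𝒜 →ₗ[ℂ] 𝒜 := (1 / 2 : ℂ) • (LinearMap.id - σ)

/-- The graded commutator `[f, A]` of (left multiplication by) `f` with an operator `A`, i.e. the
bilinear extension of `f A - (-1)^{|f||A|} A f`.  If `f` is odd then `(-1)^{|f||A|} A = σ A σ`. -/
def superComm (σ : 𝒜 →ₗ[ℂ] 𝒜) (f : 𝒜) (A : 𝒜 →ₗ[ℂ] 𝒜) : 𝒜 →ₗ[ℂ] 𝒜 :=
  LinearMap.mulLeft ℂ f ∘ₗ A - A ∘ₗ LinearMap.mulLeft ℂ (evenPart σ f)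
    - (σ ∘ₗ A ∘ₗ σ) ∘ₗ LinearMap.mulLeft ℂ (oddPart σ f)

/-- `A` is a differential operator of order at most `n`:
`[f_n, [f_{n-1}, … [f_0, A] … ]] = 0` for all `f_0, …, f_n`. -/
def OrderLE (σ : 𝒜 →ₗ[ℂ] 𝒜) : ℕ → (𝒜 →ₗ[ℂ] 𝒜) → Prop
  | 0, A => ∀ f : 𝒜, superComm σ f A = 0
  | n + 1, A => ∀ f : 𝒜, OrderLE σ n (superComm σ f A)

/-- `T` is a formal differential operator `∑_{k ≥ s} ν^k A_k`. -/
def IsFormalDiffOp (σ : 𝒜 →ₗ[ℂ] 𝒜) (T : LaurentSeries 𝒜 → LaurentSeries 𝒜) : Prop :=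
  ∃ A : ℤ → (𝒜 →ₗ[ℂ] 𝒜), (∃ s : ℤ, ∀ k < s, A k = 0) ∧ (∀ k, ∃ n, OrderLE σ n (A k)) ∧
    ∀ g n, (T g).coeff n = ∑ᶠ k : ℤ, A k (g.coeff (n - k))

/-- `T` is a natural formal differential operator: `T = ∑_{k ≥ 0} ν^k A_k` with `A_k` of order at
most `k`. -/
def IsNaturalOp (σ : 𝒜 →ₗ[ℂ] 𝒜) (T : LaurentSeries 𝒜 → LaurentSeries 𝒜) : Prop :=
  ∃ A : ℕ → (𝒜 →ₗ[ℂ] 𝒜), (∀ k, OrderLE σ k (A k)) ∧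
    ∀ g n, (T g).coeff n = ∑ᶠ k : ℕ, A k (g.coeff (n - k))

/-- The operator `R_f` of graded right multiplication: the bilinear extension of
`R_f g = (-1)^{|f||g|} g ∗ f`. -/
def gradedRight (σ : 𝒜 →ₗ[ℂ] 𝒜)
    (mul : LaurentSeries 𝒜 → LaurentSeries 𝒜 → LaurentSeries 𝒜) (f g : LaurentSeries 𝒜) :
    LaurentSeries 𝒜 :=
  mul g (f.map (evenPart σ)) + mul (g.map σ) (f.map (oddPart σ))

/-- The product `mul` on `𝒜((ν))` is given by `f ∗ g = ∑_r ν^r C_r(f, g)`, the bilinear maps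
`C_r` being extended from `𝒜` to `𝒜((ν))` by `ν`-linearity, where `C_r = 0` for `r < s`. -/
def HasExpansion (mul : LaurentSeries 𝒜 → LaurentSeries 𝒜 → LaurentSeries 𝒜)
    (C : ℤ → (𝒜 →ₗ[ℂ] 𝒜 →ₗ[ℂ] 𝒜)) (s : ℤ) : Prop :=
  (∀ r < s, C r = 0) ∧
    ∀ f g n, (mul f g).coeff n = ∑ᶠ p : ℤ × ℤ, C (n - p.1 - p.2) (f.coeff p.1) (g.coeff p.2)

/-- `mul` is a star product on `𝒜((ν))`: an associative `ℤ/2`-graded `ν`-linear and `ν`-adically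
continuous product with identity `1`, which is differential and of the form
`f ∗ g = ∑_{r ≥ 0} ν^r C_r(f, g)` with `C_0(f, g) = f g`. -/
structure IsStarProduct (σ : 𝒜 →ₗ[ℂ] 𝒜)
    (mul : LaurentSeries 𝒜 → LaurentSeries 𝒜 → LaurentSeries 𝒜) : Prop where
  expansion : ∃ C : ℤ → (𝒜 →ₗ[ℂ] 𝒜 →ₗ[ℂ] 𝒜), HasExpansion mul C 0 ∧
    (∀ r f g, σ (C r f g) = C r (σ f) (σ g)) ∧ ∀ f g, C 0 f g = f * g
  assoc : ∀ f g h, mul (mul f g) h = mul f (mul g h)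
  one_mul : ∀ f, mul 1 f = f
  mul_one : ∀ f, mul f 1 = f
  left_diff : ∀ f : 𝒜, IsFormalDiffOp σ (mul (HahnSeries.C f))
  right_diff : ∀ f : 𝒜, IsFormalDiffOp σ (gradedRight σ mul (HahnSeries.C f))

/-- `mul` is a natural star product: `L_f` and `R_f` are natural for every `f ∈ 𝒜[[ν]]`. -/
structure IsNaturalStarProduct (σ : 𝒜 →ₗ[ℂ] 𝒜)
    (mul : LaurentSeries 𝒜 → LaurentSeries 𝒜 → LaurentSeries 𝒜) : Prop extends
    IsStarProduct σ mul where
  left_natural : ∀ f : LaurentSeries 𝒜, (∀ n < 0, f.coeff n = 0) → IsNaturalOp σ (mul f)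
  right_natural : ∀ f : LaurentSeries 𝒜, (∀ n < 0, f.coeff n = 0) →
    IsNaturalOp σ (gradedRight σ mul f)

end General

/-! ### Functions on `U ⊆ ℂ^m` and star products with separation of variables -/

section Space

variable {m : ℕ}

/-- The algebra `C^∞(U)` of smooth complex valued functions on an open set `U ⊆ ℂ^m`. -/
def smoothFunctions (U : TopologicalSpace.Opens (Fin m → ℂ)) : Subalgebra ℂ (U → ℂ) where
  carrier := {f | ∃ F : (Fin m → ℂ) → ℂ, ContDiffOn ℝ ∞ F U ∧ ∀ x : U, F x = f x}
  mul_mem' := by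
    rintro f g ⟨F, hF, hf⟩ ⟨G, hG, hg⟩
    exact ⟨fun x => F x * G x, hF.mul hG, fun x => by simp [hf, hg]⟩
  add_mem' := by
    rintro f g ⟨F, hF, hf⟩ ⟨G, hG, hg⟩
    exact ⟨fun x => F x + G x, hF.add hG, fun x => by simp [hf, hg]⟩
  algebraMap_mem' c := ⟨fun _ => c, contDiffOn_const, fun _ => rfl⟩

/-- The type `C^∞(U)`. -/
abbrev Smooth (U : TopologicalSpace.Opens (Fin m → ℂ)) : Type := smoothFunctions U

variable {U : TopologicalSpace.Opens (Fin m → ℂ)}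

/-- The function `a` is holomorphic on `V ⊆ U`. -/
def IsHolomorphicOn (a : Smooth U) (V : Set (Fin m → ℂ)) : Prop :=
  ∃ F : (Fin m → ℂ) → ℂ, DifferentiableOn ℂ F V ∧ ∀ x : U, (x : Fin m → ℂ) ∈ V → F x = a.1 x

/-- The function `b` is antiholomorphic on `V ⊆ U`. -/
def IsAntiholomorphicOn (b : Smooth U) (V : Set (Fin m → ℂ)) : Prop :=
  ∃ F : (Fin m → ℂ) → ℂ, DifferentiableOn ℂ F V ∧
    ∀ x : U, (x : Fin m → ℂ) ∈ V → (starRingEnd ℂ) (F x) = b.1 x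

/-- Formal functions `f` and `g` on `U` coincide on `V ⊆ U`. -/
def FormalEqOn (V : Set (Fin m → ℂ)) (f g : LaurentSeries (Smooth U)) : Prop :=
  ∀ (n : ℤ) (x : U), (x : Fin m → ℂ) ∈ V → (f.coeff n).1 x = (g.coeff n).1 x

/-- A (possibly degenerate) star product with separation of variables on `U`: a star product on
`C^∞(U)` (trivially graded) such that `a ⋆ f = a f` and `f ⋆ b = f b` for locally defined
holomorphic `a` and antiholomorphic `b`.  A star product is local, so it restricts to open
`V ⊆ U`, and near each point of `V` a function on `V` agrees with an element of `C^∞(U)`. -/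
structure IsSeparatedStarProduct
    (star : LaurentSeries (Smooth U) → LaurentSeries (Smooth U) → LaurentSeries (Smooth U)) :
    Prop extends IsStarProduct LinearMap.id star where
  holomorphic : ∀ (V : TopologicalSpace.Opens (Fin m → ℂ)), V ≤ U → ∀ a : Smooth U,
    IsHolomorphicOn a V → ∀ f, FormalEqOn V (star (HahnSeries.C a) f) (HahnSeries.C a * f)
  antiholomorphic : ∀ (V : TopologicalSpace.Opens (Fin m → ℂ)), V ≤ U → ∀ b : Smooth U,
    IsAntiholomorphicOn b V → ∀ f, FormalEqOn V (star f (HahnSeries.C b)) (f * HahnSeries.C b)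

/-! ### Functions on `U × ℂ^{0|d}` -/

variable (U) (d : ℕ)

/-- The algebra `C^∞(U × ℂ^{0|d})`: the Grassmann algebra over `C^∞(U)` in the odd generators
`θ^1, …, θ^d` (left summand) and `θbar^1, …, θbar^d` (right summand), in this order. -/
abbrev SuperFun : Type := ExteriorAlgebra (Smooth U) (Fin d ⊕ₗ Fin d → Smooth U)

/-- The parity operator of `C^∞(U × ℂ^{0|d})`. -/
def parity : SuperFun U d →ₗ[ℂ] SuperFun U d :=
  (CliffordAlgebra.involute (Q := (0 : QuadraticForm (Smooth U)
    (Fin d ⊕ₗ Fin d → Smooth U)))).toLinearMap.restrictScalars ℂ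

/-- The basis of `C^∞(U × ℂ^{0|d})` over `C^∞(U)` consisting of the ordered products of the
generators. -/
def monomialBasis : Module.Basis (Finset (Fin d ⊕ₗ Fin d)) (Smooth U) (SuperFun U d) :=
  (Pi.basisFun (Smooth U) (Fin d ⊕ₗ Fin d)).ExteriorAlgebra

variable {d}

/-- The index of the monomial `θ^I θbar^J`. -/
def monomialIndex (I J : Finset (Fin d)) : Finset (Fin d ⊕ₗ Fin d) :=
  (I.disjSum J).map (toLex : Fin d ⊕ Fin d ≃ Fin d ⊕ₗ Fin d).toEmbedding

variable {U}

/-- The formal function `f_{IJ}` on `U`, where `f = ∑ f_{IJ} θ^I θbar^J`. -/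
def coef (f : LaurentSeries (SuperFun U d)) (I J : Finset (Fin d)) : LaurentSeries (Smooth U) :=
  f.map ((monomialBasis U d).coord (monomialIndex I J))

/-- The formal function `∑ f_{IJ} θ^I θbar^J` with given coefficients. -/
def ofCoef (f : Finset (Fin d) → Finset (Fin d) → LaurentSeries (Smooth U)) :
    LaurentSeries (SuperFun U d) :=
  ∑ I, ∑ J, (f I J).map
    (LinearMap.toSpanSingleton (Smooth U) (SuperFun U d) (monomialBasis U d (monomialIndex I J)))

/-! ### The product associated with `(⋆, u)` -/

section Associated

variable (star : LaurentSeries (Smooth U) → LaurentSeries (Smooth U) → LaurentSeries (Smooth U))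

/-- The product of `2^d × 2^d` matrices over the algebra `(C^∞(U)((ν)), ⋆)`. -/
def starMatMul (A B : Matrix (Finset (Fin d)) (Finset (Fin d)) (LaurentSeries (Smooth U))) :
    Matrix (Finset (Fin d)) (Finset (Fin d)) (LaurentSeries (Smooth U)) :=
  fun K L => ∑ I, star (A K I) (B I L)

/-- The matrix `(u_{PQ})`. -/
def coefMatrix (u : LaurentSeries (SuperFun U d)) :
    Matrix (Finset (Fin d)) (Finset (Fin d)) (LaurentSeries (Smooth U)) :=
  fun P Q => coef u P Q

/-- The even formal function `u`, with `u_{∅∅} = 1`, is admissible: the matrix `(u_{PQ})` is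
invertible over the algebra `(C^∞(U)((ν)), ⋆)`. -/
def Admissible (u : LaurentSeries (SuperFun U d)) : Prop :=
  u.map (parity U d) = u ∧ coef u ∅ ∅ = 1 ∧
    ∃ v : Matrix (Finset (Fin d)) (Finset (Fin d)) (LaurentSeries (Smooth U)),
      starMatMul star (coefMatrix u) v = 1 ∧ starMatMul star v (coefMatrix u) = 1

/-- The mapping `(f_K^I) ↦ u⁻¹ (f_K^I ⋆ u_{IL}) θ^K θbar^L` from matrices to formal functions, the
rows of the matrix being indexed by `K`.  It is a bijection if `u` is admissible. -/
def matrixToFun (u : LaurentSeries (SuperFun U d))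
    (A : Matrix (Finset (Fin d)) (Finset (Fin d)) (LaurentSeries (Smooth U))) :
    LaurentSeries (SuperFun U d) :=
  Ring.inverse u * ofCoef (starMatMul star A (coefMatrix u))

/-- The product on `C^∞(U × ℂ^{0|d})((ν))` associated with `(⋆, u)`: the matrix product over
`(C^∞(U)((ν)), ⋆)` transferred along the bijection `matrixToFun star u` (`u` admissible). -/
def assocProduct (u f g : LaurentSeries (SuperFun U d)) : LaurentSeries (SuperFun U d) :=
  matrixToFun star u (starMatMul star
    (Function.invFun (matrixToFun star u) f) (Function.invFun (matrixToFun star u) g))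

end Associated

/-! ### Nondegenerate nilpotent potentials -/

/-- The left derivative `∂f/∂θ^α`. -/
def leftDerivTheta (α : Fin d) (f : SuperFun U d) : SuperFun U d :=
  CliffordAlgebra.contractLeft (LinearMap.proj (toLex (Sum.inl α))) f

/-- The right derivative of `f` with respect to `θbar^β`. -/
def rightDerivThetaBar (β : Fin d) (f : SuperFun U d) : SuperFun U d :=
  CliffordAlgebra.contractRight f (LinearMap.proj (toLex (Sum.inr β)))

/-- The value at a point `x ∈ U` of a function on `U × ℂ^{0|d}`. -/
def valueAt (x : U) (f : SuperFun U d) : ℂ :=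
  (ExteriorAlgebra.algebraMapInv f : Smooth U).1 x

/-- `Y = ν⁻¹ Y_{-1} + Y_0 + …` is an even nilpotent formal function such that the matrix of second
derivatives of `Y_{-1}`, from the left in `θ^α` and from the right in `θbar^β`, is nondegenerate
at every point of `U`. -/
structure IsNondegenerateNilpotentPotential (Y : LaurentSeries (SuperFun U d)) : Prop where
  pole : ∀ n < -1, Y.coeff n = 0
  even : Y.map (parity U d) = Y
  nilpotent : IsNilpotent Y
  nondegenerate : ∀ x : U, (Matrix.of fun α β : Fin d =>
    valueAt x (rightDerivThetaBar β (leftDerivTheta α (Y.coeff (-1))))).det ≠ 0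

end Space

end SuperStar

end

/-! Write `u = e^Y` and let `M` be its coefficient matrix. A formal operator `T` that multiplies
coefficient matrices by a matrix `F` from the left becomes, after conjugation, `u⁻¹ T u = L_f` with
`f = u⁻¹ T u (1)`: it is a left multiplication for the associated product. The same holds on the
right, with graded signs. Everything rests on having enough natural operators of this kind.

On the left the basic ones are multiplication by `θ^α`, the derivative `ν ∂/∂θ^α`, and left
`⋆`-multiplication by a function acting on coefficients. The first two are visibly natural; the
third is natural because `⋆` is. Conjugation by `e^Y` keeps them natural
(`exp_conj_mem_naturalOps`): a commutator with the even function `Y` lowers the order by one, while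
the pole of `Y` costs only one power of `ν`. On the right, `θbar` replaces `θ`.

The leading terms `f₀` of the resulting functions `f` form a subring (`symbols`). It contains the
generators `θ^α`, the derivatives `∂Y_{-1}/∂θ^α`, and for each function `a` an element with body
`a`. To first order in the odd variables the derivatives are combinations of the `θbar^β`, modulo
the `θ^γ`, with the Hessian of `Y_{-1}` as matrix. Nondegeneracy therefore gives all generators
modulo higher degree, and as that degree is bounded the subring is the whole Grassmann algebra
(`subring_eq_top_of_hessian`, `symbols_eq_top`).

So every `f₀` is the leading term of some `f` with natural `L_f`, and likewise for `R_f`. Successive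
approximation in `ν` then gives both conclusions: the maps `A ↦ u⁻¹ (A ⋆ M)` and `A ↦ u⁻¹ (M ⋆ A)`
are onto, hence `M` is invertible (`exists_coefs_inverse`), and all coefficients of the product have
the right order (`coeffMap_mem_ord`). Natural operators have no negative powers of `ν`, and their
leading terms are multiplications, so the star product axioms follow as well.

Naturality of `⋆` comes from separation of variables. As `L_f` commutes with `R_{zbar} = zbar`, it
differentiates only along `z`; similarly `R_f` differentiates only along `zbar`. In `[L_{zbar}, R_z]
= 0` the two extreme terms of each degree in `ν` thus cannot cancel each other, and induction bounds
both orders (`coord_ops_natural`); commuting with these operators then bounds `L_f` and `R_f` for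
every `f`. That orders can be tested on coordinates alone follows from Hadamard's lemma. -/

noncomputable section

namespace SuperStar

/-! ### The order filtration of operators on a supercommutative algebra -/

section Order

variable {𝒜 : Type*} [Ring 𝒜] [Algebra ℂ 𝒜] {σ : 𝒜 →ₗ[ℂ] 𝒜}

/-- `σ` is the parity operator of a supercommutative algebra. -/
structure IsParity (σ : 𝒜 →ₗ[ℂ] 𝒜) : Prop where
  map_mul : ∀ f g, σ (f * g) = σ f * σ g
  invol : ∀ f, σ (σ f) = f
  even_comm : ∀ f g, evenPart σ g * f = f * evenPart σ g
  odd_comm : ∀ f g, oddPart σ g * f = σ f * oddPart σ g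

lemma even_add_odd (σ : 𝒜 →ₗ[ℂ] 𝒜) (f : 𝒜) : evenPart σ f + oddPart σ f = f := by
  simp only [evenPart, oddPart, LinearMap.smul_apply, LinearMap.add_apply, LinearMap.sub_apply,
    LinearMap.id_apply]
  rw [← smul_add, show f + σ f + (f - σ f) = (2 : ℂ) • f by rw [two_smul]; abel, smul_smul]
  norm_num

lemma evenPart_of_fixed {f : 𝒜} (h : σ f = f) : evenPart σ f = f := by
  simp only [evenPart, LinearMap.smul_apply, LinearMap.add_apply, LinearMap.id_apply, h]
  rw [← two_smul ℂ f, smul_smul]; norm_num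

lemma oddPart_of_fixed {f : 𝒜} (h : σ f = f) : oddPart σ f = 0 := by
  simp [oddPart, h]

lemma evenPart_of_neg {f : 𝒜} (h : σ f = -f) : evenPart σ f = 0 := by
  simp [evenPart, h]

lemma oddPart_of_neg {f : 𝒜} (h : σ f = -f) : oddPart σ f = f := by
  have := even_add_odd σ f
  rwa [evenPart_of_neg h, zero_add] at this

namespace IsParity

variable (hσ : IsParity σ)
include hσ

lemma even_fixed (f : 𝒜) : σ (evenPart σ f) = evenPart σ f := by
  simp [evenPart, hσ.invol, add_comm]

lemma odd_neg (f : 𝒜) : σ (oddPart σ f) = -oddPart σ f := by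
  simp only [oddPart, LinearMap.smul_apply, LinearMap.sub_apply, LinearMap.id_apply, map_smul,
    map_sub, hσ.invol]
  rw [← smul_neg, neg_sub]

lemma even_even (f : 𝒜) : evenPart σ (evenPart σ f) = evenPart σ f :=
  evenPart_of_fixed (hσ.even_fixed f)

lemma odd_even (f : 𝒜) : oddPart σ (evenPart σ f) = 0 := oddPart_of_fixed (hσ.even_fixed f)

lemma even_odd (f : 𝒜) : evenPart σ (oddPart σ f) = 0 := evenPart_of_neg (hσ.odd_neg f)

lemma odd_odd (f : 𝒜) : oddPart σ (oddPart σ f) = oddPart σ f := oddPart_of_neg (hσ.odd_neg f)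

lemma even_map (f : 𝒜) : evenPart σ (σ f) = evenPart σ f := by
  simp [evenPart, hσ.invol, add_comm]

lemma odd_map (f : 𝒜) : oddPart σ (σ f) = -oddPart σ f := by
  simp only [oddPart, LinearMap.smul_apply, LinearMap.sub_apply, LinearMap.id_apply, hσ.invol]
  rw [← smul_neg, neg_sub]

lemma even_mul (f g : 𝒜) :
    evenPart σ (f * g) = evenPart σ f * evenPart σ g + oddPart σ f * oddPart σ g := by
  conv_lhs => rw [← even_add_odd σ f, ← even_add_odd σ g]
  rw [add_mul, mul_add, mul_add, map_add, map_add, map_add]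
  rw [evenPart_of_fixed (f := evenPart σ f * evenPart σ g),
    evenPart_of_neg (f := evenPart σ f * oddPart σ g),
    evenPart_of_neg (f := oddPart σ f * evenPart σ g),
    evenPart_of_fixed (f := oddPart σ f * oddPart σ g)]
  · abel
  all_goals simp [hσ.map_mul, hσ.even_fixed, hσ.odd_neg]

lemma odd_mul (f g : 𝒜) :
    oddPart σ (f * g) = evenPart σ f * oddPart σ g + oddPart σ f * evenPart σ g := by
  have h := even_add_odd σ (f * g)
  rw [hσ.even_mul] at h
  rw [← sub_eq_iff_eq_add'.2 h.symm]
  nth_rw 1 [← even_add_odd σ f]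
  nth_rw 1 [← even_add_odd σ g]
  noncomm_ring

end IsParity

/-- The operator `σ A σ`. -/
def parityConj (σ A : 𝒜 →ₗ[ℂ] 𝒜) : 𝒜 →ₗ[ℂ] 𝒜 := σ ∘ₗ A ∘ₗ σ

@[simp] lemma parityConj_apply (A : 𝒜 →ₗ[ℂ] 𝒜) (f : 𝒜) : parityConj σ A f = σ (A (σ f)) := rfl

lemma superComm_apply (f : 𝒜) (A : 𝒜 →ₗ[ℂ] 𝒜) (g : 𝒜) :
    superComm σ f A g = f * A g - A (evenPart σ f * g) - σ (A (σ (oddPart σ f * g))) := rfl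

lemma superComm_add (f : 𝒜) (A B : 𝒜 →ₗ[ℂ] 𝒜) :
    superComm σ f (A + B) = superComm σ f A + superComm σ f B := by
  ext g; simp only [superComm_apply, LinearMap.add_apply, mul_add, map_add]; abel

lemma superComm_smul (f : 𝒜) (c : ℂ) (A : 𝒜 →ₗ[ℂ] 𝒜) :
    superComm σ f (c • A) = c • superComm σ f A := by
  ext g; simp only [superComm_apply, LinearMap.smul_apply, mul_smul_comm, map_smul, smul_sub]

@[simp] lemma superComm_zero (f : 𝒜) : superComm σ f 0 = 0 := by
  ext g; simp [superComm_apply]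

lemma superComm_add_left (f g : 𝒜) (A : 𝒜 →ₗ[ℂ] 𝒜) :
    superComm σ (f + g) A = superComm σ f A + superComm σ g A := by
  ext h; simp only [superComm_apply, LinearMap.add_apply, add_mul, map_add]; abel

lemma superComm_of_even {f : 𝒜} (h : σ f = f) (A : Module.End ℂ 𝒜) :
    @Eq (Module.End ℂ 𝒜) (superComm σ f A)
      (LinearMap.mulLeft ℂ f * A - A * LinearMap.mulLeft ℂ f) := by
  ext g; simp [superComm_apply, evenPart_of_fixed h, oddPart_of_fixed h]

lemma orderLE_add {n : ℕ} {A B : 𝒜 →ₗ[ℂ] 𝒜} (hA : OrderLE σ n A) (hB : OrderLE σ n B) :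
    OrderLE σ n (A + B) := by
  induction n generalizing A B with
  | zero => intro f; rw [superComm_add, hA f, hB f, add_zero]
  | succ n ih => intro f; rw [superComm_add]; exact ih (hA f) (hB f)

lemma orderLE_smul {n : ℕ} (c : ℂ) {A : 𝒜 →ₗ[ℂ] 𝒜} (hA : OrderLE σ n A) :
    OrderLE σ n (c • A) := by
  induction n generalizing A with
  | zero => intro f; rw [superComm_smul, hA f, smul_zero]
  | succ n ih => intro f; rw [superComm_smul]; exact ih (hA f)

lemma orderLE_zero (n : ℕ) : OrderLE σ n 0 := by
  induction n with
  | zero => intro f; simp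
  | succ n ih => intro f; simpa using ih

lemma orderLE_succ {n : ℕ} {A : 𝒜 →ₗ[ℂ] 𝒜} (hA : OrderLE σ n A) : OrderLE σ (n + 1) A := by
  induction n generalizing A with
  | zero => intro f; rw [hA f]; exact orderLE_zero 0
  | succ n ih => intro f; exact ih (hA f)

/-- Operators of order at most `k`; this is zero for `k < 0`. -/
def ordSubmodule (σ : 𝒜 →ₗ[ℂ] 𝒜) (k : ℤ) : Submodule ℂ (Module.End ℂ 𝒜) where
  carrier := {A | if 0 ≤ k then OrderLE σ k.toNat A else A = 0}
  zero_mem' := by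
    by_cases h : 0 ≤ k <;> simp [h, orderLE_zero]
  add_mem' {A B} hA hB := by
    by_cases h : 0 ≤ k
    · simp only [Set.mem_ofPred_eq, h, if_true] at *; exact orderLE_add hA hB
    · simp only [Set.mem_ofPred_eq, h, if_false] at *; simp [hA, hB]
  smul_mem' c A hA := by
    by_cases h : 0 ≤ k
    · simp only [Set.mem_ofPred_eq, h, if_true] at *; exact orderLE_smul c hA
    · simp only [Set.mem_ofPred_eq, h, if_false] at *; simp [hA]

lemma mem_ord_nat {n : ℕ} {A : Module.End ℂ 𝒜} : A ∈ ordSubmodule σ n ↔ OrderLE σ n A := by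
  simp [ordSubmodule]

lemma mem_ord_neg {k : ℤ} (hk : k < 0) {A : Module.End ℂ 𝒜} : A ∈ ordSubmodule σ k ↔ A = 0 := by
  change (if 0 ≤ k then OrderLE σ k.toNat A else A = 0) ↔ _
  rw [if_neg (not_le.2 hk)]

lemma mem_ord_iff {k : ℤ} (hk : 0 ≤ k) {A : Module.End ℂ 𝒜} :
    A ∈ ordSubmodule σ k ↔ ∀ f, superComm σ f A ∈ ordSubmodule σ (k - 1) := by
  lift k to ℕ using hk
  rw [mem_ord_nat]
  cases k with
  | zero =>
    simp only [Nat.cast_zero, zero_sub]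
    exact forall_congr' fun f => (mem_ord_neg (by norm_num)).symm
  | succ n =>
    rw [show ((n + 1 : ℕ) : ℤ) - 1 = n by push_cast; ring]
    exact forall_congr' fun f => mem_ord_nat.symm

lemma neg_mem_ord {k : ℤ} {A : Module.End ℂ 𝒜} (hA : A ∈ ordSubmodule σ k) :
    -A ∈ ordSubmodule σ k := by
  have := (ordSubmodule σ k).smul_mem (-1) hA
  rwa [show (-1 : ℂ) • A = -A by ext; simp] at this

lemma sub_mem_ord {k : ℤ} {A B : Module.End ℂ 𝒜} (hA : A ∈ ordSubmodule σ k)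
    (hB : B ∈ ordSubmodule σ k) : A - B ∈ ordSubmodule σ k := by
  rw [sub_eq_add_neg]; exact add_mem hA (neg_mem_ord hB)

lemma superComm_mem_ord {k : ℤ} {A : Module.End ℂ 𝒜} (hA : A ∈ ordSubmodule σ k) (f : 𝒜) :
    superComm σ f A ∈ ordSubmodule σ (k - 1) := by
  rcases lt_or_ge k 0 with h | h
  · rw [(mem_ord_neg h).1 hA, superComm_zero]; exact zero_mem _
  · exact (mem_ord_iff h).1 hA f

lemma ord_le_succ (k : ℤ) : ordSubmodule σ k ≤ ordSubmodule σ (k + 1) := by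
  intro A hA
  rcases lt_or_ge k 0 with h | h
  · rw [(mem_ord_neg h).1 hA]; exact zero_mem _
  · lift k to ℕ using h
    have := mem_ord_nat.2 (orderLE_succ (mem_ord_nat.1 hA))
    exact_mod_cast this

lemma ord_mono : Monotone (ordSubmodule σ) := monotone_int_of_le_succ ord_le_succ

/-- Conjugation by `σ` carries the commutator with `σ f` to the commutator with `f`, so it preserves
every step of the recursive definition. -/
lemma parityConj_mem_ord (hσ : IsParity σ) {k : ℤ} {A : Module.End ℂ 𝒜}
    (hA : A ∈ ordSubmodule σ k) : parityConj σ A ∈ ordSubmodule σ k := by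
  rcases lt_or_ge k 0 with h | h
  · rw [(mem_ord_neg h).1 hA]
    rw [show parityConj σ 0 = 0 by ext g; simp]; exact zero_mem _
  · lift k to ℕ using h
    rw [mem_ord_nat] at hA ⊢
    have key (f : 𝒜) (B : 𝒜 →ₗ[ℂ] 𝒜) :
        superComm σ f (parityConj σ B) = parityConj σ (superComm σ (σ f) B) := by
      ext g
      simp only [superComm_apply, parityConj_apply, map_sub, hσ.map_mul, hσ.invol, hσ.even_map,
        hσ.odd_map, hσ.even_fixed, hσ.odd_neg, map_neg, neg_neg, neg_mul]
    induction k generalizing A with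
    | zero => intro f; rw [key, hA]; ext g; simp
    | succ n ih => intro f; rw [key]; exact ih (hA _)

/-- The Leibniz rule for the graded commutator. The sign from moving an odd `f` past `A` is carried
by `parityConj σ A`, so that neither `f` nor `A` need be homogeneous. -/
lemma superComm_mul (hσ : IsParity σ) (f : 𝒜) (A B : Module.End ℂ 𝒜) :
    superComm σ f (A * B) = superComm σ f A * B + A * superComm σ (evenPart σ f) B
      + parityConj σ A * superComm σ (oddPart σ f) B := by
  ext g
  simp only [superComm_apply, parityConj_apply, Module.End.mul_apply, LinearMap.add_apply, map_sub,
    hσ.map_mul, hσ.invol, hσ.even_even, hσ.odd_even, hσ.even_odd, hσ.odd_odd,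
    hσ.odd_neg, zero_mul, map_zero, sub_zero, neg_mul, map_neg]
  abel

lemma mul_mem_ord (hσ : IsParity σ) {k l : ℤ} {A B : Module.End ℂ 𝒜}
    (hA : A ∈ ordSubmodule σ k) (hB : B ∈ ordSubmodule σ l) : A * B ∈ ordSubmodule σ (k + l) := by
  rcases lt_or_ge k 0 with hk | hk
  · rw [(mem_ord_neg hk).1 hA, zero_mul]; exact zero_mem _
  rcases lt_or_ge l 0 with hl | hl
  · rw [(mem_ord_neg hl).1 hB, mul_zero]; exact zero_mem _
  obtain ⟨n, hn⟩ : ∃ n : ℕ, (n : ℤ) = k + l := ⟨(k + l).toNat, by omega⟩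
  induction n using Nat.strong_induction_on generalizing k l A B with
  | _ n ih =>
  -- The induction hypothesis, extended to negative orders, where a factor is zero.
  have aux {k' l' : ℤ} {A' B' : Module.End ℂ 𝒜} (hA' : A' ∈ ordSubmodule σ k')
      (hB' : B' ∈ ordSubmodule σ l') (hkl : k' + l' = k + l - 1) :
      A' * B' ∈ ordSubmodule σ (k + l - 1) := by
    rcases lt_or_ge k' 0 with hk' | hk'
    · rw [(mem_ord_neg hk').1 hA', zero_mul]; exact zero_mem _
    rcases lt_or_ge l' 0 with hl' | hl'
    · rw [(mem_ord_neg hl').1 hB', mul_zero]; exact zero_mem _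
    rw [← hkl]
    exact ih (k' + l').toNat (by omega) hA' hB' hk' hl' (by omega)
  rw [mem_ord_iff (by omega)]
  intro f
  rw [superComm_mul hσ]
  refine add_mem (add_mem ?_ ?_) ?_
  · exact aux (superComm_mem_ord hA f) hB (by ring)
  · exact aux hA (superComm_mem_ord hB _) (by ring)
  · exact aux (parityConj_mem_ord hσ hA) (superComm_mem_ord hB _) (by ring)

lemma mulLeft_mem_ord (hσ : IsParity σ) (f : 𝒜) :
    (LinearMap.mulLeft ℂ f : Module.End ℂ 𝒜) ∈ ordSubmodule σ 0 := by
  rw [← Nat.cast_zero, mem_ord_nat]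
  intro g
  ext h
  simp only [superComm_apply, LinearMap.mulLeft_apply, hσ.map_mul, hσ.invol, LinearMap.zero_apply]
  nth_rw 1 [← even_add_odd σ g]
  rw [add_mul, ← mul_assoc, ← mul_assoc, ← mul_assoc, hσ.even_comm, hσ.odd_comm]
  simp only [mul_assoc]
  abel

/-- Supercommuting with all multiplications fixes the operator by its value at `1`. This is how
leading terms of natural operators become functions. -/
lemma eq_mulLeft_of_mem_ord_zero (hσ : IsParity σ) {A : Module.End ℂ 𝒜}
    (hA : A ∈ ordSubmodule σ 0) (f : 𝒜) : A f = A 1 * f := by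
  rw [← Nat.cast_zero, mem_ord_nat] at hA
  have he : A (evenPart σ f) = A 1 * evenPart σ f := by
    have := LinearMap.congr_fun (hA (evenPart σ f)) 1
    rw [superComm_apply, hσ.even_even, hσ.odd_even, mul_one, zero_mul, map_zero, map_zero,
      map_zero, sub_zero, LinearMap.zero_apply, sub_eq_zero] at this
    rw [← this, hσ.even_comm]
  have ho : A (oddPart σ f) = A 1 * oddPart σ f := by
    have := LinearMap.congr_fun (hA (oddPart σ f)) 1
    rw [superComm_apply, hσ.odd_odd, hσ.even_odd, mul_one, mul_one, map_zero, sub_zero,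
      LinearMap.zero_apply, sub_eq_zero, hσ.odd_neg, hσ.odd_comm] at this
    -- Supercommutativity has turned `A 1` into `σ (A 1)`; a second application of `σ` undoes this.
    have h2 := congrArg σ this
    rw [hσ.map_mul, hσ.invol, hσ.invol, hσ.odd_neg, map_neg, mul_neg, neg_inj] at h2
    exact h2.symm
  rw [← even_add_odd σ f, map_add, he, ho, mul_add]

/-- A Leibniz rule in the function rather than in the operator: it reduces bounds on commutators to
generators of the algebra. -/
lemma superComm_mul_left (hσ : IsParity σ) (f g : 𝒜) (A : Module.End ℂ 𝒜) :
    superComm σ (f * g) A = LinearMap.mulLeft ℂ f * superComm σ g A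
      + superComm σ f A * LinearMap.mulLeft ℂ (evenPart σ g)
      + superComm σ f (parityConj σ A) * LinearMap.mulLeft ℂ (oddPart σ g) := by
  ext h
  simp only [superComm_apply, parityConj_apply, Module.End.mul_apply, LinearMap.add_apply,
    LinearMap.mulLeft_apply, hσ.even_mul, hσ.odd_mul, mul_sub, add_mul, map_add, hσ.invol,
    mul_assoc]
  abel

end Order

/-! ### Bounded `ν`-linear maps between spaces of formal Laurent series -/

section Laurent

open HahnSeries

/-- The series `f` has no terms of degree less than `s`. -/
def VanishesBelow {A : Type*} [Zero A] (s : ℤ) (f : LaurentSeries A) : Prop :=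
  ∀ n < s, f.coeff n = 0

lemma exists_vanishesBelow {A : Type*} [Zero A] (f : LaurentSeries A) :
    ∃ s, VanishesBelow s f := by
  by_cases hf : f = 0
  · exact ⟨0, fun n _ => by simp [hf]⟩
  · exact ⟨f.order, fun n hn => coeff_eq_zero_of_lt_order hn⟩

lemma VanishesBelow.mono {A : Type*} [Zero A] {s t : ℤ} {f : LaurentSeries A}
    (h : VanishesBelow s f) (hts : t ≤ s) : VanishesBelow t f := fun n hn => h n (by omega)

lemma VanishesBelow.map {A B F : Type*} [Zero A] [Zero B] [FunLike F A B] [ZeroHomClass F A B]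
    {s : ℤ} {f : LaurentSeries A} (h : VanishesBelow s f) (φ : F) :
    VanishesBelow s (f.map φ) := fun n hn => by simp [h n hn]

lemma vanishesBelow_zero {A : Type*} [Zero A] (s : ℤ) : VanishesBelow s (0 : LaurentSeries A) :=
  fun _ _ => rfl

lemma VanishesBelow.add {A : Type*} [AddMonoid A] {s : ℤ} {f g : LaurentSeries A}
    (hf : VanishesBelow s f) (hg : VanishesBelow s g) : VanishesBelow s (f + g) :=
  fun n hn => by simp [hf n hn, hg n hn]

lemma VanishesBelow.sum {A ι : Type*} [AddCommMonoid A] {s : ℤ} {f : ι → LaurentSeries A}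
    {t : Finset ι} (hf : ∀ i ∈ t, VanishesBelow s (f i)) : VanishesBelow s (∑ i ∈ t, f i) :=
  Finset.sum_induction f (VanishesBelow s) (fun _ _ => VanishesBelow.add)
    (vanishesBelow_zero s) hf

lemma vanishesBelow_C {A : Type*} [NonAssocSemiring A] (a : A) :
    VanishesBelow 0 (C a : LaurentSeries A) := fun n hn => by
  rw [C_apply, coeff_single_of_ne hn.ne]

lemma C_smul {A : Type*} [Ring A] [Algebra ℂ A] (c : ℂ) (a : A) :
    (C (c • a) : LaurentSeries A) = c • C a := by
  ext n
  rw [C_apply, C_apply, coeff_smul]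
  by_cases hn : n = 0
  · simp [hn]
  · simp [coeff_single_of_ne hn]

/-- The sum runs over an interval instead of a support-dependent antidiagonal, so sums for different
series can be compared. It is stated for modules to cover both products of series and the action of
operator series. -/
lemma coeff_smul_Icc {R V : Type*} [Semiring R] [AddCommMonoid V] [Module R V]
    {x : LaurentSeries R} {y : LaurentSeries V} {s t : ℤ} (hx : VanishesBelow s x)
    (hy : VanishesBelow t y) (n : ℤ) :
    ((HahnModule.of R).symm (x • HahnModule.of R y)).coeff n
      = ∑ k ∈ Finset.Icc s (n - t), x.coeff k • y.coeff (n - k) := by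
  rw [HahnModule.coeff_smul]
  refine Finset.sum_of_injOn (fun ij => ij.1) ?_ ?_ ?_ ?_
  · rintro ⟨i, j⟩ hij ⟨i', j'⟩ hij' h
    simp only [Finset.mem_coe, Finset.mem_vaddAntidiagonal, vadd_eq_add] at hij hij' h
    ext <;> simp <;> omega
  · rintro ⟨i, j⟩ hij
    simp only [Finset.mem_coe, Finset.mem_vaddAntidiagonal, vadd_eq_add, mem_support,
      Equiv.symm_apply_apply] at hij
    simp only [Finset.coe_Icc, Set.mem_Icc]
    have h1 : s ≤ i := not_lt.1 fun h => hij.1 (hx i h)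
    have h2 : t ≤ j := not_lt.1 fun h => hij.2.1 (hy j h)
    omega
  · intro k hk hk'
    by_contra hne
    refine hk' ⟨(k, n - k), ?_, rfl⟩
    simp only [Finset.mem_coe, Finset.mem_vaddAntidiagonal, vadd_eq_add, mem_support,
      Equiv.symm_apply_apply]
    refine ⟨fun h => hne (by rw [h, zero_smul]), fun h => hne (by rw [h, smul_zero]), by ring⟩
  · rintro ⟨i, j⟩ hij
    simp only [Finset.mem_vaddAntidiagonal, vadd_eq_add] at hij
    rw [Equiv.symm_apply_apply, ← hij.2.2, add_sub_cancel_left]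

lemma coeff_mul_Icc {A : Type*} [Semiring A] {x y : LaurentSeries A} {s t : ℤ}
    (hx : VanishesBelow s x) (hy : VanishesBelow t y) (n : ℤ) :
    (x * y).coeff n = ∑ k ∈ Finset.Icc s (n - t), x.coeff k * y.coeff (n - k) := by
  rw [← HahnSeries.of_symm_smul_of_eq_mul, coeff_smul_Icc hx hy]; rfl

lemma coeff_mul_Icc' {A : Type*} [Semiring A] {x y : LaurentSeries A} {s t : ℤ}
    (hx : VanishesBelow s x) (hy : VanishesBelow t y) (n : ℤ) :
    (x * y).coeff n = ∑ k ∈ Finset.Icc t (n - s), x.coeff (n - k) * y.coeff k := by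
  rw [coeff_mul_Icc hx hy]
  refine Finset.sum_bij' (fun k _ => n - k) (fun k _ => n - k) ?_ ?_ ?_ ?_ ?_ <;> intro k hk <;>
    simp only [Finset.mem_Icc] at * <;> first | omega | simp

lemma VanishesBelow.mul {A : Type*} [Semiring A] {s t : ℤ} {f g : LaurentSeries A}
    (hf : VanishesBelow s f) (hg : VanishesBelow t g) : VanishesBelow (s + t) (f * g) := by
  intro n hn
  rw [coeff_mul_Icc hf hg, Finset.Icc_eq_empty (by omega), Finset.sum_empty]

lemma coeff_C_mul {A : Type*} [Semiring A] (a : A) (f : LaurentSeries A) (n : ℤ) :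
    (C a * f).coeff n = a * f.coeff n := by
  rw [C_apply, coeff_single_mul, sub_zero]

lemma coeff_mul_C {A : Type*} [Semiring A] (a : A) (f : LaurentSeries A) (n : ℤ) :
    (f * C a).coeff n = f.coeff n * a := by
  rw [C_apply, coeff_mul_single, sub_zero]

/-- Multiplication by `ν^k`. -/
def shift {A : Type*} [Semiring A] (k : ℤ) (f : LaurentSeries A) : LaurentSeries A :=
  single k 1 * f

@[simp] lemma coeff_shift {A : Type*} [Semiring A] (k : ℤ) (f : LaurentSeries A) (n : ℤ) :
    (shift k f).coeff n = f.coeff (n - k) := by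
  rw [shift, coeff_single_mul, one_mul]

lemma mul_shift {A : Type*} [Semiring A] (k : ℤ) (f g : LaurentSeries A) :
    f * shift k g = shift k (f * g) := by
  ext n
  rw [shift, ← mul_assoc, shift, ← mul_assoc]
  congr 2
  ext n
  rw [coeff_single_mul, coeff_mul_single, one_mul, mul_one]

lemma shift_add {A : Type*} [Semiring A] (k : ℤ) (f g : LaurentSeries A) :
    shift k (f + g) = shift k f + shift k g := mul_add _ _ _

lemma shift_shift {A : Type*} [Semiring A] (k l : ℤ) (f : LaurentSeries A) :
    shift k (shift l f) = shift (k + l) f := by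
  ext n; simp only [coeff_shift]; congr 1; ring

lemma shift_zero_left {A : Type*} [Semiring A] (f : LaurentSeries A) : shift 0 f = f := by
  ext n; simp

lemma VanishesBelow.shift {A : Type*} [Semiring A] {s : ℤ} {f : LaurentSeries A}
    (h : VanishesBelow s f) (k : ℤ) : VanishesBelow (k + s) (shift k f) := fun n hn => by
  rw [coeff_shift]; exact h _ (by omega)

lemma map_shift {A B F : Type*} [Semiring A] [Semiring B] [FunLike F A B] [ZeroHomClass F A B]
    (φ : F) (k : ℤ) (f : LaurentSeries A) : (shift k f).map φ = shift k (f.map φ) := by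
  ext n; simp

/-- Together with boundedness, this approximation by finite sums reduces questions about series to
constant series. -/
lemma exists_truncation {A : Type*} [Ring A] {s : ℤ} {f : LaurentSeries A}
    (hf : VanishesBelow s f) (N : ℤ) :
    VanishesBelow N (f - ∑ k ∈ Finset.Ico s N, shift k (C (f.coeff k))) := by
  intro n hn
  rw [coeff_sub, coeff_sum]
  simp only [coeff_shift]
  by_cases hs : s ≤ n
  · rw [Finset.sum_eq_single_of_mem n (Finset.mem_Ico.2 ⟨hs, hn⟩)]
    · simp
    · intro k _ hk
      rw [C_apply, coeff_single_of_ne (by omega)]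
  · rw [hf n (by omega), Finset.sum_eq_zero, sub_zero]
    intro k hk
    rw [Finset.mem_Ico] at hk
    rw [C_apply, coeff_single_of_ne (by omega)]

variable {A B D : Type*} [Ring A] [Algebra ℂ A] [Ring B] [Algebra ℂ B] [Ring D] [Algebra ℂ D]

/-- `ν`-linear maps of formal Laurent series that are bounded in the `ν`-adic filtration. -/
structure IsBounded (Φ : LaurentSeries A → LaurentSeries B) : Prop where
  add : ∀ f g, Φ (f + g) = Φ f + Φ g
  smul : ∀ (c : ℂ) f, Φ (c • f) = c • Φ f
  shift : ∀ k f, Φ (shift k f) = shift k (Φ f)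
  bound : ∃ c, ∀ s f, VanishesBelow s f → VanishesBelow (s + c) (Φ f)

namespace IsBounded

variable {Φ Ψ : LaurentSeries A → LaurentSeries B}

/-- A bounded `ν`-linear map as a linear map over `ℂ`. -/
def toLin (h : IsBounded Φ) : LaurentSeries A →ₗ[ℂ] LaurentSeries B where
  toFun := Φ
  map_add' := h.add
  map_smul' := h.smul

lemma map_sum (h : IsBounded Φ) {ι : Type*} (t : Finset ι) (f : ι → LaurentSeries A) :
    Φ (∑ i ∈ t, f i) = ∑ i ∈ t, Φ (f i) := _root_.map_sum h.toLin f t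

lemma map_zero (h : IsBounded Φ) : Φ 0 = 0 := _root_.map_zero h.toLin

lemma map_sub (h : IsBounded Φ) (f g) : Φ (f - g) = Φ f - Φ g := _root_.map_sub h.toLin f g

lemma map_neg (h : IsBounded Φ) (f) : Φ (-f) = -Φ f := _root_.map_neg h.toLin f

lemma coeff_eq (h : IsBounded Φ) {c : ℤ}
    (hc : ∀ s f, VanishesBelow s f → VanishesBelow (s + c) (Φ f)) {s : ℤ} {f : LaurentSeries A}
    (hf : VanishesBelow s f) (n : ℤ) :
    (Φ f).coeff n = ∑ k ∈ Finset.Icc s (n - c), (Φ (C (f.coeff k))).coeff (n - k) := by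
  -- Cutting `f` off at degree `n - c + 1` changes `Φ f` only from degree `n + 1` on.
  have h1 := hc _ _ (exists_truncation hf (n - c + 1)) n (by omega)
  rw [h.map_sub, h.map_sum, coeff_sub, sub_eq_zero, coeff_sum] at h1
  rw [h1, show Finset.Ico s (n - c + 1) = Finset.Icc s (n - c) by ext; simp]
  exact Finset.sum_congr rfl fun k _ => by rw [h.shift, coeff_shift]

lemma ext (hΦ : IsBounded Φ) (hΨ : IsBounded Ψ) (h : ∀ a : A, Φ (C a) = Ψ (C a))
    (f : LaurentSeries A) : Φ f = Ψ f := by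
  obtain ⟨c, hc⟩ := hΦ.bound
  obtain ⟨c', hc'⟩ := hΨ.bound
  obtain ⟨s, hs⟩ := exists_vanishesBelow f
  ext n
  -- A common bound makes both sums run over the same interval.
  rw [hΦ.coeff_eq (c := min c c') (fun s f hf => (hc s f hf).mono (by simp)) hs,
    hΨ.coeff_eq (c := min c c') (fun s f hf => (hc' s f hf).mono (by simp)) hs]
  simp_rw [h]

lemma zero : IsBounded (fun _ : LaurentSeries A => (0 : LaurentSeries B)) :=
  ⟨by simp, by simp, fun k f => by ext; simp, 0, fun s f h => vanishesBelow_zero _⟩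

lemma comp {Θ : LaurentSeries B → LaurentSeries D} (hΘ : IsBounded Θ) (hΦ : IsBounded Φ) :
    IsBounded (fun f => Θ (Φ f)) := by
  obtain ⟨c, hc⟩ := hΦ.bound
  obtain ⟨c', hc'⟩ := hΘ.bound
  refine ⟨fun f g => ?_, fun a f => ?_, fun k f => ?_, c + c', fun s f hf => ?_⟩
  · rw [hΦ.add, hΘ.add]
  · rw [hΦ.smul, hΘ.smul]
  · rw [hΦ.shift, hΘ.shift]
  · rw [← add_assoc]; exact hc' _ _ (hc _ _ hf)

lemma add' (hΦ : IsBounded Φ) (hΨ : IsBounded Ψ) : IsBounded (fun f => Φ f + Ψ f) := by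
  obtain ⟨c, hc⟩ := hΦ.bound
  obtain ⟨c', hc'⟩ := hΨ.bound
  refine ⟨fun f g => ?_, fun a f => ?_, fun k f => ?_, min c c', fun s f hf => ?_⟩
  · rw [hΦ.add, hΨ.add]; abel
  · rw [hΦ.smul, hΨ.smul, smul_add]
  · rw [hΦ.shift, hΨ.shift, shift_add]
  · exact ((hc _ _ hf).mono (by simp)).add ((hc' _ _ hf).mono (by simp))

lemma sum {ι : Type*} {t : Finset ι} {Φ : ι → LaurentSeries A → LaurentSeries B}
    (h : ∀ i, IsBounded (Φ i)) : IsBounded (fun f => ∑ i ∈ t, Φ i f) := by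
  classical
  induction t using Finset.induction_on with
  | empty => simpa using zero
  | insert i t hi ih => simpa only [Finset.sum_insert hi] using (h i).add' ih

lemma map (φ : A →ₗ[ℂ] B) : IsBounded (fun f : LaurentSeries A => f.map φ) :=
  ⟨fun f g => by ext; simp, fun c f => by ext; simp, fun k f => map_shift _ _ _, 0,
    fun s f h => by simpa using h.map φ⟩

lemma mul_left (g : LaurentSeries A) : IsBounded (fun f => g * f) := by
  obtain ⟨c, hc⟩ := exists_vanishesBelow g
  refine ⟨mul_add g, fun a f => mul_smul_comm _ _ _, fun k f => mul_shift _ _ _, c,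
    fun s f hf => ?_⟩
  rw [add_comm]; exact hc.mul hf

end IsBounded

/-- Bounded `ν`-bilinear operations on formal Laurent series. -/
structure IsBounded₂ (P : LaurentSeries A → LaurentSeries B → LaurentSeries D) : Prop where
  left : ∀ g, IsBounded (fun f => P f g)
  right : ∀ f, IsBounded (P f)
  bound : ∃ c, ∀ s t f g, VanishesBelow s f → VanishesBelow t g → VanishesBelow (s + t + c) (P f g)

namespace IsBounded₂

variable {P : LaurentSeries A → LaurentSeries B → LaurentSeries D}

/-- The bilinear maps `C_r` of the expansion `P f g = ∑ ν^r C_r(f, g)`. -/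
def coeffMap (h : IsBounded₂ P) (r : ℤ) : A →ₗ[ℂ] B →ₗ[ℂ] D :=
  LinearMap.mk₂ ℂ (fun a b => (P (C a) (C b)).coeff r)
    (fun a a' b => by rw [map_add, (h.left _).add, coeff_add])
    (fun c a b => by
      rw [C_smul, (h.left _).smul, coeff_smul])
    (fun a b b' => by rw [map_add, (h.right _).add, coeff_add])
    (fun c a b => by
      rw [C_smul, (h.right _).smul, coeff_smul])

@[simp] lemma coeffMap_apply (h : IsBounded₂ P) (r : ℤ) (a : A) (b : B) :
    h.coeffMap r a b = (P (C a) (C b)).coeff r := rfl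

lemma coeffMap_eq_zero (h : IsBounded₂ P) {c : ℤ}
    (hc : ∀ s t f g, VanishesBelow s f → VanishesBelow t g → VanishesBelow (s + t + c) (P f g))
    {r : ℤ} (hr : r < c) : h.coeffMap r = 0 := by
  ext a b
  exact hc 0 0 _ _ (vanishesBelow_C a) (vanishesBelow_C b) r (by omega)

lemma coeff_eq (h : IsBounded₂ P) {c : ℤ}
    (hc : ∀ s t f g, VanishesBelow s f → VanishesBelow t g → VanishesBelow (s + t + c) (P f g))
    {s t : ℤ} {f : LaurentSeries A} {g : LaurentSeries B} (hf : VanishesBelow s f)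
    (hg : VanishesBelow t g) (n : ℤ) :
    (P f g).coeff n = ∑ k ∈ Finset.Icc s (n - t - c), ∑ l ∈ Finset.Icc t (n - k - c),
      h.coeffMap (n - k - l) (f.coeff k) (g.coeff l) := by
  have h1 := (h.left g).coeff_eq (c := t + c)
    (fun s f hf => by rw [← add_assoc]; exact hc _ _ _ _ hf hg) hf n
  rw [h1, sub_add_eq_sub_sub]
  refine Finset.sum_congr rfl fun k _ => ?_
  rw [(h.right (C (f.coeff k))).coeff_eq (c := c) (fun s g hg => by
    simpa using hc 0 s _ _ (vanishesBelow_C _) hg) hg]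
  rfl

lemma coeff_eq_finsum (h : IsBounded₂ P) (f : LaurentSeries A) (g : LaurentSeries B) (n : ℤ) :
    (P f g).coeff n =
      ∑ᶠ p : ℤ × ℤ, h.coeffMap (n - p.1 - p.2) (f.coeff p.1) (g.coeff p.2) := by
  obtain ⟨c, hc⟩ := h.bound
  obtain ⟨s, hs⟩ := exists_vanishesBelow f
  obtain ⟨t, ht⟩ := exists_vanishesBelow g
  rw [h.coeff_eq hc hs ht, finsum_eq_sum_of_support_subset (s := (Finset.Icc s (n - t - c)).sigma
    (fun k => Finset.Icc t (n - k - c)) |>.map (Equiv.sigmaEquivProd ℤ ℤ).toEmbedding)]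
  · rw [Finset.sum_map, Finset.sum_sigma]; rfl
  · rintro ⟨k, l⟩ hkl
    rw [Function.mem_support] at hkl
    have h1 : s ≤ k := not_lt.1 fun hk => hkl (by simp only [hs k hk]; simp)
    have h2 : t ≤ l := not_lt.1 fun hk => hkl (by dsimp only; rw [ht l hk, map_zero])
    have h3 : c ≤ n - k - l := not_lt.1 fun hk => hkl (by
      simp only [h.coeffMap_eq_zero hc hk]; simp)
    simp
    omega

end IsBounded₂

lemma coeffMap_hasExpansion {P : LaurentSeries A → LaurentSeries A → LaurentSeries A}
    (h : IsBounded₂ P) {c : ℤ} (hc : ∀ r < c, h.coeffMap r = 0) : HasExpansion P h.coeffMap c :=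
  ⟨hc, h.coeff_eq_finsum⟩

lemma HasExpansion.coeff_eq {P : LaurentSeries A → LaurentSeries A → LaurentSeries A}
    {K : ℤ → (A →ₗ[ℂ] A →ₗ[ℂ] A)} {c : ℤ} (h : HasExpansion P K c) {s t : ℤ}
    {f g : LaurentSeries A} (hf : VanishesBelow s f) (hg : VanishesBelow t g) (n : ℤ) :
    (P f g).coeff n = ∑ k ∈ Finset.Icc s (n - t - c), ∑ l ∈ Finset.Icc t (n - s - c),
      K (n - k - l) (f.coeff k) (g.coeff l) := by
  rw [h.2, finsum_eq_sum_of_support_subset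
    (s := Finset.Icc s (n - t - c) ×ˢ Finset.Icc t (n - s - c)), Finset.sum_product]
  rintro ⟨k, l⟩ hkl
  rw [Function.mem_support] at hkl
  have h1 : s ≤ k := not_lt.1 fun hk => hkl (by simp only [hf k hk]; simp)
  have h2 : t ≤ l := not_lt.1 fun hk => hkl (by simp only [hg l hk]; simp)
  have h3 : c ≤ n - k - l := not_lt.1 fun hk => hkl (by
    simp only [h.1 _ hk]; simp)
  simp
  omega

lemma HasExpansion.isBounded₂ {P : LaurentSeries A → LaurentSeries A → LaurentSeries A}
    {K : ℤ → (A →ₗ[ℂ] A →ₗ[ℂ] A)} {c : ℤ} (h : HasExpansion P K c) : IsBounded₂ P := by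
  have hb : ∀ s t f g, VanishesBelow s f → VanishesBelow t g →
      VanishesBelow (s + t + c) (P f g) := by
    intro s t f g hf hg n hn
    rw [h.coeff_eq hf hg, Finset.Icc_eq_empty (by omega), Finset.sum_empty]
  refine ⟨fun g => ?_, fun f => ?_, c, hb⟩
  · obtain ⟨t, ht⟩ := exists_vanishesBelow g
    refine ⟨fun f f' => ?_, fun a f => ?_, fun k f => ?_, t + c, fun s f hf => ?_⟩
    · obtain ⟨s, hs⟩ := exists_vanishesBelow f
      obtain ⟨s', hs'⟩ := exists_vanishesBelow f'
      have hs := hs.mono (min_le_left s s')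
      have hs' := hs'.mono (min_le_right s s')
      ext n
      rw [coeff_add, h.coeff_eq hs ht, h.coeff_eq hs' ht, h.coeff_eq (hs.add hs') ht]
      simp only [coeff_add, map_add, LinearMap.add_apply, Finset.sum_add_distrib]
    · obtain ⟨s, hs⟩ := exists_vanishesBelow f
      ext n
      rw [coeff_smul, h.coeff_eq hs ht,
        h.coeff_eq (s := s) (fun n hn => by simp [hs n hn]) ht]
      simp only [coeff_smul, map_smul, LinearMap.smul_apply, Finset.smul_sum]
    · ext n
      rw [coeff_shift, h.2, h.2]
      refine finsum_eq_of_bijective (fun p : ℤ × ℤ => (p.1 - k, p.2)) ?_ fun p => ?_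
      · exact ((Equiv.subRight k).prodCongr (Equiv.refl ℤ)).bijective
      · simp only [coeff_shift]; congr 3; ring
    · rw [← add_assoc]; exact hb _ _ _ _ hf ht
  · obtain ⟨s, hs⟩ := exists_vanishesBelow f
    refine ⟨fun g g' => ?_, fun a g => ?_, fun k g => ?_, s + c, fun t g hg => ?_⟩
    · obtain ⟨t, ht⟩ := exists_vanishesBelow g
      obtain ⟨t', ht'⟩ := exists_vanishesBelow g'
      have ht := ht.mono (min_le_left t t')
      have ht' := ht'.mono (min_le_right t t')
      ext n
      rw [coeff_add, h.coeff_eq hs ht, h.coeff_eq hs ht', h.coeff_eq hs (ht.add ht')]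
      simp only [coeff_add, map_add, Finset.sum_add_distrib]
    · obtain ⟨t, ht⟩ := exists_vanishesBelow g
      ext n
      rw [coeff_smul, h.coeff_eq hs ht,
        h.coeff_eq (t := t) hs (fun n hn => by simp [ht n hn])]
      simp only [coeff_smul, map_smul, Finset.smul_sum]
    · ext n
      rw [coeff_shift, h.2, h.2]
      refine finsum_eq_of_bijective (fun p : ℤ × ℤ => (p.1, p.2 - k)) ?_ fun p => ?_
      · exact ((Equiv.refl ℤ).prodCongr (Equiv.subRight k)).bijective
      · simp only [coeff_shift]; congr 3; ring
    · exact (hb _ _ _ _ hs hg).mono (by omega)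

/-- Evaluation on constant series isolates each term, so the maps of an expansion are unique. -/
lemma HasExpansion.coeffMap_eq {P : LaurentSeries A → LaurentSeries A → LaurentSeries A}
    {K : ℤ → (A →ₗ[ℂ] A →ₗ[ℂ] A)} {c : ℤ} (h : HasExpansion P K c) (r : ℤ) :
    h.isBounded₂.coeffMap r = K r := by
  ext a b
  rw [IsBounded₂.coeffMap_apply, h.2, finsum_eq_single _ ((0, 0) : ℤ × ℤ)]
  · simp
  · rintro ⟨k, l⟩ hkl
    by_cases hk : k = 0
    · have hl : l ≠ 0 := fun hl => hkl (by rw [hk, hl])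
      simp [C_apply, coeff_single_of_ne hl]
    · simp [C_apply, coeff_single_of_ne hk]

/-! ### Formal operators -/

/-- The action of a formal series of operators on formal Laurent series. -/
def act (T : LaurentSeries (Module.End ℂ A)) (g : LaurentSeries A) : LaurentSeries A :=
  (HahnModule.of (Module.End ℂ A)).symm (T • HahnModule.of (Module.End ℂ A) g)

lemma coeff_act {T : LaurentSeries (Module.End ℂ A)} {g : LaurentSeries A} {s t : ℤ}
    (hT : VanishesBelow s T) (hg : VanishesBelow t g) (n : ℤ) :
    (act T g).coeff n = ∑ k ∈ Finset.Icc s (n - t), T.coeff k (g.coeff (n - k)) :=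
  coeff_smul_Icc hT hg n

lemma act_mul (S T : LaurentSeries (Module.End ℂ A)) (g : LaurentSeries A) :
    act (S * T) g = act S (act T g) := by
  exact congrArg (HahnModule.of _).symm
    (mul_smul S T (HahnModule.of (Module.End ℂ A) g : HahnModule ℤ (Module.End ℂ A) A))

lemma act_one (g : LaurentSeries A) : act 1 g = g := by
  simp only [act, one_smul, Equiv.symm_apply_apply]

lemma act_add (S T : LaurentSeries (Module.End ℂ A)) (g : LaurentSeries A) :
    act (S + T) g = act S g + act T g := by
  simp only [act, add_smul, HahnModule.of_symm_add]

lemma coeff_act_C (T : LaurentSeries (Module.End ℂ A)) (a : A) (n : ℤ) :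
    (act T (C a)).coeff n = T.coeff n a := by
  obtain ⟨s, hs⟩ := exists_vanishesBelow T
  rw [coeff_act hs (vanishesBelow_C a)]
  by_cases hn : s ≤ n
  · rw [Finset.sum_eq_single_of_mem n (by simp [hn])]
    · simp
    · intro k _ hk
      rw [C_apply, coeff_single_of_ne (by omega), map_zero]
  · rw [hs n (by omega), Finset.Icc_eq_empty (by omega)]; simp

lemma act_isBounded (T : LaurentSeries (Module.End ℂ A)) : IsBounded (act T) := by
  obtain ⟨c, hc⟩ := exists_vanishesBelow T
  refine ⟨fun f g => ?_, fun a f => ?_, fun k f => ?_, c, fun s f hf n hn => ?_⟩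
  · simp only [act, HahnModule.of_add, smul_add, HahnModule.of_symm_add]
  · obtain ⟨s, hs⟩ := exists_vanishesBelow f
    ext n
    rw [coeff_smul, coeff_act hc hs, coeff_act (t := s) hc (fun n hn => by simp [hs n hn])]
    simp only [coeff_smul, map_smul, Finset.smul_sum]
  · obtain ⟨s, hs⟩ := exists_vanishesBelow f
    ext n
    rw [coeff_shift, coeff_act hc hs, coeff_act hc (hs.shift k)]
    rw [show n - k - s = n - (k + s) by ring]
    refine Finset.sum_congr rfl fun l _ => ?_
    rw [coeff_shift]; congr 2; ring
  · rw [coeff_act hc hf, Finset.Icc_eq_empty (by omega), Finset.sum_empty]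

lemma act_ext {S T : LaurentSeries (Module.End ℂ A)} (h : ∀ a : A, act S (C a) = act T (C a)) :
    S = T := by
  ext n a
  rw [← coeff_act_C, h, coeff_act_C]

/-- The formal operator given by a bounded `ν`-linear map. -/
def IsBounded.toOp {Φ : LaurentSeries A → LaurentSeries A} (h : IsBounded Φ) :
    LaurentSeries (Module.End ℂ A) :=
  ofSuppBddBelow (fun k =>
    { toFun := fun a => (Φ (C a)).coeff k
      map_add' := fun a b => by rw [map_add, h.add, coeff_add]
      map_smul' := fun c a => by
        rw [C_smul, h.smul, coeff_smul]; rfl }) (by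
    obtain ⟨c, hc⟩ := h.bound
    refine ⟨c, fun k hk => not_lt.1 fun hkc => hk ?_⟩
    ext a
    exact hc 0 _ (vanishesBelow_C a) k (by omega))

lemma IsBounded.toOp_coeff {Φ : LaurentSeries A → LaurentSeries A} (h : IsBounded Φ) (k : ℤ)
    (a : A) : h.toOp.coeff k a = (Φ (C a)).coeff k := rfl

lemma IsBounded.act_toOp {Φ : LaurentSeries A → LaurentSeries A} (h : IsBounded Φ)
    (f : LaurentSeries A) : act h.toOp f = Φ f := by
  refine (act_isBounded _).ext h (fun a => ?_) f
  ext n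
  rw [coeff_act_C, toOp_coeff]

/-- Multiplication from the left by a formal function, as a formal operator. -/
def mulOp : LaurentSeries A →+* LaurentSeries (Module.End ℂ A) where
  toFun f := f.map (Algebra.lmul ℂ A)
  map_one' := by ext n a; simp [coeff_one]
  map_mul' f g := by
    obtain ⟨s, hs⟩ := exists_vanishesBelow f
    obtain ⟨t, ht⟩ := exists_vanishesBelow g
    ext1; ext1 n
    rw [coeff_mul_Icc (hs.map _) (ht.map _), HahnSeries.map_coeff, coeff_mul_Icc hs ht,
      _root_.map_sum]
    exact Finset.sum_congr rfl fun k _ => _root_.map_mul (Algebra.lmul ℂ A) _ _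
  map_zero' := by ext; simp
  map_add' f g := by ext; simp

lemma mulOp_coeff (f : LaurentSeries A) (n : ℤ) :
    (mulOp f).coeff n = LinearMap.mulLeft ℂ (f.coeff n) := rfl

lemma act_mulOp (f g : LaurentSeries A) : act (mulOp f) g = f * g := by
  refine (act_isBounded _).ext (IsBounded.mul_left f) (fun a => ?_) g
  ext n
  rw [coeff_act_C, coeff_mul_C]; rfl

end Laurent

/-! ### Operators on a commutative algebra with trivial grading -/

section Commutative

variable {A : Type*} [CommRing A] [Algebra ℂ A]

lemma isParity_id : IsParity (LinearMap.id : A →ₗ[ℂ] A) :=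
  ⟨fun _ _ => rfl, fun _ => rfl, fun _ _ => mul_comm _ _, fun _ _ => mul_comm _ _⟩

lemma superComm_id (f : A) (X : Module.End ℂ A) :
    @Eq (Module.End ℂ A) (superComm LinearMap.id f X)
      (LinearMap.mulLeft ℂ f * X - X * LinearMap.mulLeft ℂ f) :=
  superComm_of_even rfl X

/-- The order filtration for the trivial grading. -/
abbrev ordId (A : Type*) [CommRing A] [Algebra ℂ A] (k : ℤ) : Submodule ℂ (Module.End ℂ A) :=
  ordSubmodule LinearMap.id k

/-- The associated graded algebra of the order filtration is commutative. Induction on `k + l` by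
the Jacobi identity ends at order zero, where both operators are multiplications. -/
lemma commutator_mem_ordId {k l : ℤ} {X Y : Module.End ℂ A} (hX : X ∈ ordId A k)
    (hY : Y ∈ ordId A l) : X * Y - Y * X ∈ ordId A (k + l - 1) := by
  rcases lt_or_ge k 0 with hk | hk
  · rw [(mem_ord_neg hk).1 hX, zero_mul, mul_zero, sub_zero]; exact zero_mem _
  rcases lt_or_ge l 0 with hl | hl
  · rw [(mem_ord_neg hl).1 hY, zero_mul, mul_zero, sub_zero]; exact zero_mem _
  obtain ⟨n, hn⟩ : ∃ n : ℕ, (n : ℤ) = k + l := ⟨(k + l).toNat, by omega⟩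
  induction n using Nat.strong_induction_on generalizing k l X Y with
  | _ n ih =>
  have aux {k' l' : ℤ} {X' Y' : Module.End ℂ A} (hX' : X' ∈ ordId A k')
      (hY' : Y' ∈ ordId A l') (hkl : k' + l' = k + l - 1) :
      X' * Y' - Y' * X' ∈ ordId A (k + l - 1 - 1) := by
    rcases lt_or_ge k' 0 with hk' | hk'
    · rw [(mem_ord_neg hk').1 hX', zero_mul, mul_zero, sub_zero]; exact zero_mem _
    rcases lt_or_ge l' 0 with hl' | hl'
    · rw [(mem_ord_neg hl').1 hY', zero_mul, mul_zero, sub_zero]; exact zero_mem _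
    rw [← hkl]
    exact ih (k' + l').toNat (by omega) hX' hY' hk' hl' (by omega)
  by_cases h0 : k + l = 0
  · obtain rfl : k = 0 := by omega
    obtain rfl : l = 0 := by omega
    suffices X * Y - Y * X = 0 by rw [this]; exact zero_mem _
    ext f
    simp only [LinearMap.sub_apply, Module.End.mul_apply, LinearMap.zero_apply]
    rw [eq_mulLeft_of_mem_ord_zero isParity_id hX (Y f),
      eq_mulLeft_of_mem_ord_zero isParity_id hY f,
      eq_mulLeft_of_mem_ord_zero isParity_id hY (X f),
      eq_mulLeft_of_mem_ord_zero isParity_id hX f]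
    ring
  rw [ordId, mem_ord_iff (by omega)]
  intro f
  have h1 := aux (superComm_mem_ord hX f) hY (by ring)
  have h2 := aux hX (superComm_mem_ord hY f) (by ring)
  rw [superComm_id] at h1 h2 ⊢
  -- The Jacobi identity `[f, [X, Y]] = [[f, X], Y] + [X, [f, Y]]`.
  convert add_mem h1 h2 using 1
  simp only [mul_sub, sub_mul, mul_assoc]
  abel

/-- A family of functions such that derivations vanishing on it are zero. -/
def IsCoordinateFamily {ι : Type*} (x : ι → A) : Prop :=
  ∀ D : A →ₗ[ℂ] A, (∀ f g, D (f * g) = f * D g + g * D f) → (∀ i, D (x i) = 0) → D = 0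

/-- For `n = 0`, the commutator `[f, X]` is multiplication by `D f` for a derivation `D` that
vanishes on the coordinates, so `D = 0`. For larger `n` the operators `[f, X]` inherit the
hypotheses, because commutators with `f` and with `x i` commute. -/
lemma IsCoordinateFamily.mem_ordId_of_succ {ι : Type*} {x : ι → A} (hx : IsCoordinateFamily x)
    (n : ℕ) {X : Module.End ℂ A} (hX : X ∈ ordId A (n + 1))
    (h : ∀ i, superComm LinearMap.id (x i) X ∈ ordId A (n - 1)) : X ∈ ordId A n := by
  induction n generalizing X with
  | zero =>
    rw [ordId, mem_ord_iff (by simp)]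
    intro f
    rw [mem_ord_neg (by simp)]
    have hX' (f : A) (g : A) : superComm LinearMap.id f X g = superComm LinearMap.id f X 1 * g :=
      eq_mulLeft_of_mem_ord_zero isParity_id (by simpa using superComm_mem_ord hX f) g
    let D : A →ₗ[ℂ] A :=
      { toFun := fun f => superComm LinearMap.id f X 1
        map_add' := fun f g => by rw [superComm_add_left]; rfl
        map_smul' := fun c f => by
          simp only [superComm_id, LinearMap.sub_apply, Module.End.mul_apply,
            LinearMap.mulLeft_apply, smul_mul_assoc, map_smul, RingHom.id_apply, smul_sub] }
    have hD : D = 0 := by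
      refine hx D (fun f g => ?_) fun i => ?_
      · change superComm LinearMap.id (f * g) X 1 =
          f * superComm LinearMap.id g X 1 + g * superComm LinearMap.id f X 1
        rw [mul_comm g, ← hX' f g]
        simp only [superComm_id, LinearMap.sub_apply, Module.End.mul_apply,
          LinearMap.mulLeft_apply, mul_one]
        ring
      · change superComm LinearMap.id (x i) X 1 = 0
        rw [(mem_ord_neg (by simp)).1 (h i)]; rfl
    ext g
    rw [hX', show superComm LinearMap.id f X 1 = D f from rfl, hD]; simp
  | succ n ih =>
    rw [ordId, mem_ord_iff (by positivity)]
    intro f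
    rw [show ((n + 1 : ℕ) : ℤ) - 1 = n by push_cast; ring]
    refine ih ?_ fun i => ?_
    · have := superComm_mem_ord hX f
      rwa [show ((n + 1 : ℕ) : ℤ) + 1 - 1 = n + 1 by push_cast; ring] at this
    · have := superComm_mem_ord (h i) f
      rw [show ((n + 1 : ℕ) : ℤ) - 1 - 1 = n - 1 by push_cast; ring] at this
      convert this using 1
      have hc : LinearMap.mulLeft ℂ f * LinearMap.mulLeft ℂ (x i)
          = LinearMap.mulLeft ℂ (x i) * LinearMap.mulLeft ℂ f := by
        ext g; simp [mul_left_comm]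
      have hc' : X * LinearMap.mulLeft ℂ f * LinearMap.mulLeft ℂ (x i)
          = X * LinearMap.mulLeft ℂ (x i) * LinearMap.mulLeft ℂ f := by
        rw [mul_assoc, hc, mul_assoc]
      simp only [superComm_id, mul_sub, sub_mul, ← mul_assoc, hc, hc']
      abel

/-- The a priori order `N` is arbitrary; it is lowered to `n` one unit at a time. -/
lemma IsCoordinateFamily.mem_ordId {ι : Type*} {x : ι → A} (hx : IsCoordinateFamily x)
    {n : ℤ} (hn : 0 ≤ n) {X : Module.End ℂ A} (hX : ∃ N, OrderLE LinearMap.id N X)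
    (h : ∀ i, superComm LinearMap.id (x i) X ∈ ordId A (n - 1)) : X ∈ ordId A n := by
  lift n to ℕ using hn
  obtain ⟨N, hN⟩ := hX
  rw [← mem_ord_nat] at hN
  by_cases hNn : N ≤ n
  · exact ord_mono (by exact_mod_cast hNn) hN
  obtain ⟨j, rfl⟩ := Nat.exists_eq_add_of_le (not_le.1 hNn).le
  clear hNn
  induction j with
  | zero => simpa using hN
  | succ j ih =>
    refine ih (hx.mem_ordId_of_succ (n + j) (by exact_mod_cast hN) fun i => ?_)
    exact ord_mono (by push_cast; omega) (h i)

end Commutative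

/-! ### Derivations of the algebra of smooth functions -/

section Hadamard

open MeasureTheory

/-- Differentiation under the integral: the derivative is bounded on the compact product of a closed
ball and `[0, 1]`, so a constant dominates. -/
lemma hasFDerivAt_intervalIntegral_of_contDiff {E F : Type} [NormedAddCommGroup E]
    [NormedSpace ℝ E] [FiniteDimensional ℝ E] [NormedAddCommGroup F] [NormedSpace ℝ F]
    [CompleteSpace F] {H : E × ℝ → F} (hH : ContDiff ℝ ∞ H) (x : E) :
    HasFDerivAt (fun x => ∫ t in (0 : ℝ)..1, H (x, t))
      (∫ t in (0 : ℝ)..1, (fderiv ℝ H (x, t)).comp (ContinuousLinearMap.inl ℝ E ℝ)) x := by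
  have hd : ContDiff ℝ ∞ fun y => (fderiv ℝ H y).comp (ContinuousLinearMap.inl ℝ E ℝ) :=
    (hH.fderiv_right (by simp)).clm_comp contDiff_const
  have hK : IsCompact (Metric.closedBall x 1 ×ˢ Set.Icc (0 : ℝ) 1) :=
    (isCompact_closedBall x 1).prod isCompact_Icc
  obtain ⟨C, hC⟩ := hK.exists_bound_of_continuousOn hd.continuous.continuousOn
  refine intervalIntegral.hasFDerivAt_integral_of_dominated_of_fderiv_le
    (F' := fun x t => (fderiv ℝ H (x, t)).comp (ContinuousLinearMap.inl ℝ E ℝ))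
    (bound := fun _ => C) (Metric.closedBall_mem_nhds x one_pos) ?_ ?_ ?_ ?_ ?_ ?_
  · exact Filter.Eventually.of_forall fun y =>
      (hH.continuous.comp (by fun_prop : Continuous fun t : ℝ => (y, t))).aestronglyMeasurable
  · exact (hH.continuous.comp (by fun_prop : Continuous fun t : ℝ => (x, t))).intervalIntegrable _ _
  · exact (hd.continuous.comp
      (by fun_prop : Continuous fun t : ℝ => (x, t))).aestronglyMeasurable
  · refine Filter.Eventually.of_forall fun t ht y hy => hC (y, t) ⟨hy, ?_⟩
    rw [Set.uIoc_of_le zero_le_one] at ht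
    exact Set.Ioc_subset_Icc_self ht
  · exact intervalIntegrable_const
  · refine Filter.Eventually.of_forall fun t _ y _ => ?_
    exact ((hH.differentiable (by simp)) (y, t)).hasFDerivAt.comp y
      (hasFDerivAt_prodMk_left y t)

/-- The target `F` varies in the induction because the derivative is an integral of the same kind
with values in `E →L[ℝ] F`. -/
lemma contDiff_intervalIntegral {E : Type} [NormedAddCommGroup E]
    [NormedSpace ℝ E] [FiniteDimensional ℝ E] (n : ℕ) {F : Type} [NormedAddCommGroup F]
    [NormedSpace ℝ F] [CompleteSpace F] {H : E × ℝ → F} (hH : ContDiff ℝ ∞ H) :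
    ContDiff ℝ n (fun x => ∫ t in (0 : ℝ)..1, H (x, t)) := by
  induction n generalizing F with
  | zero =>
    rw [Nat.cast_zero, contDiff_zero]
    exact intervalIntegral.continuous_parametric_intervalIntegral_of_continuous'
      (f := fun x t => H (x, t)) hH.continuous 0 1
  | succ n ih =>
    rw [Nat.cast_succ, contDiff_succ_iff_hasFDerivAt]
    exact ⟨_, ih ((hH.fderiv_right (by simp)).clm_comp contDiff_const),
      hasFDerivAt_intervalIntegral_of_contDiff hH⟩

/-- Hadamard's lemma. -/
lemma exists_hadamard {E F : Type} [NormedAddCommGroup E] [NormedSpace ℝ E]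
    [FiniteDimensional ℝ E] [NormedAddCommGroup F] [NormedSpace ℝ F] [CompleteSpace F] {G : E → F}
    (hG : ContDiff ℝ ∞ G) (p : E) :
    ∃ Φ : E → (E →L[ℝ] F), ContDiff ℝ ∞ Φ ∧ ∀ x, G x = G p + Φ x (x - p) := by
  have hH : ContDiff ℝ ∞ fun y : E × ℝ => fderiv ℝ G (p + y.2 • (y.1 - p)) :=
    (hG.fderiv_right (m := ∞) (by simp)).comp (by fun_prop)
  -- The mean of the derivative of `G` along the segment from `p` to `x`; the fundamental theorem of
  -- calculus gives the identity.
  refine ⟨fun x => ∫ t in (0 : ℝ)..1, fderiv ℝ G (p + t • (x - p)),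
    contDiff_infty.2 fun n => contDiff_intervalIntegral n hH, fun x => ?_⟩
  have hc : Continuous fun t : ℝ => fderiv ℝ G (p + t • (x - p)) :=
    hH.continuous.comp (by fun_prop : Continuous fun t : ℝ => (x, t))
  rw [ContinuousLinearMap.intervalIntegral_apply (hc.intervalIntegrable _ _)]
  have h := intervalIntegral.integral_eq_sub_of_hasDerivAt
    (f := fun t : ℝ => G (p + t • (x - p))) (f' := fun t => fderiv ℝ G (p + t • (x - p)) (x - p))
    (a := 0) (b := 1) (fun t _ => ?_) ((hc.clm_apply continuous_const).intervalIntegrable _ _)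
  · rw [h]; simp
  · have h1 : HasDerivAt (fun t : ℝ => p + t • (x - p)) (x - p) t := by
      simpa using ((hasDerivAt_id t).smul_const (x - p)).const_add p
    exact ((hG.differentiable (by simp)) _).hasFDerivAt.comp_hasDerivAt t h1

end Hadamard

/-! ### The coordinates `z`, `zbar` determine derivations of `C^∞(U)` -/

section Coordinates

variable {m : ℕ} {U : TopologicalSpace.Opens (Fin m → ℂ)}

/-- The holomorphic coordinate `z^k`. -/
def coordZ (U : TopologicalSpace.Opens (Fin m → ℂ)) (k : Fin m) : Smooth U :=
  ⟨fun x => x.1 k, fun x => x k, by fun_prop, fun _ => rfl⟩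

/-- The antiholomorphic coordinate `zbar^k`. -/
def coordZbar (U : TopologicalSpace.Opens (Fin m → ℂ)) (k : Fin m) : Smooth U :=
  ⟨fun x => starRingEnd ℂ (x.1 k), fun x => starRingEnd ℂ (x k),
    (Complex.conjCLE.contDiff.comp (contDiff_apply ℝ ℂ k)).contDiffOn, fun _ => rfl⟩

/-- The restriction of a globally defined smooth function. -/
def restrictSmooth (U : TopologicalSpace.Opens (Fin m → ℂ)) (F : (Fin m → ℂ) → ℂ)
    (hF : ContDiff ℝ ∞ F) : Smooth U :=
  ⟨fun x => F x, F, hF.contDiffOn, fun _ => rfl⟩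

/-- Hadamard's real-linear `Φ x` is split, coordinate by coordinate, into its complex linear and
antilinear parts, as for the Wirtinger derivatives. -/
lemma exists_coordinate_expansion {G : (Fin m → ℂ) → ℂ} (hG : ContDiff ℝ ∞ G) (p : Fin m → ℂ) :
    ∃ g h : Fin m → (Fin m → ℂ) → ℂ, (∀ k, ContDiff ℝ ∞ (g k)) ∧ (∀ k, ContDiff ℝ ∞ (h k)) ∧
      ∀ x, G x = G p + ∑ k, (g k x * (x k - p k) + h k x * starRingEnd ℂ (x k - p k)) := by
  obtain ⟨Φ, hΦ, hΦG⟩ := exists_hadamard hG p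
  have hs (v : Fin m → ℂ) : ContDiff ℝ ∞ fun x => Φ x v := hΦ.clm_apply contDiff_const
  refine ⟨fun k x => (Φ x (Pi.single k 1) - Complex.I * Φ x (Pi.single k Complex.I)) / 2,
    fun k x => (Φ x (Pi.single k 1) + Complex.I * Φ x (Pi.single k Complex.I)) / 2,
    fun k => ?_, fun k => ?_, fun x => ?_⟩
  · exact ((hs _).sub (contDiff_const.mul (hs _))).div_const 2
  · exact ((hs _).add (contDiff_const.mul (hs _))).div_const 2
  · rw [hΦG x]
    congr 1
    have hx : x - p = ∑ k, ((x k - p k).re • (Pi.single k 1 : Fin m → ℂ)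
        + (x k - p k).im • (Pi.single k Complex.I : Fin m → ℂ)) := by
      ext j
      rw [Finset.sum_apply, Finset.sum_eq_single j]
      · simp only [Pi.sub_apply, Pi.add_apply, Pi.smul_apply, Pi.single_eq_same, Complex.real_smul,
          mul_one]
        exact (Complex.re_add_im _).symm
      · intro k _ hk
        simp [Pi.single_eq_of_ne hk.symm]
      · simp
    rw [hx, map_sum]
    refine Finset.sum_congr rfl fun k _ => ?_
    simp only [map_add, map_smul, Complex.real_smul]
    generalize x k - p k = w
    conv_rhs => rw [← Complex.re_add_im w]
    simp only [map_add, map_mul, Complex.conj_ofReal, Complex.conj_I]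
    linear_combination ((w.im : ℂ) * Φ x (Pi.single k Complex.I)) * Complex.I_sq

/-- Near `p`, split `f - f(p)` by a bump function `χ`. The part with factor `1 - χ` is a product of
two functions vanishing at `p`, so a derivation of it vanishes there. The part with factor `χ`
extends smoothly by zero to the whole space, where Hadamard's lemma expands it in `z - z(p)` and
`zbar - zbar(p)`. -/
lemma isCoordinateFamily_coord (U : TopologicalSpace.Opens (Fin m → ℂ)) :
    IsCoordinateFamily (Sum.elim (coordZ U) (coordZbar U)) := by
  intro D hD h0
  have hD1 : D 1 = 0 := by
    have := hD 1 1
    simpa using this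
  have hDc (c : ℂ) : D (algebraMap ℂ (Smooth U) c) = 0 := by
    rw [Algebra.algebraMap_eq_smul_one, map_smul, hD1, smul_zero]
  ext f p
  obtain ⟨F, hF, hFf⟩ := f.2
  obtain ⟨ε, hε, hball⟩ := Metric.isOpen_iff.1 U.isOpen p.1 p.2
  -- The outer radius `ε / 2` keeps the closed support inside the ball of radius `ε`, which lies in
  -- `U`.
  let χ : ContDiffBump p.1 := ⟨ε / 3, ε / 2, by positivity, by linarith⟩
  have hG : ContDiff ℝ ∞ fun x => ((χ x : ℝ) : ℂ) * (F x - F p) := by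
    have hχ : ContDiff ℝ ∞ fun x => ((χ x : ℝ) : ℂ) :=
      Complex.ofRealCLM.contDiff.comp χ.contDiff
    rw [contDiff_iff_contDiffAt]
    intro x
    by_cases hx : x ∈ Metric.ball p.1 ε
    · exact hχ.contDiffAt.mul ((hF.contDiffAt (U.isOpen.mem_nhds (hball hx))).sub contDiffAt_const)
    · refine (contDiffAt_const (c := (0 : ℂ))).congr_of_eventuallyEq ?_
      have hx' : x ∉ tsupport χ := by
        rw [χ.tsupport_eq]
        intro h
        refine hx (Metric.closedBall_subset_ball (by change ε / 2 < ε; linarith) h)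
      filter_upwards [(isClosed_tsupport χ).isOpen_compl.mem_nhds hx'] with y hy
      rw [image_eq_zero_of_notMem_tsupport hy]; simp
  have hχ : ContDiff ℝ ∞ fun x => ((χ x : ℝ) : ℂ) :=
    Complex.ofRealCLM.contDiff.comp χ.contDiff
  obtain ⟨g, h, hg, hh, hgh⟩ := exists_coordinate_expansion hG p.1
  let c : Smooth U := f - algebraMap ℂ (Smooth U) (F p)
  have hc : c.1 p = 0 := by
    change f.1 p - F p = 0
    rw [← hFf p, sub_self]
  let X : Smooth U := restrictSmooth U _ hχ
  have hX : X.1 p = 1 := by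
    change ((χ p.1 : ℝ) : ℂ) = 1
    rw [χ.one_of_mem_closedBall]; · simp
    · exact Metric.mem_closedBall_self (by change 0 ≤ ε / 3; positivity)
  have hXc : X * c = ∑ k, (restrictSmooth U _ (hg k) * (coordZ U k - algebraMap ℂ _ (p.1 k))
      + restrictSmooth U _ (hh k) * (coordZbar U k - algebraMap ℂ _ (starRingEnd ℂ (p.1 k)))) := by
    ext x
    have := hgh x.1
    simp only [sub_self, mul_zero, zero_add, map_sub] at this
    rw [hFf x] at this
    simp only [AddSubmonoidClass.coe_finsetSum, Finset.sum_apply]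
    exact this
  have e1 : D f = D (X * c) + D ((1 - X) * c) := by
    rw [← map_add, ← add_mul, add_sub_cancel, one_mul, map_sub, hDc, sub_zero]
  have e2 : (D ((1 - X) * c)).1 p = 0 := by
    rw [hD]
    change (1 - X.1 p) * (D c).1 p + c.1 p * (D (1 - X)).1 p = 0
    rw [hc, hX]; ring
  have e3 : (D (X * c)).1 p = 0 := by
    rw [hXc, map_sum, AddSubmonoidClass.coe_finsetSum, Finset.sum_apply]
    refine Finset.sum_eq_zero fun k _ => ?_
    have hz := h0 (Sum.inl k)
    have hzb := h0 (Sum.inr k)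
    simp only [Sum.elim_inl, Sum.elim_inr] at hz hzb
    rw [map_add, hD, hD, map_sub, map_sub, hDc, hDc, hz, hzb, sub_zero, mul_zero, zero_add,
      mul_zero, zero_add]
    change (p.1 k - p.1 k) * _ + (starRingEnd ℂ (p.1 k) - starRingEnd ℂ (p.1 k)) * _ = 0
    ring
  rw [e1]
  change (D (X * c)).1 p + (D ((1 - X) * c)).1 p = 0
  rw [e2, e3, add_zero]

end Coordinates

/-! ### Star products with separation of variables are natural -/

section Separated

open HahnSeries

lemma gradedRight_id {A : Type*} [CommRing A] [Algebra ℂ A]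
    {P : LaurentSeries A → LaurentSeries A → LaurentSeries A} (hP : IsBounded₂ P)
    (f g : LaurentSeries A) : gradedRight LinearMap.id P f g = P g f := by
  have h1 : f.map (evenPart (LinearMap.id : A →ₗ[ℂ] A)) = f := by
    ext n; rw [map_coeff, evenPart_of_fixed rfl]
  have h2 : f.map (oddPart (LinearMap.id : A →ₗ[ℂ] A)) = 0 := by
    ext n; rw [map_coeff, oddPart_of_fixed rfl]; rfl
  rw [gradedRight, h1, h2, (hP.right _).map_zero, add_zero]

/-- Evaluation on constants shows that the operators in the definition of a formal differential
operator are the coefficients of `toOp`. -/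
lemma IsFormalDiffOp.exists_orderLE {A : Type*} [Ring A] [Algebra ℂ A] {σ : A →ₗ[ℂ] A}
    {T : LaurentSeries A → LaurentSeries A} (h : IsFormalDiffOp σ T) (hT : IsBounded T) (k : ℤ) :
    ∃ n, OrderLE σ n (hT.toOp.coeff k) := by
  obtain ⟨K, -, hK, hTK⟩ := h
  obtain ⟨n, hn⟩ := hK k
  refine ⟨n, ?_⟩
  convert hn using 1
  ext a
  rw [hT.toOp_coeff, hTK, finsum_eq_single _ k]
  · simp
  · intro j hj
    rw [C_apply, coeff_single_of_ne (by omega), map_zero]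

lemma IsStarProduct.isBounded₂ {A : Type*} [Ring A] [Algebra ℂ A] {σ : A →ₗ[ℂ] A}
    {P : LaurentSeries A → LaurentSeries A → LaurentSeries A} (h : IsStarProduct σ P) :
    IsBounded₂ P := by
  obtain ⟨K, hK, -⟩ := h.expansion
  exact hK.isBounded₂

lemma IsStarProduct.vanishesBelow {A : Type*} [Ring A] [Algebra ℂ A] {σ : A →ₗ[ℂ] A}
    {P : LaurentSeries A → LaurentSeries A → LaurentSeries A} (h : IsStarProduct σ P)
    {s t : ℤ} {f g : LaurentSeries A} (hf : VanishesBelow s f) (hg : VanishesBelow t g) :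
    VanishesBelow (s + t) (P f g) := by
  obtain ⟨K, hK, -⟩ := h.expansion
  intro n hn
  rw [hK.coeff_eq hf hg, Finset.Icc_eq_empty (by omega), Finset.sum_empty]

/-- The operator of left multiplication by a function. -/
def leftOp {A : Type*} [Ring A] [Algebra ℂ A]
    {P : LaurentSeries A → LaurentSeries A → LaurentSeries A} (h : IsBounded₂ P) (f : A) :
    LaurentSeries (Module.End ℂ A) := (h.right (C f)).toOp

/-- The operator of right multiplication by a function. -/
def rightOp {A : Type*} [Ring A] [Algebra ℂ A]
    {P : LaurentSeries A → LaurentSeries A → LaurentSeries A} (h : IsBounded₂ P) (f : A) :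
    LaurentSeries (Module.End ℂ A) := (h.left (C f)).toOp

lemma IsStarProduct.leftOp_vanishesBelow {A : Type*} [Ring A] [Algebra ℂ A] {σ : A →ₗ[ℂ] A}
    {P : LaurentSeries A → LaurentSeries A → LaurentSeries A} (h : IsStarProduct σ P) (f : A) :
    VanishesBelow 0 (leftOp h.isBounded₂ f) := fun n hn => by
  ext a
  exact h.vanishesBelow (vanishesBelow_C f) (vanishesBelow_C a) n (by omega)

lemma IsStarProduct.rightOp_vanishesBelow {A : Type*} [Ring A] [Algebra ℂ A] {σ : A →ₗ[ℂ] A}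
    {P : LaurentSeries A → LaurentSeries A → LaurentSeries A} (h : IsStarProduct σ P) (f : A) :
    VanishesBelow 0 (rightOp h.isBounded₂ f) := fun n hn => by
  ext a
  exact h.vanishesBelow (vanishesBelow_C a) (vanishesBelow_C f) n (by omega)

/-- This is associativity of the product. -/
lemma IsStarProduct.leftOp_mul_rightOp {A : Type*} [Ring A] [Algebra ℂ A] {σ : A →ₗ[ℂ] A}
    {P : LaurentSeries A → LaurentSeries A → LaurentSeries A} (h : IsStarProduct σ P) (f g : A) :
    leftOp h.isBounded₂ f * rightOp h.isBounded₂ g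
      = rightOp h.isBounded₂ g * leftOp h.isBounded₂ f := by
  refine act_ext fun a => ?_
  simp only [act_mul, leftOp, rightOp, IsBounded.act_toOp]
  rw [h.assoc]

lemma IsStarProduct.coeff_zero_eq {A : Type*} [Ring A] [Algebra ℂ A] {σ : A →ₗ[ℂ] A}
    {P : LaurentSeries A → LaurentSeries A → LaurentSeries A} (h : IsStarProduct σ P) (f g : A) :
    (P (C f) (C g)).coeff 0 = f * g := by
  obtain ⟨K, hK, -, h0⟩ := h.expansion
  rw [← h0, ← hK.coeffMap_eq]; rfl

lemma mulOp_C {A : Type*} [Ring A] [Algebra ℂ A] (a : A) :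
    mulOp (C a) = C (LinearMap.mulLeft ℂ a : Module.End ℂ A) := by
  ext1; ext1 n
  rw [mulOp_coeff, C_apply, C_apply]
  by_cases hn : n = 0
  · simp [hn]
  · rw [coeff_single_of_ne hn, coeff_single_of_ne hn]; ext; simp

variable {A κ : Type*} [CommRing A] [Algebra ℂ A] {z zb : κ → A}
  {star : LaurentSeries A → LaurentSeries A → LaurentSeries A}

/-- A star product on a commutative algebra with coordinates `z` and `zb` such that `z ⋆ f = z f`
and `f ⋆ zb = f zb`. -/
structure IsCoordSeparated (z zb : κ → A)
    (star : LaurentSeries A → LaurentSeries A → LaurentSeries A) : Prop extends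
    IsStarProduct LinearMap.id star where
  coord : IsCoordinateFamily (Sum.elim z zb)
  coord_mul : ∀ k f, star (C (z k)) f = C (z k) * f
  mul_coord : ∀ k f, star f (C (zb k)) = f * C (zb k)

namespace IsCoordSeparated

lemma leftOp_coord (h : IsCoordSeparated z zb star) (k : κ) :
    leftOp h.isBounded₂ (z k) = mulOp (C (z k)) := by
  refine act_ext fun a => ?_
  rw [act_mulOp, leftOp, IsBounded.act_toOp, h.coord_mul]

lemma rightOp_coord (h : IsCoordSeparated z zb star) (k : κ) :
    rightOp h.isBounded₂ (zb k) = mulOp (C (zb k)) := by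
  refine act_ext fun a => ?_
  rw [act_mulOp, rightOp, IsBounded.act_toOp, mul_comm, h.mul_coord]

/-- Right multiplication by `zb k` is the ordinary one and commutes with left multiplication by `f`.
Thus the latter differentiates only in the `z` directions. -/
lemma superComm_zbar_left (h : IsCoordSeparated z zb star) (f : A) (k : κ) (r : ℤ) :
    superComm LinearMap.id (zb k) ((leftOp h.isBounded₂ f).coeff r) = 0 := by
  have := congrArg (fun T => T.coeff r) (h.leftOp_mul_rightOp f (zb k))
  rw [h.rightOp_coord, mulOp_C] at this
  simp only [coeff_mul_C, coeff_C_mul] at this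
  rw [superComm_id, this, sub_self]

lemma superComm_z_right (h : IsCoordSeparated z zb star) (f : A) (k : κ) (r : ℤ) :
    superComm LinearMap.id (z k) ((rightOp h.isBounded₂ f).coeff r) = 0 := by
  have := congrArg (fun T => T.coeff r) (h.leftOp_mul_rightOp (z k) f)
  rw [h.leftOp_coord, mulOp_C] at this
  simp only [coeff_mul_C, coeff_C_mul] at this
  rw [superComm_id, this, sub_self]

lemma exists_orderLE_left (h : IsCoordSeparated z zb star) (f : A) (r : ℤ) :
    ∃ n, OrderLE LinearMap.id n ((leftOp h.isBounded₂ f).coeff r) :=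
  (h.left_diff f).exists_orderLE _ r

lemma exists_orderLE_right (h : IsCoordSeparated z zb star) (f : A) (r : ℤ) :
    ∃ n, OrderLE LinearMap.id n ((rightOp h.isBounded₂ f).coeff r) := by
  have h1 := h.right_diff f
  rw [show gradedRight LinearMap.id star (C f) = fun g => star g (C f) from
    funext fun g => gradedRight_id h.isBounded₂ _ _] at h1
  exact h1.exists_orderLE _ r

lemma left_coeff_zero (h : IsCoordSeparated z zb star) (f : A) :
    (leftOp h.isBounded₂ f).coeff 0 = LinearMap.mulLeft ℂ f := by
  ext1 a; exact h.coeff_zero_eq f a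

lemma right_coeff_zero (h : IsCoordSeparated z zb star) (f : A) :
    (rightOp h.isBounded₂ f).coeff 0 = LinearMap.mulLeft ℂ f := by
  ext1 a; exact (h.coeff_zero_eq a f).trans (mul_comm _ _)

/-- The coefficient of `ν^r` in `[L_f, R_g] = 0`, the source of all the recursive estimates below.
-/
lemma sum_commutator (h : IsCoordSeparated z zb star) (f g : A) (r : ℤ) :
    ∑ k ∈ Finset.Icc 0 r, ((leftOp h.isBounded₂ f).coeff k * (rightOp h.isBounded₂ g).coeff (r - k)
      - (rightOp h.isBounded₂ g).coeff (r - k) * (leftOp h.isBounded₂ f).coeff k) = 0 := by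
  have := congrArg (fun T => T.coeff r) (h.leftOp_mul_rightOp f g)
  rw [coeff_mul_Icc (h.leftOp_vanishesBelow f) (h.rightOp_vanishesBelow g),
    coeff_mul_Icc' (h.rightOp_vanishesBelow g) (h.leftOp_vanishesBelow f), sub_zero] at this
  rw [Finset.sum_sub_distrib, this, sub_self]

/-- Commutators with the `zb k` vanish, so the order has to be tested only on the `z k`. -/
lemma mem_ordId_left_iff (h : IsCoordSeparated z zb star) (f : A) {r : ℤ} (hr : 0 ≤ r)
    (hz : ∀ k, superComm LinearMap.id (z k) ((leftOp h.isBounded₂ f).coeff r)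
      ∈ ordId A (r - 1)) :
    (leftOp h.isBounded₂ f).coeff r ∈ ordId A r := by
  refine h.coord.mem_ordId hr (h.exists_orderLE_left f r) ?_
  rintro (k | k)
  · exact hz k
  · rw [Sum.elim_inr, h.superComm_zbar_left]; exact zero_mem _

lemma mem_ordId_right_iff (h : IsCoordSeparated z zb star) (f : A) {r : ℤ} (hr : 0 ≤ r)
    (hz : ∀ k, superComm LinearMap.id (zb k) ((rightOp h.isBounded₂ f).coeff r)
      ∈ ordId A (r - 1)) :
    (rightOp h.isBounded₂ f).coeff r ∈ ordId A r := by
  refine h.coord.mem_ordId hr (h.exists_orderLE_right f r) ?_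
  rintro (k | k)
  · rw [Sum.elim_inl, h.superComm_z_right]; exact zero_mem _
  · exact hz k

lemma superComm_comm (f g : A) (X : Module.End ℂ A) :
    superComm LinearMap.id f (superComm LinearMap.id g X)
      = superComm LinearMap.id g (superComm LinearMap.id f X) := by
  ext a
  simp only [superComm_id, LinearMap.sub_apply, Module.End.mul_apply, LinearMap.mulLeft_apply]
  rw [mul_left_comm g f a]
  ring

lemma exists_orderLE_superComm (f : A) {X : Module.End ℂ A}
    (h : ∃ n, OrderLE LinearMap.id n X) :
    ∃ n, OrderLE LinearMap.id n (superComm LinearMap.id f X) := by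
  obtain ⟨n, hn⟩ := h
  exact ⟨n, orderLE_succ hn f⟩

/-- An operator in the holomorphic variables and an operator in the antiholomorphic variables
cannot cancel each other's leading terms. -/
lemma mem_ordId_of_add (hc : IsCoordinateFamily (Sum.elim z zb)) {r : ℤ} (hr : 0 ≤ r)
    {X Y : Module.End ℂ A}
    (hX : ∃ n, OrderLE LinearMap.id n X)
    (hXz : ∀ k, superComm LinearMap.id (zb k) X = 0)
    (hYz : ∀ k, superComm LinearMap.id (z k) Y = 0) (h : X + Y ∈ ordId A r) :
    X ∈ ordId A r ∧ Y ∈ ordId A r := by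
  have hx : X ∈ ordId A r := by
    refine hc.mem_ordId hr hX ?_
    rintro (k | k)
    -- The commutator with `z k` kills `Y`, so it sees only `X` in the sum.
    · have := superComm_mem_ord h (z k)
      rwa [superComm_add, hYz, add_zero] at this
    · rw [Sum.elim_inr, hXz]; exact zero_mem _
  refine ⟨hx, ?_⟩
  simpa using sub_mem_ord h hx

/-- Strong induction on `r`. In degree `r` of `[L_{zb l}, R_{z k}] = 0` the inner terms have order
at most `r - 1` by induction. The outer terms are `[z k, L_r]` and `[zb l, R_r]` up to sign; one
differentiates only along `z`, the other only along `zb`, so each of them has order at most `r - 1`.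
-/
lemma coord_ops_natural (h : IsCoordSeparated z zb star) (r : ℕ) (k l : κ) :
    (leftOp h.isBounded₂ (zb l)).coeff r ∈ ordId A r ∧
      (rightOp h.isBounded₂ (z k)).coeff r ∈ ordId A r := by
  induction r using Nat.strong_induction_on generalizing k l with
  | _ r ih =>
  rcases Nat.eq_zero_or_pos r with rfl | hr
  · simp only [Nat.cast_zero, h.left_coeff_zero, h.right_coeff_zero]
    exact ⟨mulLeft_mem_ord isParity_id _, mulLeft_mem_ord isParity_id _⟩
  have key (k l : κ) :
      superComm LinearMap.id (z k) ((leftOp h.isBounded₂ (zb l)).coeff r)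
        ∈ ordId A (r - 1) ∧
      -superComm LinearMap.id (zb l) ((rightOp h.isBounded₂ (z k)).coeff r)
        ∈ ordId A (r - 1) := by
    have hneg (f g : A) (Z : Module.End ℂ A)
        (hZ : superComm LinearMap.id f Z = 0) :
        superComm LinearMap.id f (-superComm LinearMap.id g Z) = 0 := by
      rw [show -superComm LinearMap.id g Z = (-1 : ℂ) • superComm LinearMap.id g Z by
        ext; simp, superComm_smul, superComm_comm, hZ, superComm_zero, smul_zero]
    refine mem_ordId_of_add h.coord (by omega)
      (exists_orderLE_superComm _ (h.exists_orderLE_left _ _))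
      (fun j => by rw [superComm_comm, h.superComm_zbar_left, superComm_zero])
      (fun j => hneg _ _ _ (h.superComm_z_right _ _ _)) ?_
    · have hs := h.sum_commutator (zb l) (z k) r
      -- The terms of index `0` and `r` are split off; there one factor is an ordinary
      -- multiplication.
      rw [← Finset.add_sum_Ioc_eq_sum_Icc (by positivity),
        ← Finset.sum_Ioo_add_eq_sum_Ioc (by exact_mod_cast hr), sub_zero, sub_self,
        h.left_coeff_zero, h.right_coeff_zero, ← superComm_id] at hs
      have h2 : ∑ j ∈ Finset.Ioo 0 (r : ℤ),
          ((leftOp h.isBounded₂ (zb l)).coeff j *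
            (rightOp h.isBounded₂ (z k)).coeff (r - j)
          - (rightOp h.isBounded₂ (z k)).coeff (r - j) *
            (leftOp h.isBounded₂ (zb l)).coeff j) ∈ ordId A (r - 1) := by
        refine sum_mem fun j hj => ?_
        rw [Finset.mem_Ioo] at hj
        obtain ⟨j, rfl⟩ := Int.eq_ofNat_of_zero_le hj.1.le
        have e : (r : ℤ) - j = ((r - j : ℕ) : ℤ) := by omega
        have := commutator_mem_ordId (ih j (by omega) k l).1 (ih (r - j) (by omega) k l).2
        rw [← e, add_sub_cancel] at this
        exact this
      convert h2 using 1
      rw [superComm_id (z k)]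
      rw [← sub_eq_zero, ← neg_eq_zero, ← hs]
      abel
  refine ⟨h.mem_ordId_left_iff _ (by positivity) fun j => (key j l).1,
    h.mem_ordId_right_iff _ (by positivity) fun j => ?_⟩
  simpa using neg_mem_ord (key k j).2

/-- With `R_{z k}` known to be natural, degree `r` of `[L_f, R_{z k}] = 0` expresses `[z k, L_r]`
through commutators that involve only lower coefficients of `L_f`. -/
lemma left_natural (h : IsCoordSeparated z zb star) (f : A) (r : ℤ) :
    (leftOp h.isBounded₂ f).coeff r ∈ ordId A r := by
  rcases lt_or_ge r 0 with hr | hr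
  · rw [h.leftOp_vanishesBelow f r hr]; exact zero_mem _
  lift r to ℕ using hr
  induction r using Nat.strong_induction_on with
  | _ r ih =>
  refine h.mem_ordId_left_iff f (by positivity) fun k => ?_
  have hs := h.sum_commutator f (z k) r
  rw [← Finset.sum_Ico_add_eq_sum_Icc (by positivity), sub_self, h.right_coeff_zero] at hs
  rw [superComm_id, ← neg_sub (_ * LinearMap.mulLeft ℂ _)]
  rw [add_comm, add_eq_zero_iff_eq_neg] at hs
  rw [hs, neg_neg]
  refine sum_mem fun j hj => ?_
  rw [Finset.mem_Ico] at hj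
  obtain ⟨j, rfl⟩ := Int.eq_ofNat_of_zero_le hj.1
  have e : (r : ℤ) - j = ((r - j : ℕ) : ℤ) := by omega
  have := commutator_mem_ordId (ih j (by omega)) (h.coord_ops_natural (r - j) k k).2
  rw [← e, add_sub_cancel] at this
  exact this

lemma right_natural (h : IsCoordSeparated z zb star) (f : A) (r : ℤ) :
    (rightOp h.isBounded₂ f).coeff r ∈ ordId A r := by
  rcases lt_or_ge r 0 with hr | hr
  · rw [h.rightOp_vanishesBelow f r hr]; exact zero_mem _
  lift r to ℕ using hr
  induction r using Nat.strong_induction_on with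
  | _ r ih =>
  refine h.mem_ordId_right_iff f (by positivity) fun k => ?_
  have hs := h.sum_commutator (zb k) f r
  rw [← Finset.add_sum_Ioc_eq_sum_Icc (by positivity), sub_zero, h.left_coeff_zero] at hs
  rw [add_eq_zero_iff_eq_neg] at hs
  rw [superComm_id, hs]
  refine neg_mem_ord ?_
  refine sum_mem fun j hj => ?_
  rw [Finset.mem_Ioc] at hj
  obtain ⟨j, rfl⟩ := Int.eq_ofNat_of_zero_le hj.1.le
  have e : (r : ℤ) - j = ((r - j : ℕ) : ℤ) := by omega
  have := commutator_mem_ordId (h.coord_ops_natural j k k).1 (ih (r - j) (by omega))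
  rw [← e, add_sub_cancel] at this
  exact this

end IsCoordSeparated

end Separated

variable {m : ℕ} {U : TopologicalSpace.Opens (Fin m → ℂ)}

lemma IsSeparatedStarProduct.isCoordSeparated
    {star : LaurentSeries (Smooth U) → LaurentSeries (Smooth U) → LaurentSeries (Smooth U)}
    (h : IsSeparatedStarProduct star) :
    IsCoordSeparated (coordZ U) (coordZbar U) star where
  toIsStarProduct := h.toIsStarProduct
  coord := isCoordinateFamily_coord U
  coord_mul k f := by
    ext n x
    exact h.holomorphic U le_rfl (coordZ U k)
      ⟨fun x => x k, by fun_prop, fun _ _ => rfl⟩ f n x x.2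
  mul_coord k f := by
    ext n x
    exact h.antiholomorphic U le_rfl (coordZbar U k)
      ⟨fun x => x k, by fun_prop, fun _ _ => rfl⟩ f n x x.2

/-! ### Grassmann algebras -/

section Grassmann

open CliffordAlgebra

/-- The Grassmann algebra over `R` with generators indexed by `I`. -/
abbrev Grassmann (R I : Type*) [CommRing R] : Type _ := ExteriorAlgebra R (I → R)

variable (R : Type*) {I : Type*} [CommRing R] [Algebra ℂ R]

/-- The parity operator of the Grassmann algebra. -/
def grParity (I : Type*) : Grassmann R I →ₗ[ℂ] Grassmann R I :=
  (CliffordAlgebra.involute (Q := (0 : QuadraticForm R (I → R)))).toLinearMap.restrictScalars ℂ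

variable {R}

lemma grParity_ι (v : I → R) : grParity R I (ExteriorAlgebra.ι R v) = -ExteriorAlgebra.ι R v :=
  CliffordAlgebra.involute_ι v

lemma grParity_algebraMap (r : R) :
    grParity R I (algebraMap R _ r) = algebraMap R _ r :=
  AlgHom.commutes (CliffordAlgebra.involute (Q := (0 : QuadraticForm R (I → R)))) r

lemma grParity_mul (f g : Grassmann R I) :
    grParity R I (f * g) = grParity R I f * grParity R I g :=
  map_mul (CliffordAlgebra.involute (Q := (0 : QuadraticForm R (I → R)))) f g

lemma mul_ι_eq (g : Grassmann R I) (v : I → R) :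
    g * ExteriorAlgebra.ι R v = ExteriorAlgebra.ι R v * grParity R I g := by
  induction g using CliffordAlgebra.left_induction with
  | algebraMap r =>
    rw [grParity_algebraMap]
    exact (Algebra.commutes r _)
  | add x y hx hy => rw [add_mul, hx, hy, map_add, mul_add]
  | ι_mul x w hx =>
    have h1 : ExteriorAlgebra.ι R w * ExteriorAlgebra.ι R v
        = -(ExteriorAlgebra.ι R v * ExteriorAlgebra.ι R w) :=
      eq_neg_of_add_eq_zero_left (ExteriorAlgebra.ι_add_mul_swap w v)
    change ExteriorAlgebra.ι R w * x * _ = _ * grParity R I (ExteriorAlgebra.ι R w * x)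
    rw [mul_assoc, hx, grParity_mul, grParity_ι, ← mul_assoc, h1]
    simp only [mul_assoc, neg_mul, mul_neg]

/-- A homogeneous element is moved past the generators one at a time, by left induction on the other
factor. -/
lemma isParity_grParity : IsParity (grParity R I) where
  map_mul := grParity_mul
  invol f := CliffordAlgebra.involute_involute f
  even_comm f g := by
    have hg : grParity R I (evenPart (grParity R I) g) = evenPart (grParity R I) g := by
      simp only [evenPart, LinearMap.smul_apply, LinearMap.add_apply, LinearMap.id_apply, map_smul,
        map_add]
      rw [show grParity R I (grParity R I g) = g from CliffordAlgebra.involute_involute g, add_comm]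
    generalize evenPart (grParity R I) g = h at hg
    induction f using CliffordAlgebra.left_induction with
    | algebraMap r => exact (Algebra.commutes r h).symm
    | add x y hx hy => rw [mul_add, hx, hy, add_mul]
    | ι_mul x w hx =>
      change h * (ExteriorAlgebra.ι R w * x) = ExteriorAlgebra.ι R w * x * h
      rw [← mul_assoc, mul_ι_eq, hg, mul_assoc, hx, mul_assoc]
  odd_comm f g := by
    have hg : grParity R I (oddPart (grParity R I) g) = -oddPart (grParity R I) g := by
      simp only [oddPart, LinearMap.smul_apply, LinearMap.sub_apply, LinearMap.id_apply, map_smul,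
        map_sub]
      rw [show grParity R I (grParity R I g) = g from CliffordAlgebra.involute_involute g,
        ← smul_neg, neg_sub]
    generalize oddPart (grParity R I) g = h at hg
    induction f using CliffordAlgebra.left_induction with
    | algebraMap r =>
      rw [grParity_algebraMap]
      exact (Algebra.commutes r h).symm
    | add x y hx hy => rw [mul_add, hx, hy, map_add, add_mul]
    | ι_mul x w hx =>
      change h * (ExteriorAlgebra.ι R w * x) = grParity R I (ExteriorAlgebra.ι R w * x) * h
      rw [← mul_assoc, mul_ι_eq, hg, mul_assoc, neg_mul, hx, grParity_mul, grParity_ι]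
      simp only [mul_assoc, neg_mul, mul_neg]

/-- The left derivative with respect to a generator. -/
def grDeriv (i : I) : Module.End ℂ (Grassmann R I) :=
  (CliffordAlgebra.contractLeft (Q := (0 : QuadraticForm R (I → R)))
    (LinearMap.proj i)).restrictScalars ℂ

lemma grDeriv_algebraMap (i : I) (r : R) : grDeriv i (algebraMap R (Grassmann R I) r) = 0 :=
  CliffordAlgebra.contractLeft_algebraMap _ _ r

lemma grDeriv_ι_mul (i : I) (v : I → R) (f : Grassmann R I) :
    grDeriv i (ExteriorAlgebra.ι R v * f) = v i • f - ExteriorAlgebra.ι R v * grDeriv i f :=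
  CliffordAlgebra.contractLeft_ι_mul _ v f

lemma grDeriv_smul (i : I) (r : R) (f : Grassmann R I) : grDeriv i (r • f) = r • grDeriv i f :=
  map_smul (CliffordAlgebra.contractLeft (Q := (0 : QuadraticForm R (I → R)))
    (LinearMap.proj i)) r f

lemma grDeriv_comm (i j : I) (f : Grassmann R I) :
    grDeriv i (grDeriv j f) = -grDeriv j (grDeriv i f) :=
  CliffordAlgebra.contractLeft_comm _ _ f

lemma grParity_smul (r : R) (f : Grassmann R I) : grParity R I (r • f) = r • grParity R I f :=
  map_smul (CliffordAlgebra.involute (Q := (0 : QuadraticForm R (I → R)))) r f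

lemma grParity_grDeriv (i : I) (f : Grassmann R I) :
    grParity R I (grDeriv i f) = -grDeriv i (grParity R I f) := by
  induction f using CliffordAlgebra.left_induction with
  | algebraMap r => rw [grParity_algebraMap, grDeriv_algebraMap, map_zero, neg_zero]
  | add x y hx hy => simp only [map_add, hx, hy, neg_add]
  | ι_mul x w hx =>
    change grParity R I (grDeriv i (ExteriorAlgebra.ι R w * x))
      = -grDeriv i (grParity R I (ExteriorAlgebra.ι R w * x))
    rw [grDeriv_ι_mul, grParity_mul, grParity_ι, map_sub, grParity_mul, hx, grParity_ι, neg_mul,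
      neg_mul, map_neg, grDeriv_ι_mul, grParity_smul]
    simp

lemma grDeriv_mul (i : I) (f g : Grassmann R I) :
    grDeriv i (f * g) = grDeriv i f * g + grParity R I f * grDeriv i g := by
  induction f using CliffordAlgebra.left_induction generalizing g with
  | algebraMap r =>
    change grDeriv i (algebraMap R (Grassmann R I) r * g) = _
    rw [grParity_algebraMap, grDeriv_algebraMap, ← Algebra.smul_def, grDeriv_smul,
      Algebra.smul_def, zero_mul, zero_add]
  | add x y hx hy => simp only [add_mul, map_add, hx, hy]; abel
  | ι_mul x w hx =>
    change grDeriv i (ExteriorAlgebra.ι R w * x * g) =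
      grDeriv i (ExteriorAlgebra.ι R w * x) * g
        + grParity R I (ExteriorAlgebra.ι R w * x) * grDeriv i g
    rw [mul_assoc, grDeriv_ι_mul, grDeriv_ι_mul, hx, grParity_mul, grParity_ι, sub_mul, mul_add,
      smul_mul_assoc]
    simp only [mul_assoc, neg_mul]
    abel

/-- By the graded Leibniz rule the commutator of `∂_i` with `f` is multiplication by a signed
combination of derivatives of the parts of `f`. -/
lemma grDeriv_mem_ord (i : I) :
    (grDeriv i : Module.End ℂ (Grassmann R I)) ∈ ordSubmodule (grParity R I) 1 := by
  have hσ : IsParity (grParity R I) := isParity_grParity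
  rw [mem_ord_iff zero_le_one]
  intro f
  have : superComm (grParity R I) f (grDeriv i) = LinearMap.mulLeft ℂ
      (-grDeriv i (evenPart (grParity R I) f) + grDeriv i (oddPart (grParity R I) f)) := by
    ext1 g
    rw [superComm_apply]
    nth_rw 1 [← even_add_odd (grParity R I) f]
    rw [grDeriv_mul, hσ.even_fixed, hσ.map_mul, hσ.odd_neg, grDeriv_mul]
    simp only [map_neg, map_add, hσ.map_mul, hσ.odd_neg, grParity_grDeriv, hσ.invol, neg_neg,
      neg_mul, mul_neg, LinearMap.mulLeft_apply, add_mul]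
    abel
  rw [this, sub_self]
  exact mulLeft_mem_ord hσ _

variable [LinearOrder I] [Fintype I]

/-- A generator of the Grassmann algebra. -/
def gen (R : Type*) [CommRing R] (i : I) : Grassmann R I := ExteriorAlgebra.ι R (Pi.single i 1)

/-- The basis of ordered monomials. -/
def grBasis (R I : Type*) [CommRing R] [LinearOrder I] [Fintype I] :
    Module.Basis (Finset I) R (Grassmann R I) :=
  (Pi.basisFun R I).ExteriorAlgebra

omit [Algebra ℂ R]

lemma grBasis_eq_prod (S : Finset I) :
    grBasis R I S = ((S.sort (· ≤ ·)).map (gen R)).prod := by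
  rw [grBasis, ExteriorAlgebra.basis_apply_ofCard _ rfl]
  refine (ExteriorAlgebra.ιMulti_apply _).trans ?_
  rw [← Finset.listMap_orderEmbOfFin_finRange S rfl, List.map_map, List.ofFn_eq_map]
  congr 2
  ext1 k
  simp only [Pi.basisFun_apply, Function.comp_apply, gen]
  rfl

lemma grBasis_empty : grBasis R I ∅ = 1 := by
  rw [grBasis_eq_prod]; simp

lemma grBasis_singleton (i : I) : grBasis R I {i} = gen R i := by
  rw [grBasis_eq_prod]; simp

lemma grBasis_mul_of_not_disjoint {S T : Finset I} (h : ¬Disjoint S T) :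
    grBasis R I S * grBasis R I T = 0 :=
  ExteriorAlgebra.basis_mul_of_not_disjoint (Pi.basisFun R I)
    (⟨S, rfl⟩ : Set.powersetCard I S.card) (⟨T, rfl⟩ : Set.powersetCard I T.card) h

lemma grBasis_mul_of_disjoint {S T : Finset I} (h : Disjoint S T) :
    ∃ ε : ℤˣ, grBasis R I S * grBasis R I T = ε • grBasis R I (S ∪ T) := by
  rw [← Finset.disjUnion_eq_union S T h]
  exact ⟨_, ExteriorAlgebra.basis_mul_of_disjoint (Pi.basisFun R I)
    (⟨S, rfl⟩ : Set.powersetCard I S.card) (⟨T, rfl⟩ : Set.powersetCard I T.card) h⟩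

/-- Concatenating the sorted lists needs no transposition, so no sign appears. -/
lemma grBasis_mul_of_lt {S T : Finset I} (h : ∀ i ∈ S, ∀ j ∈ T, i < j) :
    grBasis R I S * grBasis R I T = grBasis R I (S ∪ T) := by
  rw [grBasis_eq_prod, grBasis_eq_prod, grBasis_eq_prod, ← List.prod_append, ← List.map_append]
  have hp : (S.sort (· ≤ ·) ++ T.sort (· ≤ ·)).Pairwise (· < ·) := by
    rw [List.pairwise_append]
    refine ⟨S.sortedLT_sort.pairwise, T.sortedLT_sort.pairwise, fun i hi j hj => ?_⟩
    exact h i (by simpa using hi) j (by simpa using hj)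
  rw [show S ∪ T = (S.sort (· ≤ ·) ++ T.sort (· ≤ ·)).toFinset by ext; simp,
    (List.toFinset_sort (· ≤ ·) (hp.imp fun h => h.ne)).2 (hp.imp fun h => h.le)]

lemma gen_mul_grBasis_of_mem {i : I} {S : Finset I} (h : i ∈ S) :
    gen R i * grBasis R I S = 0 := by
  rw [← grBasis_singleton]
  exact grBasis_mul_of_not_disjoint (by simpa using h)

lemma gen_mul_grBasis_of_notMem {i : I} {S : Finset I} (h : i ∉ S) :
    ∃ ε : ℤˣ, gen R i * grBasis R I S = ε • grBasis R I (insert i S) := by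
  rw [← grBasis_singleton, Finset.insert_eq]
  exact grBasis_mul_of_disjoint (by simpa using h)

lemma grBasis_insert {i : I} {S : Finset I} (h : i ∉ S) :
    ∃ ε : ℤˣ, grBasis R I (insert i S) = ε • (gen R i * grBasis R I S) := by
  obtain ⟨ε, hε⟩ := gen_mul_grBasis_of_notMem (R := R) h
  exact ⟨ε, by rw [hε, smul_smul, Int.units_mul_self, one_smul]⟩

end Grassmann

/-! ### Signs of monomials, and operators acting on coefficients -/

section GrassmannBasis

variable {R I : Type*} [CommRing R] [Algebra ℂ R] [LinearOrder I] [Fintype I]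

lemma units_smul_eq {V : Type*} [AddCommGroup V] [Module ℂ V] (ε : ℤˣ) (x : V) :
    ε • x = ((ε : ℤ) : ℂ) • x := by
  rw [Units.smul_def, Int.cast_smul_eq_zsmul]

/-- One complex scalar covers both the sign and the case of a repeated generator, where it is zero.
-/
lemma exists_gen_mul_grBasis (i : I) (S : Finset I) :
    ∃ ε : ℂ, gen R i * grBasis R I S = ε • grBasis R I (insert i S) := by
  by_cases h : i ∈ S
  · exact ⟨0, by rw [gen_mul_grBasis_of_mem h, zero_smul]⟩
  · obtain ⟨ε, hε⟩ := gen_mul_grBasis_of_notMem (R := R) h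
    exact ⟨_, by rw [hε, units_smul_eq]⟩

lemma exists_grBasis_insert {i : I} {S : Finset I} (h : i ∉ S) :
    ∃ ε : ℂ, grBasis R I (insert i S) = ε • (gen R i * grBasis R I S) := by
  obtain ⟨ε, hε⟩ := grBasis_insert (R := R) h
  exact ⟨_, by rw [hε, units_smul_eq]⟩

lemma exists_grBasis_mul (S T : Finset I) :
    ∃ ε : ℂ, grBasis R I S * grBasis R I T = ε • grBasis R I (S ∪ T) ∧
      (¬Disjoint S T → ε = 0) := by
  by_cases h : Disjoint S T
  · obtain ⟨ε, hε⟩ := grBasis_mul_of_disjoint (R := R) h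
    exact ⟨_, by rw [hε, units_smul_eq], fun h' => (h' h).elim⟩
  · exact ⟨0, by rw [grBasis_mul_of_not_disjoint h, zero_smul], fun _ => rfl⟩

omit [Fintype I] in
lemma grParity_gen (i : I) : grParity R I (gen R i) = -gen R i := grParity_ι _

lemma grParity_grBasis (S : Finset I) :
    grParity R I (grBasis R I S) = (-1 : ℂ) ^ S.card • grBasis R I S := by
  induction S using Finset.induction_on with
  | empty =>
    rw [grBasis_empty, Finset.card_empty, pow_zero, one_smul, ← map_one (algebraMap R _),
      grParity_algebraMap]
  | insert i S hi ih =>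
    obtain ⟨ε, hε⟩ := exists_grBasis_insert (R := R) hi
    rw [hε, map_smul, grParity_mul, ih, grParity_gen, Finset.card_insert_of_notMem hi, pow_succ,
      mul_smul_comm, neg_mul, smul_comm ε]
    simp

lemma gr_ext {V : Type*} [AddCommMonoid V] [Module ℂ V] {X Y : Grassmann R I →ₗ[ℂ] V}
    (h : ∀ (r : R) S, X (r • grBasis R I S) = Y (r • grBasis R I S)) : X = Y := by
  ext f
  rw [← (grBasis R I).sum_repr f, map_sum, map_sum]
  exact Finset.sum_congr rfl fun S _ => h _ _

lemma grCoord_smul (S : Finset I) (c : ℂ) (f : Grassmann R I) :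
    (grBasis R I).coord S (c • f) = c • (grBasis R I).coord S f := by
  rw [← algebraMap_smul R c f, map_smul, algebraMap_smul]

omit [Algebra ℂ R] in
lemma grCoord_basis (S T : Finset I) (r : R) :
    (grBasis R I).coord S (r • grBasis R I T) = if T = S then r else 0 := by
  rw [map_smul, Module.Basis.coord_apply, Module.Basis.repr_self, Finsupp.single_apply]
  split_ifs <;> simp

/-- The operator acting on the coefficients of functions by the operator `X`. -/
def extend (X : Module.End ℂ R) : Module.End ℂ (Grassmann R I) where
  toFun f := ∑ S, X ((grBasis R I).coord S f) • grBasis R I S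
  map_add' f g := by simp only [map_add, add_smul, Finset.sum_add_distrib]
  map_smul' c f := by
    simp only [grCoord_smul, map_smul, RingHom.id_apply, Finset.smul_sum, smul_assoc]

lemma extend_apply (X : Module.End ℂ R) (f : Grassmann R I) :
    extend X f = ∑ S, X ((grBasis R I).coord S f) • grBasis R I S := rfl

lemma grCoord_extend (X : Module.End ℂ R) (f : Grassmann R I) (S : Finset I) :
    (grBasis R I).coord S (extend X f) = X ((grBasis R I).coord S f) := by
  rw [extend_apply, map_sum]
  simp only [grCoord_basis]
  simp

lemma extend_smul_basis (X : Module.End ℂ R) (r : R) (S : Finset I) :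
    extend X (r • grBasis R I S) = X r • grBasis R I S := by
  rw [extend_apply]
  simp only [grCoord_basis]
  rw [Finset.sum_eq_single S]
  · simp
  · intro T _ hT
    rw [if_neg hT.symm, map_zero, zero_smul]
  · simp

lemma extend_gen_mul (X : Module.End ℂ R) (i : I) (f : Grassmann R I) :
    extend X (gen R i * f) = gen R i * extend X f := by
  have : extend X ∘ₗ LinearMap.mulLeft ℂ (gen R i) = LinearMap.mulLeft ℂ (gen R i) ∘ₗ extend X := by
    refine gr_ext fun r S => ?_
    obtain ⟨ε, hε⟩ := exists_gen_mul_grBasis (R := R) i S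
    simp only [LinearMap.comp_apply, LinearMap.mulLeft_apply, extend_smul_basis, mul_smul_comm, hε]
    rw [smul_comm, smul_comm (X r), map_smul, extend_smul_basis]
  exact LinearMap.congr_fun this f

lemma extend_grParity (X : Module.End ℂ R) (f : Grassmann R I) :
    extend X (grParity R I f) = grParity R I (extend X f) := by
  have : extend X ∘ₗ grParity R I = grParity R I ∘ₗ extend X := by
    refine gr_ext fun r S => ?_
    simp only [LinearMap.comp_apply, extend_smul_basis, grParity_smul, grParity_grBasis]
    rw [smul_comm, smul_comm (X r), map_smul, extend_smul_basis]
  exact LinearMap.congr_fun this f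

lemma parityConj_extend (X : Module.End ℂ R) :
    parityConj (grParity R I) (extend X) = extend X := by
  ext1 f
  rw [parityConj_apply, extend_grParity]
  exact isParity_grParity.invol _

lemma superComm_gen_extend (X : Module.End ℂ R) (i : I) :
    superComm (grParity R I) (gen R i) (extend X) = 0 := by
  ext1 f
  rw [superComm_apply, evenPart_of_neg (grParity_gen i), oddPart_of_neg (grParity_gen i),
    ← extend_grParity, isParity_grParity.invol, extend_gen_mul]
  simp

lemma superComm_algebraMap_extend (X : Module.End ℂ R) (r : R) :
    superComm (grParity R I) (algebraMap R _ r) (extend X)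
      = extend (superComm LinearMap.id r X) := by
  refine gr_ext fun a S => ?_
  rw [superComm_apply, evenPart_of_fixed (grParity_algebraMap r),
    oddPart_of_fixed (grParity_algebraMap r), ← Algebra.smul_def, ← Algebra.smul_def, smul_smul,
    extend_smul_basis, extend_smul_basis, extend_smul_basis, superComm_id]
  simp [smul_smul, sub_smul]

/-- An extended operator is even and supercommutes with every generator, and its commutators with
functions are again extended operators, of lower order. By the Leibniz rule in the function, these
two cases control the commutator with any element. -/
lemma extend_mem_ord {k : ℤ} {X : Module.End ℂ R} (hX : X ∈ ordId R k) :
    (extend X : Module.End ℂ (Grassmann R I)) ∈ ordSubmodule (grParity R I) k := by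
  have hσ : IsParity (grParity R I) := isParity_grParity
  rcases lt_or_ge k 0 with hk | hk
  · rw [(mem_ord_neg hk).1 hX]
    rw [show (extend 0 : Module.End ℂ (Grassmann R I)) = 0 by ext1 f; simp [extend_apply]]
    exact zero_mem _
  lift k to ℕ using hk
  induction k using Nat.strong_induction_on generalizing X with
  | _ k ih =>
  have hr (r : R) : superComm (grParity R I) (algebraMap R _ r) (extend X)
      ∈ ordSubmodule (grParity R I) (k - 1) := by
    rw [superComm_algebraMap_extend]
    have h1 := superComm_mem_ord hX r
    rcases Nat.eq_zero_or_pos k with rfl | hk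
    · rw [(mem_ord_neg (by simp)).1 h1]
      rw [show (extend 0 : Module.End ℂ (Grassmann R I)) = 0 by ext1 f; simp [extend_apply]]
      exact zero_mem _
    · have e : (k : ℤ) - 1 = ((k - 1 : ℕ) : ℤ) := by omega
      rw [e] at h1 ⊢
      exact ih (k - 1) (by omega) h1
  have hmul {x y : Grassmann R I}
      (hx : superComm (grParity R I) x (extend X) ∈ ordSubmodule (grParity R I) (k - 1))
      (hy : superComm (grParity R I) y (extend X) ∈ ordSubmodule (grParity R I) (k - 1)) :
      superComm (grParity R I) (x * y) (extend X) ∈ ordSubmodule (grParity R I) (k - 1) := by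
    rw [superComm_mul_left hσ, parityConj_extend]
    refine add_mem (add_mem ?_ ?_) ?_
    · simpa using mul_mem_ord hσ (mulLeft_mem_ord hσ x) hy
    · simpa using mul_mem_ord hσ hx (mulLeft_mem_ord hσ _)
    · simpa using mul_mem_ord hσ hx (mulLeft_mem_ord hσ _)
  have hadd {x y : Grassmann R I}
      (hx : superComm (grParity R I) x (extend X) ∈ ordSubmodule (grParity R I) (k - 1))
      (hy : superComm (grParity R I) y (extend X) ∈ ordSubmodule (grParity R I) (k - 1)) :
      superComm (grParity R I) (x + y) (extend X) ∈ ordSubmodule (grParity R I) (k - 1) := by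
    rw [superComm_add_left]; exact add_mem hx hy
  rw [mem_ord_iff (by positivity)]
  intro f
  rw [← (grBasis R I).sum_repr f]
  refine Finset.sum_induction _ (fun x => superComm (grParity R I) x (extend X) ∈
    ordSubmodule (grParity R I) (k - 1)) (fun _ _ => hadd) ?_ fun S _ => ?_
  · simpa using hr 0
  · rw [Algebra.smul_def]
    refine hmul (hr _) ?_
    induction S using Finset.induction_on with
    | empty => rw [grBasis_empty]; simpa using hr 1
    | insert i S hi ih' =>
      obtain ⟨ε, hε⟩ := exists_grBasis_insert (R := R) hi
      rw [hε, ← algebraMap_smul R ε, Algebra.smul_def]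
      refine hmul (hr _) (hmul ?_ (ih' (Finset.mem_univ _)))
      rw [superComm_gen_extend]; exact zero_mem _

end GrassmannBasis

/-! ### The filtration by degree in the odd generators -/

section Filtration

variable {R I : Type*} [CommRing R] [Algebra ℂ R] [LinearOrder I] [Fintype I]

/-- Functions of degree at least `k` in the odd generators. -/
def grFil (R I : Type*) [CommRing R] [LinearOrder I] [Fintype I] (k : ℕ) :
    Submodule R (Grassmann R I) :=
  Submodule.span R (grBasis R I '' {S | k ≤ S.card})

omit [Algebra ℂ R] in
lemma grBasis_mem_grFil {k : ℕ} {S : Finset I} (h : k ≤ S.card) : grBasis R I S ∈ grFil R I k :=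
  Submodule.subset_span ⟨S, h, rfl⟩

omit [Algebra ℂ R] in
lemma grFil_antitone : Antitone (grFil R I) := fun _ _ h =>
  Submodule.span_mono (Set.image_mono fun _ hS => le_trans h hS)

omit [Algebra ℂ R] in
lemma grFil_zero : grFil R I 0 = ⊤ := by
  rw [grFil, ← (grBasis R I).span_eq]; simp

omit [Algebra ℂ R] in
lemma grFil_eq_bot : grFil R I (Fintype.card I + 1) = ⊥ := by
  rw [grFil, Submodule.span_eq_bot]
  rintro _ ⟨S, hS, rfl⟩
  exact absurd (Finset.card_le_univ S) (by simpa using hS)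

lemma mul_mem_grFil {k l : ℕ} {f g : Grassmann R I} (hf : f ∈ grFil R I k)
    (hg : g ∈ grFil R I l) : f * g ∈ grFil R I (k + l) := by
  have h : grFil R I k * grFil R I l ≤ grFil R I (k + l) := by
    rw [grFil, grFil, Submodule.span_mul_span, Submodule.span_le]
    rintro _ ⟨_, ⟨S, hS, rfl⟩, _, ⟨T, hT, rfl⟩, rfl⟩
    simp only [Set.mem_ofPred_eq] at hS hT
    obtain ⟨ε, hε, hd⟩ := exists_grBasis_mul (R := R) S T
    simp only [SetLike.mem_coe]
    rw [hε]
    by_cases hST : Disjoint S T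
    · rw [← algebraMap_smul R ε]
      refine Submodule.smul_mem _ _ (grBasis_mem_grFil ?_)
      rw [Finset.card_union_of_disjoint hST]; omega
    · rw [hd hST, zero_smul]; exact zero_mem _
  exact h (Submodule.mul_mem_mul hf hg)

/-- The value of a function at zero of the odd variables. -/
def body (R I : Type*) [CommRing R] : Grassmann R I →ₐ[R] R := ExteriorAlgebra.algebraMapInv

omit [Algebra ℂ R] [LinearOrder I] [Fintype I] in
lemma body_ι (v : I → R) : body R I (ExteriorAlgebra.ι R v) = 0 := by
  rw [body, ExteriorAlgebra.algebraMapInv, ExteriorAlgebra.lift_ι_apply]; rfl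

lemma body_grBasis (S : Finset I) :
    body R I (grBasis R I S) = if S = ∅ then 1 else 0 := by
  split_ifs with h
  · rw [h, grBasis_empty, map_one]
  · obtain ⟨i, hi⟩ := Finset.nonempty_iff_ne_empty.2 h
    obtain ⟨ε, hε⟩ := exists_grBasis_insert (R := R) (Finset.notMem_erase i S)
    rw [← Finset.insert_erase hi, hε, ← algebraMap_smul R ε, map_smul, map_mul, gen, body_ι,
      zero_mul, smul_zero]

lemma body_eq_coord (f : Grassmann R I) : body R I f = (grBasis R I).coord ∅ f := by
  have : (body R I).toLinearMap = (grBasis R I).coord ∅ := by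
    refine (grBasis R I).ext fun S => ?_
    rw [AlgHom.toLinearMap_apply, body_grBasis, Module.Basis.coord_apply, Module.Basis.repr_self,
      Finsupp.single_apply]
  exact LinearMap.congr_fun this f

lemma grDeriv_grBasis_of_notMem {i : I} {S : Finset I} (h : i ∉ S) :
    grDeriv i (grBasis R I S) = 0 := by
  induction S using Finset.induction_on with
  | empty => rw [grBasis_empty, ← map_one (algebraMap R _), grDeriv_algebraMap]
  | insert j S hj ih =>
    obtain ⟨ε, hε⟩ := exists_grBasis_insert (R := R) hj
    rw [Finset.mem_insert, not_or] at h
    rw [hε, map_smul, gen, grDeriv_ι_mul, ih h.2, Pi.single_eq_of_ne h.1]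
    simp

lemma exists_grDeriv_grBasis (i : I) (S : Finset I) :
    ∃ ε : ℂ, grDeriv i (grBasis R I S) = ε • grBasis R I (S.erase i) := by
  by_cases h : i ∈ S
  · obtain ⟨ε, hε⟩ := exists_grBasis_insert (R := R) (Finset.notMem_erase i S)
    rw [Finset.insert_erase h] at hε
    refine ⟨ε, ?_⟩
    rw [hε, map_smul, gen, grDeriv_ι_mul, grDeriv_grBasis_of_notMem (Finset.notMem_erase i S),
      Pi.single_eq_same]
    simp
  · exact ⟨0, by rw [grDeriv_grBasis_of_notMem h, zero_smul]⟩

omit [Fintype I] in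
lemma grDeriv_gen (i j : I) : grDeriv i (gen R j) = if i = j then 1 else 0 := by
  have := grDeriv_ι_mul i (Pi.single j (1 : R)) 1
  rw [mul_one, ← map_one (algebraMap R (Grassmann R I)), grDeriv_algebraMap, mul_zero,
    sub_zero, map_one] at this
  rw [gen, this, Pi.single_apply]
  split_ifs <;> simp

/-- The expansion of a function to first order in the odd variables. -/
lemma sub_sub_mem_grFil (f : Grassmann R I) :
    f - algebraMap R _ (body R I f) - ∑ i, body R I (grDeriv i f) • gen R i ∈ grFil R I 2 := by
  rw [← (grBasis R I).sum_repr f]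
  refine Finset.sum_induction _ (fun f => f - algebraMap R _ (body R I f)
    - ∑ i, body R I (grDeriv i f) • gen R i ∈ grFil R I 2) (fun x y hx hy => ?_) (by simp)
    fun S _ => ?_
  · convert add_mem hx hy using 1
    simp only [map_add, add_smul, Finset.sum_add_distrib]
    abel
  · generalize (grBasis R I).repr f S = r
    suffices h : grBasis R I S - algebraMap R _ (body R I (grBasis R I S))
        - ∑ i, body R I (grDeriv i (grBasis R I S)) • gen R i ∈ grFil R I 2 by
      convert Submodule.smul_mem _ r h using 1
      simp only [map_smul, grDeriv_smul, smul_sub, Finset.smul_sum, smul_eq_mul,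
        map_mul, mul_smul]
      rw [Algebra.smul_def r (algebraMap R (Grassmann R I) _)]
    rcases Nat.lt_or_ge S.card 2 with hS | hS
    · rcases (by omega : S.card = 0 ∨ S.card = 1) with hS | hS
      · have h1 (i : I) : grDeriv i (1 : Grassmann R I) = 0 := by
          rw [← map_one (algebraMap R _), grDeriv_algebraMap]
        rw [Finset.card_eq_zero.1 hS, grBasis_empty, map_one, map_one]
        simp only [h1, map_zero, zero_smul, Finset.sum_const_zero, sub_self]
        exact zero_mem _
      · obtain ⟨j, rfl⟩ := Finset.card_eq_one.1 hS
        have h0 : body R I (gen R j) = 0 := body_ι _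
        rw [grBasis_singleton]
        simp only [grDeriv_gen, h0, apply_ite, map_one, map_zero, ite_smul, one_smul, zero_smul,
          Finset.sum_ite_eq', Finset.mem_univ, if_true]
        simp
    · have h0 : body R I (grBasis R I S) = 0 := by
        rw [body_grBasis, if_neg]; rintro rfl; simp at hS
      have h1 (i : I) : body R I (grDeriv i (grBasis R I S)) = 0 := by
        obtain ⟨ε, hε⟩ := exists_grDeriv_grBasis (R := R) i S
        rw [hε, ← algebraMap_smul R ε, map_smul, body_grBasis, if_neg, smul_zero]
        intro h
        have := Finset.pred_card_le_card_erase (s := S) (a := i)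
        rw [h, Finset.card_empty] at this
        omega
      simp only [h0, h1, map_zero, zero_smul, Finset.sum_const_zero, sub_zero]
      exact grBasis_mem_grFil hS

omit [Algebra ℂ R] in
lemma gen_mem_grFil (i : I) : gen R i ∈ grFil R I 1 := by
  rw [← grBasis_singleton]; exact grBasis_mem_grFil (by simp)

/-- A subring containing all functions and all generators up to terms of higher degree is the whole
Grassmann algebra. -/
lemma subring_eq_top {S : Subring (Grassmann R I)}
    (h0 : ∀ a : R, ∃ s ∈ S, algebraMap R _ a - s ∈ grFil R I 1)
    (h1 : ∀ i, ∃ s ∈ S, gen R i - s ∈ grFil R I 2) : S = ⊤ := by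
  have hmem (k : ℕ) : ∀ {s f : Grassmann R I}, f ∈ grFil R I k → f - s ∈ grFil R I (k + 1) →
      s ∈ grFil R I k := fun {s f} hf hs => by
    have := sub_mem hf (grFil_antitone (Nat.le_succ k) hs)
    simpa using this
  -- Products of approximations of generators approximate monomials, modulo higher degree.
  have hb : ∀ T : Finset I, ∃ s ∈ S, grBasis R I T - s ∈ grFil R I (T.card + 1) := by
    intro T
    induction T using Finset.induction_on with
    | empty => exact ⟨1, one_mem _, by rw [grBasis_empty, sub_self]; exact zero_mem _⟩
    | insert i T hi ih =>
      obtain ⟨s, hs, hsT⟩ := ih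
      obtain ⟨t, ht, hti⟩ := h1 i
      obtain ⟨ε, hε⟩ := grBasis_insert (R := R) hi
      have key : gen R i * grBasis R I T - t * s ∈ grFil R I (T.card + 1 + 1) := by
        rw [show gen R i * grBasis R I T - t * s
          = (gen R i - t) * grBasis R I T + t * (grBasis R I T - s) by noncomm_ring]
        refine add_mem ?_ ?_
        · convert mul_mem_grFil hti (grBasis_mem_grFil le_rfl) using 2; ring
        · convert mul_mem_grFil (hmem 1 (gen_mem_grFil i) hti) hsT using 2; ring
      rw [hε, Finset.card_insert_of_notMem hi]
      rcases Int.units_eq_one_or ε with rfl | rfl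
      · exact ⟨t * s, mul_mem ht hs, by simpa using key⟩
      · refine ⟨-(t * s), neg_mem (mul_mem ht hs), ?_⟩
        convert neg_mem key using 1
        rw [Units.neg_smul, one_smul]; abel
  have hf (k : ℕ) (f : Grassmann R I) (hf : f ∈ grFil R I k) :
      ∃ s ∈ S, f - s ∈ grFil R I (k + 1) := by
    induction hf using Submodule.span_induction with
    | mem x hx =>
      obtain ⟨T, hT, rfl⟩ := hx
      obtain ⟨s, hs, hsT⟩ := hb T
      exact ⟨s, hs, grFil_antitone (Nat.succ_le_succ hT) hsT⟩
    | zero => exact ⟨0, zero_mem _, by simp⟩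
    | add x y _ _ hx hy =>
      obtain ⟨s, hs, hsx⟩ := hx
      obtain ⟨t, ht, hty⟩ := hy
      refine ⟨s + t, add_mem hs ht, ?_⟩
      rw [add_sub_add_comm]; exact add_mem hsx hty
    -- `S` need not be closed under multiplication by functions, so the coefficient `a` is itself
    -- replaced by an approximation from `S`.
    | smul a x hxk hx =>
      obtain ⟨s, hs, hsx⟩ := hx
      obtain ⟨t, ht, hta⟩ := h0 a
      refine ⟨t * s, mul_mem ht hs, ?_⟩
      rw [Algebra.smul_def, show algebraMap R (Grassmann R I) a * x - t * s
        = (algebraMap R _ a - t) * x + t * (x - s) by noncomm_ring]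
      refine add_mem ?_ ?_
      · convert mul_mem_grFil hta hxk using 2; ring
      · convert mul_mem_grFil (k := 0) (f := t) (by rw [grFil_zero]; trivial) hsx using 2; ring
  have hall (k : ℕ) (f : Grassmann R I) : ∃ s ∈ S, f - s ∈ grFil R I k := by
    induction k with
    | zero => exact ⟨0, zero_mem _, by rw [grFil_zero]; trivial⟩
    | succ k ih =>
      obtain ⟨s, hs, hsf⟩ := ih
      obtain ⟨t, ht, htf⟩ := hf k _ hsf
      exact ⟨s + t, add_mem hs ht, by rwa [sub_sub] at htf⟩
  rw [eq_top_iff]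
  intro f _
  -- No monomial has more factors than there are generators, so approximation to this degree is
  -- equality.
  obtain ⟨s, hs, hsf⟩ := hall (Fintype.card I + 1) f
  rw [grFil_eq_bot, Submodule.mem_bot, sub_eq_zero] at hsf
  rwa [hsf]

end Filtration

/-! ### Conjugation of natural operators by exponentials -/

section Conjugation

open HahnSeries

/-- A subgroup closed under commutators with a nilpotent element `y` is closed under conjugation by
`exp y`. -/
lemma exp_conj_mem {A : Type*} [Ring A] [Module ℚ A] (S : AddSubgroup A)
    (hS : ∀ (q : ℚ), ∀ x ∈ S, q • x ∈ S) {y : A} (hy : IsNilpotent y)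
    (had : ∀ x ∈ S, x * y - y * x ∈ S) {T : A} (hT : T ∈ S) :
    IsNilpotent.exp (-y) * T * IsNilpotent.exp y ∈ S := by
  obtain ⟨n, hn⟩ := hy
  have hn' : (-y) ^ n = 0 := by rw [neg_pow, hn, mul_zero]
  have hl : LinearMap.mulLeft ℚ (-y) ^ n = 0 := by rw [LinearMap.pow_mulLeft, hn']; ext; simp
  have hr : LinearMap.mulRight ℚ y ^ n = 0 := by rw [LinearMap.pow_mulRight, hn]; ext; simp
  have h1 (z : A) : IsNilpotent.exp (LinearMap.mulLeft ℚ (-y)) z = IsNilpotent.exp (-y) * z := by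
    rw [IsNilpotent.exp_eq_sum hl, IsNilpotent.exp_eq_sum hn', Finset.sum_mul,
      LinearMap.sum_apply]
    exact Finset.sum_congr rfl fun k _ => by
      rw [LinearMap.smul_apply, LinearMap.pow_mulLeft, LinearMap.mulLeft_apply, smul_mul_assoc]
  have h2 (z : A) : IsNilpotent.exp (LinearMap.mulRight ℚ y) z = z * IsNilpotent.exp y := by
    rw [IsNilpotent.exp_eq_sum hr, IsNilpotent.exp_eq_sum hn, Finset.mul_sum,
      LinearMap.sum_apply]
    exact Finset.sum_congr rfl fun k _ => by
      rw [LinearMap.smul_apply, LinearMap.pow_mulRight, LinearMap.mulRight_apply, mul_smul_comm]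
  -- Left and right multiplication commute, so conjugation by `exp y` is the exponential of the
  -- nilpotent operator `x ↦ x * y - y * x`, whose powers preserve `S`.
  have hc : Commute (LinearMap.mulLeft ℚ (-y)) (LinearMap.mulRight ℚ y) :=
    LinearMap.commute_mulLeft_right _ _
  have h3 := IsNilpotent.exp_add_of_commute hc ⟨n, hl⟩ ⟨n, hr⟩
  have h4 := hc.isNilpotent_add ⟨n, hl⟩ ⟨n, hr⟩
  obtain ⟨N, hN⟩ := h4
  have h5 (k : ℕ) : ((LinearMap.mulLeft ℚ (-y) + LinearMap.mulRight ℚ y) ^ k) T ∈ S := by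
    induction k with
    | zero => simpa using hT
    | succ k ih =>
      rw [pow_succ', Module.End.mul_apply]
      have := had _ ih
      rw [LinearMap.add_apply, LinearMap.mulLeft_apply, LinearMap.mulRight_apply]
      rwa [neg_mul, neg_add_eq_sub]
  have h6 : IsNilpotent.exp (LinearMap.mulLeft ℚ (-y) + LinearMap.mulRight ℚ y) T ∈ S := by
    rw [IsNilpotent.exp_eq_sum hN, LinearMap.sum_apply]
    exact sum_mem fun k _ => hS _ _ (h5 k)
  rwa [h3, Module.End.mul_apply, h2, h1, ← mul_assoc] at h6

lemma map_exp_conj_mem {A B : Type*} [Ring A] [Algebra ℂ A] [Ring B] [Module ℚ B] (φ : B →+* A)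
    (S : AddSubgroup A) (hS : ∀ (c : ℂ), ∀ x ∈ S, c • x ∈ S) {y : B} (hy : IsNilpotent y)
    (had : ∀ x ∈ S, x * φ y - φ y * x ∈ S) {T : A} (hT : T ∈ S) :
    φ (IsNilpotent.exp (-y)) * T * φ (IsNilpotent.exp y) ∈ S := by
  let _ : Module ℚ A := Module.compHom _ (algebraMap ℚ ℂ)
  rw [IsNilpotent.map_exp hy, IsNilpotent.map_exp hy.neg, map_neg]
  exact exp_conj_mem S (fun q x hx => hS _ _ hx) (hy.map φ) had hT

variable {𝒜 : Type*} [Ring 𝒜] [Algebra ℂ 𝒜] {σ : 𝒜 →ₗ[ℂ] 𝒜}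

/-- The formal operators `∑ ν^k A_k` with `A_k` a differential operator of order at most `k`. -/
def naturalOps (σ : 𝒜 →ₗ[ℂ] 𝒜) : AddSubgroup (LaurentSeries (Module.End ℂ 𝒜)) where
  carrier := {T | ∀ k : ℤ, T.coeff k ∈ ordSubmodule σ k}
  zero_mem' _ := zero_mem _
  add_mem' hS hT k := add_mem (hS k) (hT k)
  neg_mem' hT k := neg_mem_ord (hT k)

lemma vanishesBelow_of_mem_naturalOps {T : LaurentSeries (Module.End ℂ 𝒜)}
    (hT : T ∈ naturalOps σ) : VanishesBelow 0 T := fun k hk => (mem_ord_neg hk).1 (hT k)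

lemma mul_mem_naturalOps (hσ : IsParity σ) {S T : LaurentSeries (Module.End ℂ 𝒜)}
    (hS : S ∈ naturalOps σ) (hT : T ∈ naturalOps σ) : S * T ∈ naturalOps σ := by
  intro n
  rw [coeff_mul_Icc (vanishesBelow_of_mem_naturalOps hS) (vanishesBelow_of_mem_naturalOps hT)]
  refine sum_mem fun k _ => ?_
  have := mul_mem_ord hσ (hS k) (hT (n - k))
  rwa [add_sub_cancel] at this

lemma mulOp_mem_naturalOps (hσ : IsParity σ) {f : LaurentSeries 𝒜} (hf : VanishesBelow 0 f) :
    mulOp f ∈ naturalOps σ := by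
  intro k
  rw [mulOp_coeff]
  rcases lt_or_ge k 0 with hk | hk
  · rw [hf k hk, LinearMap.mulLeft_zero_eq_zero]; exact zero_mem _
  · exact ord_mono hk (mulLeft_mem_ord hσ _)

/-- As `Y` is even, this is up to sign the graded commutator with the functions `Y_j`, `j ≥ -1`. It
lowers the order by one, and `ν^j` lowers the degree by at most one. -/
lemma commutator_mem_naturalOps {Y : LaurentSeries 𝒜}
    (hY : VanishesBelow (-1) Y) (he : Y.map σ = Y) {T : LaurentSeries (Module.End ℂ 𝒜)}
    (hT : T ∈ naturalOps σ) : T * mulOp Y - mulOp Y * T ∈ naturalOps σ := by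
  intro n
  have hY' : VanishesBelow (-1) (mulOp Y) := hY.map _
  have hT0 := vanishesBelow_of_mem_naturalOps hT
  rw [coeff_sub, coeff_mul_Icc hT0 hY', coeff_mul_Icc' hY' hT0, ← Finset.sum_sub_distrib]
  refine sum_mem fun k hk => ?_
  rw [Finset.mem_Icc] at hk
  have hev : σ (Y.coeff (n - k)) = Y.coeff (n - k) := by
    conv_rhs => rw [← he]
    rw [map_coeff]
  have h1 := superComm_mem_ord (hT k) (Y.coeff (n - k))
  rw [superComm_of_even hev] at h1
  rw [mulOp_coeff, ← neg_sub]
  exact neg_mem_ord (ord_mono (by omega) h1)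

/-- Conjugation by the exponential of an even nilpotent `Y = ν⁻¹ Y_{-1} + Y_0 + …` preserves natural
operators. -/
lemma exp_conj_mem_naturalOps [Module ℚ (LaurentSeries 𝒜)] {Y : LaurentSeries 𝒜}
    (hY : VanishesBelow (-1) Y) (he : Y.map σ = Y) (hn : IsNilpotent Y)
    {T : LaurentSeries (Module.End ℂ 𝒜)} (hT : T ∈ naturalOps σ) :
    mulOp (IsNilpotent.exp (-Y)) * T * mulOp (IsNilpotent.exp Y) ∈ naturalOps σ := by
  have hS (c : ℂ) (x : LaurentSeries (Module.End ℂ 𝒜)) (hx : x ∈ naturalOps σ) :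
      c • x ∈ naturalOps σ := fun k => (ordSubmodule σ k).smul_mem c (hx k)
  have had (x : LaurentSeries (Module.End ℂ 𝒜)) (hx : x ∈ naturalOps σ) :=
    commutator_mem_naturalOps hY he hx
  exact map_exp_conj_mem (A := LaurentSeries (Module.End ℂ 𝒜)) (B := LaurentSeries 𝒜)
    (mulOp (A := 𝒜)) (naturalOps σ) hS hn had hT

lemma isNaturalOp_act {T : LaurentSeries (Module.End ℂ 𝒜)} (hT : T ∈ naturalOps σ) :
    IsNaturalOp σ (act T) := by
  refine ⟨fun k => T.coeff k, fun k => mem_ord_nat.1 (hT k), fun g n => ?_⟩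
  obtain ⟨s, hs⟩ := exists_vanishesBelow g
  rw [coeff_act (vanishesBelow_of_mem_naturalOps hT) hs,
    finsum_eq_sum_of_support_subset (s := Finset.range (n - s + 1).toNat)]
  · symm
    refine Finset.sum_bij (fun k _ => (k : ℤ)) ?_ ?_ ?_ ?_
    · intro k hk; simp at hk ⊢; omega
    · intro a _ b _ h; simpa using h
    · intro k hk
      rw [Finset.mem_Icc] at hk
      exact ⟨k.toNat, by simp; omega, by simp [hk.1]⟩
    · intros; rfl
  · intro k hk
    rw [Function.mem_support] at hk
    have : s ≤ n - k := not_lt.1 fun h => hk (by rw [hs _ h, map_zero])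
    simp
    omega

lemma isFormalDiffOp_act {T : LaurentSeries (Module.End ℂ 𝒜)} (hT : T ∈ naturalOps σ) :
    IsFormalDiffOp σ (act T) := by
  refine ⟨T.coeff, ⟨0, vanishesBelow_of_mem_naturalOps hT⟩, fun k => ⟨k.toNat, ?_⟩, fun g n => ?_⟩
  · rw [← mem_ord_nat]; exact ord_mono (Int.self_le_toNat k) (hT k)
  obtain ⟨s, hs⟩ := exists_vanishesBelow g
  have hT0 := vanishesBelow_of_mem_naturalOps hT
  rw [coeff_act hT0 hs, finsum_eq_sum_of_support_subset]
  intro k hk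
  rw [Function.mem_support] at hk
  have h1 : s ≤ n - k := not_lt.1 fun h => hk (by rw [hs _ h, map_zero])
  have h2 : 0 ≤ k := not_lt.1 fun h => hk (by rw [hT0 _ h, LinearMap.zero_apply])
  simp
  omega

/-- A formal product is natural if every element of `𝒜` is the leading term of the value at `1` of
a natural operator `T` that is given by multiplication by `T 1`. -/
lemma coeffMap_mem_ord {B : LaurentSeries 𝒜 → LaurentSeries 𝒜 → LaurentSeries 𝒜}
    (h : IsBounded₂ B)
    (hT : ∀ f : 𝒜, ∃ T ∈ naturalOps σ, (∀ g, act T g = B (act T 1) g) ∧ (act T 1).coeff 0 = f)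
    (r : ℤ) (f : 𝒜) : h.coeffMap r f ∈ ordSubmodule σ r := by
  obtain ⟨c, hc⟩ := h.bound
  rcases lt_or_ge r c with hr | hr
  · rw [h.coeffMap_eq_zero hc hr]; exact zero_mem _
  -- The induction starts at the lower bound `c`, possibly negative. In negative degrees it shows
  -- that the coefficients vanish.
  obtain ⟨n, rfl⟩ := Int.le.dest hr
  clear hr
  induction n using Nat.strong_induction_on generalizing f with
  | _ n ih =>
  obtain ⟨T, hTn, hTB, hTf⟩ := hT f
  have h0 : VanishesBelow 0 (act T 1) := fun k hk => by
    rw [← map_one (C : 𝒜 →+* LaurentSeries 𝒜), coeff_act_C,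
      vanishesBelow_of_mem_naturalOps hTn k hk, LinearMap.zero_apply]
  have h1 (k : ℤ) (hk : 0 < k) (f : 𝒜) :
      h.coeffMap (c + n - k) f ∈ ordSubmodule σ (c + n - k) := by
    rcases lt_or_ge (c + n - k) c with hr | hr
    · rw [h.coeffMap_eq_zero hc hr]; exact zero_mem _
    · have := ih (n - k.toNat) (by omega) f
      rwa [show c + ((n - k.toNat : ℕ) : ℤ) = c + n - k by omega] at this
  -- In `T g = B (T 1) g` the leading term `f` of `T 1` yields the wanted coefficient; the higher
  -- terms of `T 1` involve only earlier ones.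
  have h2 : T.coeff (c + n) = h.coeffMap (c + n) f
      + ∑ k ∈ Finset.Ioc 0 (n : ℤ), h.coeffMap (c + n - k) ((act T 1).coeff k) := by
    ext g
    rw [← coeff_act_C, hTB, (h.left (C g)).coeff_eq (c := c)
      (fun s f hf => by simpa using hc s 0 _ _ hf (vanishesBelow_C g)) h0,
      LinearMap.add_apply, LinearMap.sum_apply, add_sub_cancel_left,
      ← Finset.Ioc_insert_left (by positivity : (0 : ℤ) ≤ n), Finset.sum_insert (by simp), hTf,
      sub_zero]
    rfl
  rw [eq_sub_of_add_eq h2.symm]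
  refine sub_mem_ord (hTn _) (sum_mem fun k hk => ?_)
  rw [Finset.mem_Ioc] at hk
  exact ord_mono (by omega) (h1 k hk.1 _)

/-- The terms `ν^k f_k` with `k ≥ 0` only raise the degree in `ν`, which leaves more room for the
order. -/
lemma toOp_mem_naturalOps {B : LaurentSeries 𝒜 → LaurentSeries 𝒜 → LaurentSeries 𝒜}
    (h : IsBounded₂ B) (hB : ∀ r f, h.coeffMap r f ∈ ordSubmodule σ r) {f : LaurentSeries 𝒜}
    (hf : VanishesBelow 0 f) : (h.right f).toOp ∈ naturalOps σ := by
  intro n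
  obtain ⟨c, hc⟩ := h.bound
  have : (h.right f).toOp.coeff n
      = ∑ k ∈ Finset.Icc 0 (n - c), h.coeffMap (n - k) (f.coeff k) := by
    ext g
    rw [IsBounded.toOp_coeff, (h.left (C g)).coeff_eq (c := c)
      (fun s f hf => by simpa using hc s 0 _ _ hf (vanishesBelow_C g)) hf, LinearMap.sum_apply]
    rfl
  rw [this]
  refine sum_mem fun k hk => ?_
  rw [Finset.mem_Icc] at hk
  exact ord_mono (by omega) (hB _ _)

lemma map_C_linear {A B F : Type*} [Semiring A] [Semiring B] [FunLike F A B]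
    [ZeroHomClass F A B] (φ : F) (a : A) : (C a : LaurentSeries A).map φ = C (φ a) := by
  ext n
  by_cases hn : n = 0
  · simp [hn, C_apply]
  · simp [C_apply, coeff_single_of_ne hn]

/-- An associative unital graded product with natural expansion. -/
lemma isNaturalStarProduct_of_coeffMap (hσ : IsParity σ)
    {B : LaurentSeries 𝒜 → LaurentSeries 𝒜 → LaurentSeries 𝒜}
    (h : IsBounded₂ B) (hr : IsBounded₂ (gradedRight σ B))
    (hgr : ∀ f g, (B f g).map σ = B (f.map σ) (g.map σ))
    (hassoc : ∀ f g h, B (B f g) h = B f (B g h)) (hone : ∀ f, B 1 f = f) (hone' : ∀ f, B f 1 = f)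
    (hB : ∀ r f, h.coeffMap r f ∈ ordSubmodule σ r)
    (hBr : ∀ r f, hr.coeffMap r f ∈ ordSubmodule σ r) : IsNaturalStarProduct σ B where
  expansion := by
    refine ⟨h.coeffMap, coeffMap_hasExpansion h fun r hr => ?_, fun r f g => ?_, fun f g => ?_⟩
    -- Order at most `r < 0` means zero, so the expansion begins in degree `0`.
    · ext1 f; exact (mem_ord_neg hr).1 (hB r f)
    · rw [IsBounded₂.coeffMap_apply, IsBounded₂.coeffMap_apply, ← map_coeff, hgr,
        map_C_linear, map_C_linear]
    -- `C_0(f, ·)` has order zero, so the unit law `C_0(f, 1) = f` determines it.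
    · rw [eq_mulLeft_of_mem_ord_zero hσ (hB 0 f) g, IsBounded₂.coeffMap_apply, map_one, hone']
      simp
  assoc := hassoc
  one_mul := hone
  mul_one := hone'
  left_diff f := by
    have := isFormalDiffOp_act (toOp_mem_naturalOps h hB (vanishesBelow_C f))
    rwa [show act (h.right (C f)).toOp = B (C f) from funext (h.right (C f)).act_toOp] at this
  right_diff f := by
    have := isFormalDiffOp_act (toOp_mem_naturalOps hr hBr (vanishesBelow_C f))
    rwa [show act (hr.right (C f)).toOp = _ from funext (hr.right (C f)).act_toOp] at this
  left_natural f hf := by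
    have := isNaturalOp_act (toOp_mem_naturalOps h hB hf)
    rwa [show act (h.right f).toOp = B f from funext (h.right f).act_toOp] at this
  right_natural f hf := by
    have := isNaturalOp_act (toOp_mem_naturalOps hr hBr hf)
    rwa [show act (hr.right f).toOp = _ from funext (hr.right f).act_toOp] at this

/-- Graded right multiplication of a bounded product is bounded. -/
lemma gradedRight_isBounded₂ {B : LaurentSeries 𝒜 → LaurentSeries 𝒜 → LaurentSeries 𝒜}
    (h : IsBounded₂ B) : IsBounded₂ (gradedRight σ B) where
  left g := ((h.right g).comp (IsBounded.map _)).add' ((h.right _).comp (IsBounded.map _))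
  right f := (h.left _).add' ((h.left _).comp (IsBounded.map σ))
  bound := by
    obtain ⟨c, hc⟩ := h.bound
    refine ⟨c, fun s t f g hf hg => ?_⟩
    rw [add_comm s t]
    exact (hc _ _ _ _ hg (hf.map _)).add (hc _ _ _ _ (hg.map _) (hf.map _))

end Conjugation

/-! ### The monomials `θ^K θbar^L` -/

section Monomials

variable {d : ℕ}

/-- The index of `θ^α`. -/
abbrev thetaIdx (α : Fin d) : Fin d ⊕ₗ Fin d := toLex (Sum.inl α)

/-- The index of `θbar^β`. -/
abbrev thetaBarIdx (β : Fin d) : Fin d ⊕ₗ Fin d := toLex (Sum.inr β)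

/-- Pairs of subsets of `{1, …, d}` as indices of monomials. -/
def monomialEquiv : Finset (Fin d) × Finset (Fin d) ≃ Finset (Fin d ⊕ₗ Fin d) :=
  Finset.sumEquiv.symm.toEquiv.trans (toLex : Fin d ⊕ Fin d ≃ Fin d ⊕ₗ Fin d).finsetCongr

lemma monomialEquiv_apply (K L : Finset (Fin d)) : monomialEquiv (K, L) = monomialIndex K L := rfl

lemma monomialIndex_inj {K L K' L' : Finset (Fin d)} :
    monomialIndex K L = monomialIndex K' L' ↔ K = K' ∧ L = L' := by
  rw [← monomialEquiv_apply, ← monomialEquiv_apply, monomialEquiv.apply_eq_iff_eq, Prod.mk.injEq]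

lemma thetaIdx_mem {K L : Finset (Fin d)} {α : Fin d} :
    thetaIdx α ∈ monomialIndex K L ↔ α ∈ K := by
  simp [monomialIndex]

lemma thetaBarIdx_mem {K L : Finset (Fin d)} {α : Fin d} :
    thetaBarIdx α ∈ monomialIndex K L ↔ α ∈ L := by
  simp [monomialIndex]

lemma idx_cases {p : Fin d ⊕ₗ Fin d → Prop} (hl : ∀ α, p (thetaIdx α))
    (hr : ∀ α, p (thetaBarIdx α)) (i : Fin d ⊕ₗ Fin d) : p i := by
  rcases h : ofLex i with α | α
  · exact (show i = thetaIdx α from h) ▸ hl α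
  · exact (show i = thetaBarIdx α from h) ▸ hr α

lemma idx_finset_ext {S T : Finset (Fin d ⊕ₗ Fin d)} (hl : ∀ α, thetaIdx α ∈ S ↔ thetaIdx α ∈ T)
    (hr : ∀ α, thetaBarIdx α ∈ S ↔ thetaBarIdx α ∈ T) : S = T :=
  Finset.ext (idx_cases hl hr)

lemma insert_thetaIdx {_ : DecidableEq (Fin d ⊕ₗ Fin d)} (α : Fin d) (K L : Finset (Fin d)) :
    insert (thetaIdx α) (monomialIndex K L) = monomialIndex (insert α K) L := by
  apply idx_finset_ext <;> intro <;>
    simp only [Finset.mem_insert, thetaIdx_mem, thetaBarIdx_mem] <;> simp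

lemma insert_thetaBarIdx {_ : DecidableEq (Fin d ⊕ₗ Fin d)} (α : Fin d) (K L : Finset (Fin d)) :
    insert (thetaBarIdx α) (monomialIndex K L) = monomialIndex K (insert α L) := by
  apply idx_finset_ext <;> intro <;>
    simp only [Finset.mem_insert, thetaIdx_mem, thetaBarIdx_mem] <;> simp

lemma erase_thetaIdx {_ : DecidableEq (Fin d ⊕ₗ Fin d)} (α : Fin d) (K L : Finset (Fin d)) :
    (monomialIndex K L).erase (thetaIdx α) = monomialIndex (K.erase α) L := by
  apply idx_finset_ext <;> intro <;>
    simp only [Finset.mem_erase, thetaIdx_mem, thetaBarIdx_mem] <;> simp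

lemma erase_thetaBarIdx {_ : DecidableEq (Fin d ⊕ₗ Fin d)} (α : Fin d) (K L : Finset (Fin d)) :
    (monomialIndex K L).erase (thetaBarIdx α) = monomialIndex K (L.erase α) := by
  apply idx_finset_ext <;> intro <;>
    simp only [Finset.mem_erase, thetaIdx_mem, thetaBarIdx_mem] <;> simp

lemma monomialIndex_union {_ : DecidableEq (Fin d ⊕ₗ Fin d)} (K L : Finset (Fin d)) :
    monomialIndex K ∅ ∪ monomialIndex ∅ L = monomialIndex K L := by
  apply idx_finset_ext <;> intro <;>
    simp only [Finset.mem_union, thetaIdx_mem, thetaBarIdx_mem] <;> simp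

lemma monomialIndex_empty : monomialIndex (∅ : Finset (Fin d)) ∅ = ∅ := by
  simp [monomialIndex]

lemma card_monomialIndex (K L : Finset (Fin d)) :
    (monomialIndex K L).card = K.card + L.card := by
  simp [monomialIndex]

variable {R : Type*} [CommRing R] [Algebra ℂ R]

variable (R) in
/-- The monomial `θ^K θbar^L`. -/
def mono (K L : Finset (Fin d)) : Grassmann R (Fin d ⊕ₗ Fin d) :=
  grBasis R (Fin d ⊕ₗ Fin d) (monomialIndex K L)

omit [Algebra ℂ R] in
lemma mono_eq_mul (K L : Finset (Fin d)) : mono R K L = mono R K ∅ * mono R ∅ L := by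
  rw [mono, mono, mono, grBasis_mul_of_lt, monomialIndex_union]
  refine idx_cases (fun α _ => idx_cases (fun β h => ?_) fun β _ => Sum.Lex.inl_lt_inr α β)
    fun α h => ?_
  · rw [thetaIdx_mem] at h; simp at h
  · rw [thetaBarIdx_mem] at h; simp at h

lemma grParity_mono (K L : Finset (Fin d)) :
    grParity R _ (mono R K L) = (-1 : ℂ) ^ (K.card + L.card) • mono R K L := by
  rw [mono, grParity_grBasis, card_monomialIndex]

/-- The scalar does not depend on `L`, since `θ^α` acts from the left of `θ^K`. Hence the operator
is a matrix acting on the row index alone. -/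
lemma gen_theta_mul_mono (α : Fin d) : ∃ ε : Finset (Fin d) → ℂ, ∀ K L,
    gen R (thetaIdx α) * mono R K L = ε K • mono R (insert α K) L := by
  choose ε hε using fun K => exists_gen_mul_grBasis (R := R) (thetaIdx α) (monomialIndex K ∅)
  refine ⟨ε, fun K L => ?_⟩
  rw [mono_eq_mul, ← mul_assoc, mono, hε, smul_mul_assoc, insert_thetaIdx]
  exact congrArg _ (mono_eq_mul _ _).symm

lemma grDeriv_theta_mono (α : Fin d) : ∃ ε : Finset (Fin d) → ℂ, ∀ K L,
    grDeriv (thetaIdx α) (mono R K L) = ε K • mono R (K.erase α) L := by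
  choose ε hε using fun K => exists_grDeriv_grBasis (R := R) (thetaIdx α) (monomialIndex K ∅)
  refine ⟨ε, fun K L => ?_⟩
  rw [mono_eq_mul, grDeriv_mul, mono, hε, mono, grDeriv_grBasis_of_notMem, mul_zero, add_zero,
    smul_mul_assoc, erase_thetaIdx]
  · exact congrArg _ (mono_eq_mul _ _).symm
  · rw [thetaIdx_mem]; simp

/-- Passing `θbar^β` through `θ^K` costs `(-1)^|K|`, and the remaining scalar depends on `L` alone.
The parity clause says that the matrix acting on the column index is odd, so the sign is that of
graded right multiplication. -/
lemma gen_thetaBar_mul_mono (β : Fin d) : ∃ ε : Finset (Fin d) → ℂ,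
    (∀ K L, gen R (thetaBarIdx β) * mono R K L
      = ((-1) ^ K.card * ε L) • mono R K (insert β L)) ∧
    ∀ L, ε L ≠ 0 → Odd ((insert β L).card + L.card) := by
  have h1 (L : Finset (Fin d)) : ∃ ε : ℂ, gen R (thetaBarIdx β) * mono R ∅ L
      = ε • mono R ∅ (insert β L) ∧ (ε ≠ 0 → Odd ((insert β L).card + L.card)) := by
    by_cases h : β ∈ L
    · exact ⟨0, by rw [mono, gen_mul_grBasis_of_mem (thetaBarIdx_mem.2 h), zero_smul], by simp⟩
    · obtain ⟨ε, hε⟩ := exists_gen_mul_grBasis (R := R) (thetaBarIdx β) (monomialIndex ∅ L)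
      refine ⟨ε, by rw [mono, hε, insert_thetaBarIdx]; rfl, fun _ => ?_⟩
      rw [Finset.card_insert_of_notMem h]
      exact ⟨L.card, by ring⟩
  choose ε hε using h1
  refine ⟨ε, fun K L => ?_, fun L => (hε L).2⟩
  have h2 : gen R (thetaBarIdx β) * mono R K ∅
      = (-1 : ℂ) ^ K.card • (mono R K ∅ * gen R (thetaBarIdx β)) := by
    rw [gen, mul_ι_eq, grParity_mono, Finset.card_empty, add_zero, mul_smul_comm, smul_smul,
      ← pow_add, Even.neg_one_pow ⟨_, rfl⟩, one_smul]
  rw [mono_eq_mul, ← mul_assoc, h2, smul_mul_assoc, mul_assoc, (hε L).1, mul_smul_comm, smul_smul,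
    ← mono_eq_mul]

lemma grDeriv_thetaBar_mono (β : Fin d) : ∃ ε : Finset (Fin d) → ℂ,
    (∀ K L, grDeriv (thetaBarIdx β) (mono R K L)
      = ((-1) ^ K.card * ε L) • mono R K (L.erase β)) ∧
    ∀ L, ε L ≠ 0 → Odd ((L.erase β).card + L.card) := by
  have h1 (L : Finset (Fin d)) : ∃ ε : ℂ, grDeriv (thetaBarIdx β) (mono R ∅ L)
      = ε • mono R ∅ (L.erase β) ∧ (ε ≠ 0 → Odd ((L.erase β).card + L.card)) := by
    by_cases h : β ∈ L
    · obtain ⟨ε, hε⟩ := exists_grDeriv_grBasis (R := R) (thetaBarIdx β) (monomialIndex ∅ L)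
      refine ⟨ε, by rw [mono, hε, erase_thetaBarIdx]; rfl, fun _ => ?_⟩
      have := Finset.card_erase_add_one h
      exact ⟨(L.erase β).card, by omega⟩
    · exact ⟨0, by rw [mono, grDeriv_grBasis_of_notMem (mt thetaBarIdx_mem.1 h), zero_smul],
        by simp⟩
  choose ε hε using h1
  refine ⟨ε, fun K L => ?_, fun L => (hε L).2⟩
  have h2 : grDeriv (thetaBarIdx β) (mono R K ∅) = 0 :=
    grDeriv_grBasis_of_notMem (mt thetaBarIdx_mem.1 (by simp))
  rw [mono_eq_mul, grDeriv_mul, h2, zero_mul, zero_add, grParity_mono, Finset.card_empty, add_zero,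
    (hε L).1, smul_mul_assoc, mul_smul_comm, smul_smul, ← mono_eq_mul]

end Monomials

/-! ### Coefficient matrices -/

section CoefMatrix

open HahnSeries

variable {d : ℕ} {R : Type*} [CommRing R] [Algebra ℂ R]

/-- The coefficient of `θ^K θbar^L`. -/
def monoCoord (K L : Finset (Fin d)) : Grassmann R (Fin d ⊕ₗ Fin d) →ₗ[ℂ] R :=
  ((grBasis R (Fin d ⊕ₗ Fin d)).coord (monomialIndex K L)).restrictScalars ℂ

lemma monoCoord_smul_mono (K L K' L' : Finset (Fin d)) (r : R) :
    monoCoord K L (r • mono R K' L') = if K' = K ∧ L' = L then r else 0 := by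
  rw [monoCoord, mono, LinearMap.restrictScalars_apply, grCoord_basis]
  simp only [monomialIndex_inj]

lemma sum_monoCoord (f : Grassmann R (Fin d ⊕ₗ Fin d)) :
    ∑ K, ∑ L, monoCoord K L f • mono R K L = f := by
  conv_rhs => rw [← (grBasis R (Fin d ⊕ₗ Fin d)).sum_repr f]
  rw [← Finset.sum_product', Finset.univ_product_univ]
  exact Fintype.sum_equiv monomialEquiv _ _ fun _ => rfl

lemma mono_ext {V : Type*} [AddCommMonoid V] [Module ℂ V]
    {X Y : Grassmann R (Fin d ⊕ₗ Fin d) →ₗ[ℂ] V}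
    (h : ∀ (r : R) K L, X (r • mono R K L) = Y (r • mono R K L)) : X = Y := by
  ext f
  rw [← sum_monoCoord f]
  simp only [map_sum, h]

/-- The matrix of coefficients `(h_{KL})` of `h = ∑ h_{KL} θ^K θbar^L`. -/
def coefs (h : LaurentSeries (Grassmann R (Fin d ⊕ₗ Fin d))) :
    Matrix (Finset (Fin d)) (Finset (Fin d)) (LaurentSeries R) :=
  fun K L => h.map (monoCoord K L)

/-- The formal function with given coefficients. -/
def ofCoefs (A : Matrix (Finset (Fin d)) (Finset (Fin d)) (LaurentSeries R)) :
    LaurentSeries (Grassmann R (Fin d ⊕ₗ Fin d)) :=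
  ∑ K, ∑ L, (A K L).map ((LinearMap.toSpanSingleton R (Grassmann R (Fin d ⊕ₗ Fin d))
    (mono R K L)).restrictScalars ℂ)

lemma coefs_add (g h : LaurentSeries (Grassmann R (Fin d ⊕ₗ Fin d))) :
    coefs (g + h) = coefs g + coefs h := by
  ext K L n; simp [coefs]

lemma coefs_isBounded (K L : Finset (Fin d)) :
    IsBounded (fun h : LaurentSeries (Grassmann R (Fin d ⊕ₗ Fin d)) => coefs h K L) :=
  IsBounded.map _

lemma coeff_ofCoefs (A : Matrix (Finset (Fin d)) (Finset (Fin d)) (LaurentSeries R)) (n : ℤ) :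
    (ofCoefs A).coeff n = ∑ K, ∑ L, (A K L).coeff n • mono R K L := by
  simp [ofCoefs, coeff_sum]

lemma coefs_ofCoefs (A : Matrix (Finset (Fin d)) (Finset (Fin d)) (LaurentSeries R)) :
    coefs (ofCoefs A) = A := by
  ext K L n
  rw [coefs, map_coeff, coeff_ofCoefs, map_sum, Finset.sum_eq_single K, map_sum,
    Finset.sum_eq_single L, monoCoord_smul_mono]
  · simp
  · intro L' _ hL; rw [monoCoord_smul_mono, if_neg (fun h => hL h.2)]
  · simp
  · intro K' _ hK
    rw [map_sum]
    exact Finset.sum_eq_zero fun L' _ => by rw [monoCoord_smul_mono, if_neg (fun h => hK h.1)]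
  · simp

lemma ofCoefs_coefs (h : LaurentSeries (Grassmann R (Fin d ⊕ₗ Fin d))) :
    ofCoefs (coefs h) = h := by
  ext1; ext1 n
  rw [coeff_ofCoefs]
  exact sum_monoCoord _

lemma coefs_injective : Function.Injective (coefs (d := d) (R := R)) :=
  Function.LeftInverse.injective ofCoefs_coefs

/-- The action of the parity on matrices. -/
def matParity (A : Matrix (Finset (Fin d)) (Finset (Fin d)) (LaurentSeries R)) :
    Matrix (Finset (Fin d)) (Finset (Fin d)) (LaurentSeries R) :=
  fun K L => (-1 : ℂ) ^ (K.card + L.card) • A K L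

lemma coefs_map_parity (h : LaurentSeries (Grassmann R (Fin d ⊕ₗ Fin d))) :
    coefs (h.map (grParity R (Fin d ⊕ₗ Fin d))) = matParity (coefs h) := by
  refine Matrix.ext fun K L => ?_
  have : monoCoord K L ∘ₗ grParity R (Fin d ⊕ₗ Fin d)
      = (-1 : ℂ) ^ (K.card + L.card) • monoCoord K L := by
    refine mono_ext fun r K' L' => ?_
    rw [LinearMap.comp_apply, grParity_smul, grParity_mono, smul_comm, map_smul,
      LinearMap.smul_apply, monoCoord_smul_mono]
    split_ifs with h
    · rw [h.1, h.2]
    · simp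
  ext n
  exact LinearMap.congr_fun this _

end CoefMatrix

/-! ### Matrices over the star algebra and the operators they define -/

section StarMatrix

open HahnSeries

variable {d : ℕ} {R : Type*} [CommRing R] [Algebra ℂ R]

/-- The product of matrices with respect to a product of formal functions. -/
def matMul (star : LaurentSeries R → LaurentSeries R → LaurentSeries R)
    (A B : Matrix (Finset (Fin d)) (Finset (Fin d)) (LaurentSeries R)) :
    Matrix (Finset (Fin d)) (Finset (Fin d)) (LaurentSeries R) :=
  fun K L => ∑ I, star (A K I) (B I L)

variable {star : LaurentSeries R → LaurentSeries R → LaurentSeries R}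
  {A B D : Matrix (Finset (Fin d)) (Finset (Fin d)) (LaurentSeries R)}

omit [Algebra ℂ R] in
lemma matMul_apply (K L : Finset (Fin d)) : matMul star A B K L = ∑ I, star (A K I) (B I L) := rfl

lemma matParity_apply (K L : Finset (Fin d)) :
    matParity A K L = (-1 : ℂ) ^ (K.card + L.card) • A K L := rfl

lemma coefs_neg (h : LaurentSeries (Grassmann R (Fin d ⊕ₗ Fin d))) : coefs (-h) = -coefs h := by
  ext; simp [coefs]

lemma act_neg {A : Type*} [Ring A] [Algebra ℂ A] (S : LaurentSeries (Module.End ℂ A))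
    (h : LaurentSeries A) : act (-S) h = -act S h := by
  refine eq_neg_iff_add_eq_zero.2 ((act_add _ _ _).symm.trans ?_)
  exact (congrArg (act · h) (neg_add_cancel S)).trans (by simp [act])

lemma matMul_add (h : IsBounded₂ star) :
    matMul star A (B + D) = matMul star A B + matMul star A D := by
  refine Matrix.ext fun K L => ?_
  simp only [matMul, Matrix.add_apply, (h.right _).add, Finset.sum_add_distrib]

lemma add_matMul (h : IsBounded₂ star) :
    matMul star (A + B) D = matMul star A D + matMul star B D := by
  refine Matrix.ext fun K L => ?_
  simp only [matMul, Matrix.add_apply, (h.left _).add, Finset.sum_add_distrib]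

lemma matMul_neg (h : IsBounded₂ star) : matMul star A (-B) = -matMul star A B := by
  refine Matrix.ext fun K L => ?_
  simp only [matMul, Matrix.neg_apply, (h.right _).map_neg, Finset.sum_neg_distrib]

lemma neg_matMul (h : IsBounded₂ star) : matMul star (-A) B = -matMul star A B := by
  refine Matrix.ext fun K L => ?_
  simp only [matMul, Matrix.neg_apply, (h.left _).map_neg, Finset.sum_neg_distrib]

lemma matMul_zero (h : IsBounded₂ star) : matMul star A 0 = 0 := by
  refine Matrix.ext fun K L => ?_
  simp only [matMul, Matrix.zero_apply, (h.right _).map_zero, Finset.sum_const_zero]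

lemma zero_matMul (h : IsBounded₂ star) : matMul star 0 A = 0 := by
  refine Matrix.ext fun K L => ?_
  simp only [matMul, Matrix.zero_apply, (h.left _).map_zero, Finset.sum_const_zero]

lemma matMul_diagonal (h : IsBounded₂ star) (a : LaurentSeries R) (K L : Finset (Fin d)) :
    matMul star A (Matrix.diagonal fun _ => a) K L = star (A K L) a := by
  rw [matMul, Finset.sum_eq_single L]
  · rw [Matrix.diagonal_apply_eq]
  · intro I _ hI; rw [Matrix.diagonal_apply_ne _ hI, (h.right _).map_zero]
  · simp

lemma diagonal_matMul (h : IsBounded₂ star) (a : LaurentSeries R) (K L : Finset (Fin d)) :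
    matMul star (Matrix.diagonal fun _ => a) A K L = star a (A K L) := by
  rw [matMul, Finset.sum_eq_single K]
  · rw [Matrix.diagonal_apply_eq]
  · intro I _ hI; rw [Matrix.diagonal_apply_ne _ hI.symm, (h.left _).map_zero]
  · simp

lemma matMul_assoc (hs : IsStarProduct LinearMap.id star) :
    matMul star (matMul star A B) D = matMul star A (matMul star B D) := by
  refine Matrix.ext fun K L => ?_
  have h := hs.isBounded₂
  simp only [matMul, (h.right _).map_sum, (h.left _).map_sum, hs.assoc]
  exact Finset.sum_comm

lemma matMul_one (hs : IsStarProduct LinearMap.id star) : matMul star A 1 = A := by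
  refine Matrix.ext fun K L => ?_
  rw [show (1 : Matrix (Finset (Fin d)) (Finset (Fin d)) (LaurentSeries R))
    = Matrix.diagonal fun _ => 1 from rfl, matMul_diagonal hs.isBounded₂, hs.mul_one]

lemma one_matMul (hs : IsStarProduct LinearMap.id star) : matMul star 1 A = A := by
  refine Matrix.ext fun K L => ?_
  rw [show (1 : Matrix (Finset (Fin d)) (Finset (Fin d)) (LaurentSeries R))
    = Matrix.diagonal fun _ => 1 from rfl, diagonal_matMul hs.isBounded₂, hs.one_mul]

lemma matMul_vanishesBelow (hs : IsStarProduct LinearMap.id star)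
    (hA : ∀ K L, VanishesBelow 0 (A K L)) (hB : ∀ K L, VanishesBelow 0 (B K L))
    (K L : Finset (Fin d)) : VanishesBelow 0 (matMul star A B K L) :=
  VanishesBelow.sum fun I _ => by simpa using hs.vanishesBelow (hA K I) (hB I L)

lemma matParity_add : matParity (A + B) = matParity A + matParity B :=
  Matrix.ext fun _ _ => smul_add _ _ _

lemma matParity_neg : matParity (-A) = -matParity A :=
  Matrix.ext fun _ _ => smul_neg _ _

lemma matParity_zero :
    matParity (0 : Matrix (Finset (Fin d)) (Finset (Fin d)) (LaurentSeries R)) = 0 :=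
  Matrix.ext fun _ _ => smul_zero _

lemma matParity_diagonal (a : LaurentSeries R) :
    matParity (Matrix.diagonal fun _ : Finset (Fin d) => a) = Matrix.diagonal fun _ => a := by
  refine Matrix.ext fun K L => ?_
  rw [matParity_apply]
  by_cases h : K = L
  · rw [h, Matrix.diagonal_apply_eq, Even.neg_one_pow ⟨_, rfl⟩, one_smul]
  · rw [Matrix.diagonal_apply_ne _ h, smul_zero]

lemma matParity_matParity : matParity (matParity A) = A := by
  refine Matrix.ext fun K L => ?_
  rw [matParity_apply, matParity_apply, smul_smul, ← _root_.pow_add,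
    Even.neg_one_pow ⟨_, rfl⟩, one_smul]

/-- The parity of the summation index enters twice and cancels. -/
lemma matParity_matMul (h : IsBounded₂ star) :
    matParity (matMul star A B) = matMul star (matParity A) (matParity B) := by
  refine Matrix.ext fun K L => ?_
  simp only [matParity_apply, matMul_apply, Finset.smul_sum, (h.right _).smul, (h.left _).smul,
    smul_smul,
    ← _root_.pow_add]
  refine Finset.sum_congr rfl fun I _ => ?_
  rw [show I.card + L.card + (K.card + I.card) = K.card + L.card + (I.card + I.card) by ring,
    _root_.pow_add _ (K.card + L.card), Even.neg_one_pow (n := I.card + I.card) ⟨_, rfl⟩, mul_one]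

lemma star_algebraMap_left (hs : IsStarProduct LinearMap.id star) (c : ℂ) (f : LaurentSeries R) :
    star (C (algebraMap ℂ R c)) f = c • f := by
  rw [Algebra.algebraMap_eq_smul_one, C_smul, (hs.isBounded₂.left f).smul, map_one, hs.one_mul]

lemma star_algebraMap_right (hs : IsStarProduct LinearMap.id star) (c : ℂ) (f : LaurentSeries R) :
    star f (C (algebraMap ℂ R c)) = c • f := by
  rw [Algebra.algebraMap_eq_smul_one, C_smul, (hs.isBounded₂.right f).smul, map_one, hs.mul_one]

lemma act_shift_C {A : Type*} [Ring A] [Algebra ℂ A] (k : ℤ) (X : Module.End ℂ A)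
    (h : LaurentSeries A) : act (shift k (C X)) h = shift k (h.map X) := by
  refine (act_isBounded _).ext (Ψ := fun h => shift k (h.map X)) ?_ (fun a => ?_) h
  · exact (IsBounded.mul_left _).comp (IsBounded.map X)
  · ext n
    rw [coeff_act_C, map_C_linear, coeff_shift, coeff_shift]
    by_cases hn : n - k = 0
    · simp [hn, C_apply]
    · simp [C_apply, coeff_single_of_ne hn]

/-- The operators on formal functions given by multiplication of the matrix of coefficients by a
matrix from the left. -/
def leftOps (d : ℕ) (hs : IsStarProduct LinearMap.id star) :
    Subring (LaurentSeries (Module.End ℂ (Grassmann R (Fin d ⊕ₗ Fin d)))) where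
  carrier := {T | ∃ F : Matrix (Finset (Fin d)) (Finset (Fin d)) (LaurentSeries R),
    (∀ K L, VanishesBelow 0 (F K L)) ∧ ∀ h, coefs (act T h) = matMul star F (coefs h)}
  zero_mem' := ⟨0, fun _ _ => vanishesBelow_zero _, fun h => by
    rw [zero_matMul hs.isBounded₂]; ext; simp [act, coefs]⟩
  one_mem' := ⟨Matrix.diagonal fun _ => 1, fun K L => by
    by_cases h : K = L
    · rw [h, Matrix.diagonal_apply_eq, ← map_one (C : R →+* _)]; exact vanishesBelow_C _
    · rw [Matrix.diagonal_apply_ne _ h]; exact vanishesBelow_zero _, fun h => by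
    rw [act_one]; exact (one_matMul hs).symm⟩
  add_mem' := by
    rintro S T ⟨F, hF, hS⟩ ⟨G, hG, hT⟩
    refine ⟨F + G, fun K L => (hF K L).add (hG K L), fun h => ?_⟩
    rw [act_add, coefs_add, hS, hT, add_matMul hs.isBounded₂]
  neg_mem' := by
    rintro S ⟨F, hF, hS⟩
    refine ⟨-F, fun K L n hn => by simp [hF K L n hn], fun h => ?_⟩
    rw [neg_matMul hs.isBounded₂, ← hS]
    rw [act_neg, coefs_neg]
  mul_mem' := by
    rintro S T ⟨F, hF, hS⟩ ⟨G, hG, hT⟩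
    refine ⟨matMul star F G, matMul_vanishesBelow hs hF hG, fun h => ?_⟩
    rw [act_mul, hS, hT, matMul_assoc hs]

/-- The operators on formal functions given by graded multiplication of the matrix of coefficients
by a matrix from the right, whose even and odd parts are `G₀` and `G₁`. -/
def rightOps (d : ℕ) (hs : IsStarProduct LinearMap.id star) :
    Subring (LaurentSeries (Module.End ℂ (Grassmann R (Fin d ⊕ₗ Fin d)))) where
  carrier := {T | ∃ G₀ G₁ : Matrix (Finset (Fin d)) (Finset (Fin d)) (LaurentSeries R),
    ((∀ K L, VanishesBelow 0 (G₀ K L)) ∧ (∀ K L, VanishesBelow 0 (G₁ K L)) ∧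
      matParity G₀ = G₀ ∧ matParity G₁ = -G₁) ∧
    ∀ h, coefs (act T h) = matMul star (coefs h) G₀ + matMul star (matParity (coefs h)) G₁}
  zero_mem' := ⟨0, 0, ⟨fun _ _ => vanishesBelow_zero _, fun _ _ => vanishesBelow_zero _,
    matParity_zero, by rw [matParity_zero, neg_zero]⟩, fun h => by
    rw [matMul_zero hs.isBounded₂, matMul_zero hs.isBounded₂]; ext; simp [act, coefs]⟩
  one_mem' := ⟨Matrix.diagonal fun _ => 1, 0, ⟨fun K L => by
    by_cases h : K = L
    · rw [h, Matrix.diagonal_apply_eq, ← map_one (C : R →+* _)]; exact vanishesBelow_C _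
    · rw [Matrix.diagonal_apply_ne _ h]; exact vanishesBelow_zero _,
    fun _ _ => vanishesBelow_zero _, matParity_diagonal _, by rw [matParity_zero, neg_zero]⟩,
    fun h => by
      rw [act_one, matMul_zero hs.isBounded₂, add_zero]; exact (matMul_one hs).symm⟩
  add_mem' := by
    rintro S T ⟨F₀, F₁, ⟨h1, h2, h3, h4⟩, hS⟩ ⟨G₀, G₁, ⟨k1, k2, k3, k4⟩, hT⟩
    refine ⟨F₀ + G₀, F₁ + G₁, ⟨fun K L => (h1 K L).add (k1 K L), fun K L => (h2 K L).add (k2 K L),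
      by rw [matParity_add, h3, k3], by rw [matParity_add, h4, k4, neg_add]⟩, fun h => ?_⟩
    rw [act_add, coefs_add, hS, hT, matMul_add hs.isBounded₂, matMul_add hs.isBounded₂]
    abel
  neg_mem' := by
    rintro S ⟨F₀, F₁, ⟨h1, h2, h3, h4⟩, hS⟩
    refine ⟨-F₀, -F₁, ⟨fun K L n hn => by simp [h1 K L n hn], fun K L n hn => by simp [h2 K L n hn],
      by rw [matParity_neg, h3], by rw [matParity_neg, h4]⟩, fun h => ?_⟩
    rw [matMul_neg hs.isBounded₂, matMul_neg hs.isBounded₂, ← neg_add, ← hS]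
    rw [act_neg, coefs_neg]
  mul_mem' := by
    rintro S T ⟨F₀, F₁, ⟨h1, h2, h3, h4⟩, hS⟩ ⟨G₀, G₁, ⟨k1, k2, k3, k4⟩, hT⟩
    have hb := hs.isBounded₂
    -- `T` acts before `S`, which puts its matrices on the left. The minus sign arises when the
    -- parity used with `F₁` meets the odd matrix `G₁`.
    refine ⟨matMul star G₀ F₀ + -matMul star G₁ F₁, matMul star G₁ F₀ + matMul star G₀ F₁,
      ⟨fun K L => (matMul_vanishesBelow hs k1 h1 K L).add fun n hn => ?_,
        fun K L => (matMul_vanishesBelow hs k2 h1 K L).add (matMul_vanishesBelow hs k1 h2 K L),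
        ?_, ?_⟩, fun h => ?_⟩
    · rw [Matrix.neg_apply, coeff_neg, matMul_vanishesBelow hs k2 h2 K L n hn, neg_zero]
    · rw [matParity_add, matParity_neg, matParity_matMul hb, matParity_matMul hb, h3, h4, k3, k4,
        matMul_neg hb, neg_matMul hb, neg_neg]
    · rw [matParity_add, matParity_matMul hb, matParity_matMul hb, h3, h4, k3, k4,
        matMul_neg hb, neg_matMul hb, neg_add]
    · rw [act_mul, hS, hT, matParity_add, matParity_matMul hb, matParity_matMul hb, k3, k4,
        matParity_matParity]
      simp only [matMul_add hb, add_matMul hb, matMul_neg hb, neg_matMul hb, matMul_assoc hs]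
      abel

/-- Scalars act in `⋆` as ordinary scalars, so an operator that acts on the row index with scalar
coefficients is left multiplication by a constant matrix. -/
lemma shift_C_mem_leftOps (hs : IsStarProduct LinearMap.id star)
    (X : Module.End ℂ (Grassmann R (Fin d ⊕ₗ Fin d))) (hX : ∀ (r : R) f, X (r • f) = r • X f)
    {ε : Finset (Fin d) → ℂ} {p : Finset (Fin d) → Finset (Fin d)}
    (hp : ∀ K L, X (mono R K L) = ε K • mono R (p K) L) {k : ℤ} (hk : 0 ≤ k) :
    shift k (C X) ∈ leftOps d hs := by
  have h1 (K L : Finset (Fin d)) : monoCoord K L ∘ₗ X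
      = ∑ I, (if p I = K then ε I else 0) • monoCoord I L := by
    refine mono_ext fun r I L' => ?_
    rw [LinearMap.comp_apply, hX, hp, smul_comm, map_smul, monoCoord_smul_mono,
      LinearMap.sum_apply, Finset.sum_eq_single I]
    · rw [LinearMap.smul_apply, monoCoord_smul_mono]
      by_cases h : p I = K <;> simp [h]
    · intro J _ hJ
      rw [LinearMap.smul_apply, monoCoord_smul_mono,
        if_neg (c := I = J ∧ L' = L) (fun h => hJ h.1.symm), smul_zero]
    · simp
  refine ⟨fun K I => shift k (C (algebraMap ℂ R (if p I = K then ε I else 0))),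
    fun K L => ((vanishesBelow_C _).shift k).mono (by omega), fun h => ?_⟩
  refine Matrix.ext fun K L => ?_
  simp only [matMul, (hs.isBounded₂.left _).shift, star_algebraMap_left hs]
  rw [act_shift_C]
  ext n
  rw [coefs, map_shift, coeff_sum]
  simp only [coeff_shift, coeff_smul]
  exact (LinearMap.congr_fun (h1 K L) _).trans (LinearMap.sum_apply _ _ _)

lemma shift_C_mem_rightOps (hs : IsStarProduct LinearMap.id star)
    (X : Module.End ℂ (Grassmann R (Fin d ⊕ₗ Fin d))) (hX : ∀ (r : R) f, X (r • f) = r • X f)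
    {ε : Finset (Fin d) → ℂ} {p : Finset (Fin d) → Finset (Fin d)}
    (hp : ∀ K L, X (mono R K L) = ((-1) ^ K.card * ε L) • mono R K (p L))
    (hε : ∀ L, ε L ≠ 0 → Odd ((p L).card + L.card)) {k : ℤ} (hk : 0 ≤ k) :
    shift k (C X) ∈ rightOps d hs := by
  have h1 (K L : Finset (Fin d)) : monoCoord K L ∘ₗ X
      = ∑ I, ((if p I = L then (-1) ^ I.card * ε I else 0) * (-1) ^ (K.card + I.card))
          • monoCoord K I := by
    refine mono_ext fun r K' I => ?_
    rw [LinearMap.comp_apply, hX, hp, smul_comm, map_smul, monoCoord_smul_mono,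
      LinearMap.sum_apply, Finset.sum_eq_single I]
    · rw [LinearMap.smul_apply, monoCoord_smul_mono]
      by_cases h : K' = K
      · by_cases h' : p I = L
        · simp only [h, h', and_self, if_true]
          rw [show (-1 : ℂ) ^ I.card * ε I * (-1) ^ (K.card + I.card)
            = (-1 : ℂ) ^ (I.card + I.card) * ((-1) ^ K.card * ε I) by
              rw [_root_.pow_add, _root_.pow_add]; ring,
            Even.neg_one_pow (n := I.card + I.card) ⟨_, rfl⟩, one_mul]
        · simp [h']
      · simp [h]
    · intro J _ hJ
      rw [LinearMap.smul_apply, monoCoord_smul_mono,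
        if_neg (c := K' = K ∧ I = J) (fun h => hJ h.2.symm), smul_zero]
    · simp
  -- The even part is zero. In the odd part, `matParity` contributes `(-1)^(|K| + |I|)`; the extra
  -- factor `(-1)^|I|` reduces this to the required `(-1)^|K|`.
  refine ⟨0, fun I L => shift k (C (algebraMap ℂ R (if p I = L then (-1) ^ I.card * ε I else 0))),
    ⟨fun _ _ => vanishesBelow_zero _, fun K L => ((vanishesBelow_C _).shift k).mono (by omega),
      matParity_zero, Matrix.ext fun I L => ?_⟩, fun h => ?_⟩
  · change (-1 : ℂ) ^ (I.card + L.card) • shift k (C (algebraMap ℂ R _))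
      = -shift k (C (algebraMap ℂ R _))
    by_cases h : p I = L
    · by_cases h0 : ε I = 0
      · ext n; simp [h0, C_apply]
      · rw [← h, add_comm, (hε I h0).neg_one_pow, neg_one_smul]
    · ext n; simp [h, C_apply]
  rw [matMul_zero hs.isBounded₂, zero_add]
  refine Matrix.ext fun K L => ?_
  simp only [matMul, (hs.isBounded₂.right _).shift, star_algebraMap_right hs, matParity_apply]
  rw [act_shift_C]
  ext n
  rw [coefs, map_shift, coeff_sum]
  simp only [coeff_shift, coeff_smul]
  exact (LinearMap.congr_fun (h1 K L) _).trans (by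
    simp only [LinearMap.sum_apply, LinearMap.smul_apply, mul_smul]; rfl)

/-- The operators acting on coefficients, as a linear function of the operator. -/
def extendLin (R I : Type*) [CommRing R] [Algebra ℂ R] [LinearOrder I] [Fintype I] :
    Module.End ℂ R →ₗ[ℂ] Module.End ℂ (Grassmann R I) where
  toFun := extend
  map_add' X Y := by
    ext f
    simp only [LinearMap.add_apply, extend_apply, add_smul, Finset.sum_add_distrib]
  map_smul' c X := by
    ext f
    simp only [LinearMap.smul_apply, extend_apply, Finset.smul_sum, smul_assoc, RingHom.id_apply]

lemma coefs_act_extend (T : LaurentSeries (Module.End ℂ R))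
    (h : LaurentSeries (Grassmann R (Fin d ⊕ₗ Fin d))) (K L : Finset (Fin d)) :
    coefs (act (T.map (extendLin R (Fin d ⊕ₗ Fin d))) h) K L = act T (coefs h K L) := by
  refine ((coefs_isBounded K L).comp (act_isBounded _)).ext
    ((act_isBounded T).comp (coefs_isBounded K L)) (fun f => ?_) h
  ext n
  rw [coefs, map_coeff, coeff_act_C, coefs, map_C_linear, coeff_act_C, map_coeff]
  exact grCoord_extend _ _ _

lemma extend_leftOp_mem_leftOps (hs : IsStarProduct LinearMap.id star) (a : R) :
    (leftOp hs.isBounded₂ a).map (extendLin R (Fin d ⊕ₗ Fin d)) ∈ leftOps d hs := by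
  refine ⟨Matrix.diagonal fun _ => C a, fun K L => ?_, fun h => Matrix.ext fun K L => ?_⟩
  · by_cases h : K = L
    · rw [h, Matrix.diagonal_apply_eq]; exact vanishesBelow_C _
    · rw [Matrix.diagonal_apply_ne _ h]; exact vanishesBelow_zero _
  · rw [diagonal_matMul hs.isBounded₂, coefs_act_extend, leftOp, IsBounded.act_toOp]

lemma extend_rightOp_mem_rightOps (hs : IsStarProduct LinearMap.id star) (a : R) :
    (rightOp hs.isBounded₂ a).map (extendLin R (Fin d ⊕ₗ Fin d)) ∈ rightOps d hs := by
  refine ⟨Matrix.diagonal fun _ => C a, 0, ⟨fun K L => ?_, fun _ _ => vanishesBelow_zero _,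
    matParity_diagonal _, by rw [matParity_zero, neg_zero]⟩, fun h => Matrix.ext fun K L => ?_⟩
  · by_cases h : K = L
    · rw [h, Matrix.diagonal_apply_eq]; exact vanishesBelow_C _
    · rw [Matrix.diagonal_apply_ne _ h]; exact vanishesBelow_zero _
  · rw [matMul_zero hs.isBounded₂, add_zero, matMul_diagonal hs.isBounded₂, coefs_act_extend,
      rightOp, IsBounded.act_toOp]

end StarMatrix

/-! ### Conjugated operators and their symbols -/

section Symbols

open HahnSeries

variable {A B : Type*} [Ring A] [Algebra ℂ A] [Ring B] [Algebra ℂ B]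

/-- A bounded map that hits every leading term is surjective. -/
lemma surjective_of_leading {Φ : LaurentSeries A → LaurentSeries B} (hΦ : IsBounded Φ)
    (h : ∀ b : B, ∃ x, VanishesBelow 0 x ∧ VanishesBelow 0 (Φ x) ∧ (Φ x).coeff 0 = b) :
    Function.Surjective Φ := by
  choose x hx hΦx hb using h
  have key (f : LaurentSeries B) (hf : VanishesBelow 0 f) : ∃ y, Φ y = f := by
    -- Remove the leading term by an image under `Φ` and divide the remainder by `ν`.
    let next (g : LaurentSeries B) : LaurentSeries B := shift (-1) (g - Φ (x (g.coeff 0)))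
    let g (k : ℕ) : LaurentSeries B := next^[k] f
    have hg (k : ℕ) : VanishesBelow 0 (g k) := by
      induction k with
      | zero => exact hf
      | succ k ih =>
        intro n hn
        simp only [g, Function.iterate_succ_apply', next]
        rw [coeff_shift, coeff_sub]
        change (g k).coeff (n - -1) - (Φ (x ((g k).coeff 0))).coeff (n - -1) = 0
        rcases eq_or_ne n (-1) with rfl | hn'
        · rw [sub_self, hb, sub_self]
        · rw [ih _ (by omega), hΦx _ _ (by omega), sub_self]
    have hrec (k : ℕ) : g k = Φ (x ((g k).coeff 0)) + shift 1 (g (k + 1)) := by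
      simp only [g, Function.iterate_succ_apply', next]
      rw [shift_shift, add_neg_cancel, shift_zero_left]
      abel
    have hf' (N : ℕ) : f = ∑ k ∈ Finset.range N, shift k (Φ (x ((g k).coeff 0)))
        + shift N (g N) := by
      induction N with
      | zero => simp [shift_zero_left, g]
      | succ N ih =>
        rw [Finset.sum_range_succ, add_assoc]
        conv_lhs => rw [ih, hrec N]
        rw [shift_add, shift_shift, Nat.cast_succ]
    -- The `ν`-adic sum of the corrections `ν^k x_k`; only `k ≤ n` contribute in degree `n`.
    let y : LaurentSeries A := ofSuppBddBelow
      (fun n => ∑ k ∈ Finset.range (n + 1).toNat, (x ((g k).coeff 0)).coeff (n - k)) (by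
        refine ⟨0, fun n hn => not_lt.1 fun hn0 => hn ?_⟩
        simp only
        rw [show (n + 1).toNat = 0 by omega, Finset.range_zero, Finset.sum_empty])
    have hy (N : ℕ) : VanishesBelow N
        (y - ∑ k ∈ Finset.range N, shift k (x ((g k).coeff 0))) := by
      intro n hn
      rw [coeff_sub, coeff_sum]
      simp only [coeff_shift]
      change (∑ k ∈ Finset.range (n + 1).toNat, (x ((g k).coeff 0)).coeff (n - k)) - _ = 0
      rw [sub_eq_zero]
      refine Finset.sum_subset (fun k hk => ?_) fun k _ hk => ?_
      · simp at hk ⊢; omega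
      · simp at hk; exact hx _ _ (by omega)
    refine ⟨y, sub_eq_zero.1 ?_⟩
    obtain ⟨c, hc⟩ := hΦ.bound
    ext n
    -- `N` is so large that neither remainder, that of `f` nor the image under `Φ` of that of `y`,
    -- reaches degree `n`.
    obtain ⟨N, hN1, hN2⟩ : ∃ N : ℕ, n < N ∧ n < N + c :=
      ⟨(n + 1).toNat + (n - c + 1).toNat, by omega, by omega⟩
    have h1 := hc _ _ (hy N) n hN2
    rw [hΦ.map_sub, hΦ.map_sum, coeff_sub, sub_eq_zero] at h1
    have h2 := (hg N).shift N n (by omega)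
    rw [coeff_sub, h1, hf' N, coeff_add, h2, add_zero]
    simp [hΦ.shift]
  intro f
  obtain ⟨s, hs⟩ := exists_vanishesBelow f
  obtain ⟨y, hy⟩ := key (shift (-s) f) (by simpa using hs.shift (-s))
  exact ⟨shift s y, by rw [hΦ.shift, hy, shift_shift, add_neg_cancel, shift_zero_left]⟩

variable {σ : A →ₗ[ℂ] A}

lemma even_mul_comm (hσ : IsParity σ) {f : LaurentSeries A} (hf : f.map σ = f)
    (g : LaurentSeries A) : f * g = g * f := by
  obtain ⟨s, hs⟩ := exists_vanishesBelow f
  obtain ⟨t, ht⟩ := exists_vanishesBelow g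
  ext n
  rw [coeff_mul_Icc hs ht, coeff_mul_Icc' ht hs]
  refine Finset.sum_congr rfl fun k _ => ?_
  have h1 : σ (f.coeff k) = f.coeff k := by
    conv_rhs => rw [← hf]
    rw [map_coeff]
  rw [← evenPart_of_fixed h1, hσ.even_comm]

/-- Conjugation of operators by an invertible formal function. -/
def conjOp {u u' : LaurentSeries A} (h : u * u' = 1) (h' : u' * u = 1) :
    LaurentSeries (Module.End ℂ A) →+* LaurentSeries (Module.End ℂ A) where
  toFun T := mulOp u' * T * mulOp u
  map_one' := by rw [mul_one, ← map_mul, h', map_one]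
  map_mul' S T := by
    have : mulOp u * mulOp u' = 1 := by rw [← map_mul, h, map_one]
    calc mulOp u' * (S * T) * mulOp u
        = mulOp u' * S * 1 * T * mulOp u := by rw [mul_one]; simp only [mul_assoc]
      _ = _ := by rw [← this]; simp only [mul_assoc]
  map_zero' := by rw [mul_zero, zero_mul]
  map_add' S T := by rw [mul_add, add_mul]

lemma act_conjOp {u u' : LaurentSeries A} (h : u * u' = 1) (h' : u' * u = 1)
    (T : LaurentSeries (Module.End ℂ A)) (g : LaurentSeries A) :
    act (conjOp h h' T) g = u' * act T (u * g) := by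
  change act (mulOp u' * T * mulOp u) g = _
  rw [act_mul, act_mul, act_mulOp, act_mulOp]

lemma coeff_act_one (T : LaurentSeries (Module.End ℂ A)) (n : ℤ) :
    (act T 1).coeff n = T.coeff n 1 := by
  rw [← map_one (C : A →+* LaurentSeries A), coeff_act_C]

/-- The leading terms `T 1` of the natural operators `T` among the conjugates of the operators in a
given subring. -/
def symbols (hσ : IsParity σ) {u u' : LaurentSeries A} (h : u * u' = 1) (h' : u' * u = 1)
    (𝒯 : Subring (LaurentSeries (Module.End ℂ A))) : Subring A where
  carrier := {f | ∃ T ∈ 𝒯, conjOp h h' T ∈ naturalOps σ ∧ (conjOp h h' T).coeff 0 1 = f}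
  zero_mem' := ⟨0, zero_mem _, by rw [map_zero]; exact zero_mem _, by rw [map_zero]; rfl⟩
  one_mem' := ⟨1, one_mem _, by
    rw [map_one, ← map_one (mulOp (A := A)), ← map_one (C : A →+* LaurentSeries A)]
    exact mulOp_mem_naturalOps hσ (vanishesBelow_C _), by
    rw [map_one (conjOp h h')]; simp [coeff_one]⟩
  add_mem' := by
    rintro _ _ ⟨S, hS, hS', rfl⟩ ⟨T, hT, hT', rfl⟩
    exact ⟨S + T, add_mem hS hT, by rw [map_add]; exact add_mem hS' hT', by rw [map_add]; rfl⟩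
  neg_mem' := by
    rintro _ ⟨S, hS, hS', rfl⟩
    have e : conjOp h h' S + conjOp h h' (-S) = 0 := by
      rw [← map_add, (add_neg_cancel S : S + -S = 0), map_zero]
    have e' (k : ℤ) : (conjOp h h' (-S)).coeff k = -(conjOp h h' S).coeff k :=
      eq_neg_of_add_eq_zero_right (congrArg (fun T => coeff T k) e)
    exact ⟨-S, neg_mem hS, fun k => by rw [e']; exact neg_mem_ord (hS' k), by rw [e']; rfl⟩
  mul_mem' := by
    rintro _ _ ⟨S, hS, hS', rfl⟩ ⟨T, hT, hT', rfl⟩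
    refine ⟨S * T, mul_mem hS hT, by rw [map_mul]; exact mul_mem_naturalOps hσ hS' hT', ?_⟩
    rw [map_mul, coeff_mul_Icc (vanishesBelow_of_mem_naturalOps hS')
      (vanishesBelow_of_mem_naturalOps hT')]
    simp only [sub_self, Finset.Icc_self, Finset.sum_singleton]
    -- Degree-zero coefficients of natural operators are multiplications, so values at `1` multiply
    -- under composition.
    exact eq_mulLeft_of_mem_ord_zero hσ (hS' 0) _

lemma shift_C_mem_naturalOps {k : ℤ} {X : Module.End ℂ A} (hX : X ∈ ordSubmodule σ k) :
    shift k (C X) ∈ naturalOps σ := by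
  intro n
  rw [coeff_shift]
  by_cases hn : n = k
  · rw [hn, sub_self]; simpa [C_apply] using hX
  · rw [C_apply, coeff_single_of_ne (by omega)]; exact zero_mem _

lemma map_mul_of_ringHom {A B : Type*} [Ring A] [Ring B] (φ : A →+* B) (f g : LaurentSeries A) :
    (f * g).map φ = f.map φ * g.map φ := by
  obtain ⟨s, hs⟩ := exists_vanishesBelow f
  obtain ⟨t, ht⟩ := exists_vanishesBelow g
  ext n
  rw [map_coeff, coeff_mul_Icc hs ht, coeff_mul_Icc (hs.map φ) (ht.map φ), map_sum]
  exact Finset.sum_congr rfl fun k _ => map_mul φ _ _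

/-- The homomorphism of formal Laurent series induced by a homomorphism of coefficients. -/
def mapHom {A B : Type*} [Ring A] [Ring B] (φ : A →+* B) : LaurentSeries A →+* LaurentSeries B where
  toFun f := f.map φ
  map_one' := by
    rw [← map_one (C : A →+* LaurentSeries A), map_C_linear, map_one, map_one]
  map_mul' := map_mul_of_ringHom φ
  map_zero' := by ext; simp
  map_add' f g := by ext; simp

end Symbols

/-! ### Derivatives of exponentials, and generation through the Hessian -/

section GrassmannSymbols

open HahnSeries

variable {R I : Type*} [CommRing R] [Algebra ℂ R]

lemma map_grDeriv_mul (i : I) (f g : LaurentSeries (Grassmann R I)) :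
    (f * g).map (grDeriv i) = f.map (grDeriv i) * g + f.map (grParity R I) * g.map (grDeriv i) := by
  obtain ⟨s, hs⟩ := exists_vanishesBelow f
  obtain ⟨t, ht⟩ := exists_vanishesBelow g
  ext1; ext1 n
  rw [map_coeff, coeff_mul_Icc hs ht, coeff_add, coeff_mul_Icc (hs.map _) ht,
    coeff_mul_Icc (hs.map _) (ht.map _), map_sum, ← Finset.sum_add_distrib]
  exact Finset.sum_congr rfl fun k _ => grDeriv_mul _ _ _

lemma map_grParity_eq (f : LaurentSeries (Grassmann R I)) :
    f.map (grParity R I) = mapHom (CliffordAlgebra.involute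
      (Q := (0 : QuadraticForm R (I → R)))).toRingHom f := rfl

lemma map_grParity_mul (f g : LaurentSeries (Grassmann R I)) :
    (f * g).map (grParity R I) = f.map (grParity R I) * g.map (grParity R I) := by
  rw [map_grParity_eq, map_mul]; rfl

lemma map_grParity_exp [Module ℚ (LaurentSeries (Grassmann R I))]
    {Y : LaurentSeries (Grassmann R I)} (he : Y.map (grParity R I) = Y) (hn : IsNilpotent Y) :
    (IsNilpotent.exp Y).map (grParity R I) = IsNilpotent.exp Y := by
  rw [map_grParity_eq, IsNilpotent.map_exp hn, ← map_grParity_eq, he]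

/-- The derivative of the exponential of an even function. -/
lemma map_grDeriv_exp [Module ℚ (LaurentSeries (Grassmann R I))]
    {Y : LaurentSeries (Grassmann R I)} (he : Y.map (grParity R I) = Y) (hn : IsNilpotent Y)
    (i : I) :
    (IsNilpotent.exp Y).map (grDeriv i) = IsNilpotent.exp Y * Y.map (grDeriv i) := by
  let D : LaurentSeries (Grassmann R I) →+ LaurentSeries (Grassmann R I) :=
    { toFun := fun f => f.map (grDeriv i)
      map_zero' := by ext1; ext1; simp
      map_add' := fun f g => by ext1; ext1; simp }
  have hD (f : LaurentSeries (Grassmann R I)) : D f = f.map (grDeriv i) := rfl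
  have hpe (k : ℕ) : (Y ^ k).map (grParity R I) = Y ^ k := by
    rw [map_grParity_eq, map_pow, ← map_grParity_eq, he]
  have h1 : D 1 = 0 := by
    rw [hD, ← map_one (C : Grassmann R I →+* _), map_C_linear, ← map_one (algebraMap R _),
      grDeriv_algebraMap, map_zero]
  -- Evenness of `Y` removes the sign in the Leibniz rule and makes `Y` central, so the usual power
  -- rule holds.
  have hpow (k : ℕ) : D (Y ^ (k + 1)) = (k + 1) • (Y ^ k * D Y) := by
    induction k with
    | zero => simp
    | succ k ih =>
      rw [_root_.pow_succ, hD, map_grDeriv_mul, hpe, ← hD, ih, ← hD, smul_mul_assoc, mul_assoc,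
        ← even_mul_comm isParity_grParity he, ← mul_assoc, ← _root_.pow_succ, ← succ_nsmul]
  obtain ⟨n, hn⟩ := hn
  have hn' : Y ^ (n + 1) = 0 := by rw [_root_.pow_succ, hn, zero_mul]
  rw [← hD, ← hD]
  conv_lhs => rw [IsNilpotent.exp_eq_sum hn', map_sum, Finset.sum_range_succ']
  rw [IsNilpotent.exp_eq_sum hn, Finset.sum_mul]
  simp only [map_rat_smul, pow_zero, h1, smul_zero, add_zero, hpow]
  refine Finset.sum_congr rfl fun k _ => ?_
  rw [← Nat.cast_smul_eq_nsmul ℚ, smul_smul, smul_mul_assoc, Nat.factorial_succ]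
  congr 1
  push_cast
  field_simp

variable [LinearOrder I] [Fintype I]

lemma body_grParity (f : Grassmann R I) : body R I (grParity R I f) = body R I f := by
  have : (body R I).toLinearMap.restrictScalars ℂ ∘ₗ grParity R I
      = (body R I).toLinearMap.restrictScalars ℂ := by
    refine gr_ext fun r S => ?_
    simp only [LinearMap.comp_apply, LinearMap.restrictScalars_apply, AlgHom.toLinearMap_apply,
      grParity_smul, grParity_grBasis]
    by_cases h : S = ∅
    · simp [h]
    · rw [smul_comm, ← algebraMap_smul R, map_smul, map_smul, body_grBasis, if_neg h, smul_zero,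
        smul_zero]
  exact LinearMap.congr_fun this f

lemma body_eq_zero_of_odd {f : Grassmann R I} (h : grParity R I f = -f) : body R I f = 0 := by
  have h1 := body_grParity f
  rw [h, map_neg, neg_eq_iff_add_eq_zero, ← two_smul ℂ] at h1
  exact (smul_eq_zero_iff_right (two_ne_zero)).1 h1

lemma sub_body_mem_grFil (f : Grassmann R I) : f - algebraMap R _ (body R I f) ∈ grFil R I 1 := by
  have h := grFil_antitone one_le_two (sub_sub_mem_grFil f)
  have h2 : ∑ i, body R I (grDeriv i f) • gen R i ∈ grFil R I 1 :=
    sum_mem fun i _ => Submodule.smul_mem _ _ (gen_mem_grFil i)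
  have := add_mem h h2
  rwa [sub_add_cancel] at this

/-- A subring of the Grassmann algebra containing the functions up to higher degree, half of the
generators, and the derivatives of an even function `y` in their direction is the whole algebra, if
the mixed second derivatives of `y` are nondegenerate. -/
lemma subring_eq_top_of_hessian {κ : Type*} [Fintype κ] [DecidableEq κ] {ρ ρ' : κ → I}
    (hcases : ∀ i, (∃ α, i = ρ α) ∨ ∃ β, i = ρ' β)
    (hsum : ∀ f : I → Grassmann R I, ∑ i, f i = ∑ α, f (ρ α) + ∑ β, f (ρ' β))
    {y : Grassmann R I} (hy : grParity R I y = y)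
    (hdet : IsUnit (Matrix.of fun α β => body R I (grDeriv (ρ' β) (grDeriv (ρ α) y))).det)
    {S : Subring (Grassmann R I)} (h0 : ∀ a : R, ∃ s ∈ S, algebraMap R _ a - s ∈ grFil R I 1)
    (hgen : ∀ α, gen R (ρ α) ∈ S) (hder : ∀ α, grDeriv (ρ α) y ∈ S) : S = ⊤ := by
  -- The elements without body that lie in `S` modulo degree two. Unlike `S`, they are closed under
  -- multiplication by functions, so linear algebra over `R` applies.
  let V : Submodule R (Grassmann R I) :=
    { carrier := {x | x ∈ grFil R I 1 ∧ ∃ s ∈ S, x - s ∈ grFil R I 2}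
      zero_mem' := ⟨zero_mem _, 0, zero_mem _, by simp⟩
      add_mem' := by
        rintro x x' ⟨hx, s, hs, hxs⟩ ⟨hx', s', hs', hxs'⟩
        exact ⟨add_mem hx hx', s + s', add_mem hs hs', by
          rw [add_sub_add_comm]; exact add_mem hxs hxs'⟩
      smul_mem' := by
        rintro r x ⟨hx, s, hs, hxs⟩
        obtain ⟨t, ht, hrt⟩ := h0 r
        refine ⟨Submodule.smul_mem _ _ hx, t * s, mul_mem ht hs, ?_⟩
        rw [Algebra.smul_def, show algebraMap R (Grassmann R I) r * x - t * s
          = (algebraMap R _ r - t) * x + t * (x - s) by noncomm_ring]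
        refine add_mem (by simpa only [one_add_one_eq_two] using mul_mem_grFil hrt hx) ?_
        simpa using mul_mem_grFil (k := 0) (f := t) (by rw [grFil_zero]; trivial) hxs }
  have hV2 {x : Grassmann R I} (hx : x ∈ grFil R I 2) : x ∈ V :=
    ⟨grFil_antitone one_le_two hx, 0, zero_mem _, by rwa [sub_zero]⟩
  have hVS {x : Grassmann R I} (hx : x ∈ S) (hx' : x ∈ grFil R I 1) : x ∈ V :=
    ⟨hx', x, hx, by rw [sub_self]; exact zero_mem _⟩
  have hb (α : κ) : body R I (grDeriv (ρ α) y) = 0 := by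
    apply body_eq_zero_of_odd
    rw [grParity_grDeriv, hy]
  set N : Matrix κ κ R := Matrix.of fun α β => body R I (grDeriv (ρ' β) (grDeriv (ρ α) y)) with hN
  -- To first order `∂_{ρ α} y` is a combination of all generators. The part along `ρ` is already in
  -- `V`, which leaves the row `α` of the Hessian.
  have h1 (α : κ) : ∑ β, N α β • gen R (ρ' β) ∈ V := by
    have h2 : grDeriv (ρ α) y ∈ V := hVS (hder α) (by
      have := sub_body_mem_grFil (grDeriv (ρ α) y)
      rwa [hb, map_zero, sub_zero] at this)
    have h3 := hV2 (sub_sub_mem_grFil (grDeriv (ρ α) y))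
    rw [hb, map_zero, sub_zero, hsum] at h3
    have h4 : ∑ γ, body R I (grDeriv (ρ γ) (grDeriv (ρ α) y)) • gen R (ρ γ) ∈ V :=
      sum_mem fun γ _ => Submodule.smul_mem _ _ (hVS (hgen γ) (gen_mem_grFil _))
    have h5 := sub_mem (sub_mem h2 h3) h4
    convert h5 using 1
    simp only [hN, Matrix.of_apply]
    abel
  have h2 (β : κ) : gen R (ρ' β) ∈ V := by
    have : gen R (ρ' β) = ∑ α, N⁻¹ β α • ∑ γ, N α γ • gen R (ρ' γ) := by
      simp only [Finset.smul_sum, smul_smul]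
      rw [Finset.sum_comm]
      simp only [← Finset.sum_smul, ← Matrix.mul_apply, Matrix.nonsing_inv_mul N hdet]
      simp [Matrix.one_apply]
    rw [this]
    exact sum_mem fun α _ => Submodule.smul_mem _ _ (h1 α)
  refine subring_eq_top h0 fun i => ?_
  rcases hcases i with ⟨α, rfl⟩ | ⟨β, rfl⟩
  · exact ⟨_, hgen α, by rw [sub_self]; exact zero_mem _⟩
  · exact (h2 β).2

end GrassmannSymbols

/-! ### Invertibility of the coefficient matrix of the exponential of a potential -/

section Potential

open HahnSeries

variable {d : ℕ} {R : Type*} [CommRing R] [Algebra ℂ R]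

lemma coefs_empty (f : LaurentSeries (Grassmann R (Fin d ⊕ₗ Fin d))) :
    coefs f ∅ ∅ = mapHom (body R (Fin d ⊕ₗ Fin d)).toRingHom f := by
  ext n
  refine Eq.trans ?_ (body_eq_coord (f.coeff n)).symm
  rw [← monomialIndex_empty]; rfl

/-- The body of a nilpotent series is nilpotent in a reduced ring, hence zero; the exponential of
zero is `1`. -/
lemma coefs_exp_empty [IsReduced (LaurentSeries R)]
    [Module ℚ (LaurentSeries (Grassmann R (Fin d ⊕ₗ Fin d)))]
    {Y : LaurentSeries (Grassmann R (Fin d ⊕ₗ Fin d))} (hn : IsNilpotent Y) :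
    coefs (IsNilpotent.exp Y) ∅ ∅ = 1 := by
  let _ : Module ℚ (LaurentSeries R) := Module.compHom _ (algebraMap ℚ ℂ)
  rw [coefs_empty, IsNilpotent.map_exp hn, (hn.map _).eq_zero, IsNilpotent.exp_zero]

/-- The data of a nondegenerate nilpotent potential. -/
structure IsPotential (Y : LaurentSeries (Grassmann R (Fin d ⊕ₗ Fin d))) : Prop where
  pole : VanishesBelow (-1) Y
  even : Y.map (grParity R (Fin d ⊕ₗ Fin d)) = Y
  nilpotent : IsNilpotent Y
  hessian : IsUnit (Matrix.of fun α β : Fin d => body R (Fin d ⊕ₗ Fin d)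
    (grDeriv (thetaBarIdx β) (grDeriv (thetaIdx α) (Y.coeff (-1))))).det

variable [Module ℚ (LaurentSeries (Grassmann R (Fin d ⊕ₗ Fin d)))]
  {Y : LaurentSeries (Grassmann R (Fin d ⊕ₗ Fin d))}

open IsNilpotent

/-- The choice of `ρ`, `ρ'` treats left and right multiplications together. Multiplication by a
generator has that generator as its symbol, `ν ∂_{ρ α}` has the symbol `∂_{ρ α} Y_{-1}`, and the
operator of a function `a` has a symbol with body `a`. -/
lemma symbols_eq_top [IsReduced (LaurentSeries R)] (hY : IsPotential Y)
    {ρ ρ' : Fin d → Fin d ⊕ₗ Fin d}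
    (hcases : ∀ i, (∃ α, i = ρ α) ∨ ∃ β, i = ρ' β)
    (hsum : ∀ f : Fin d ⊕ₗ Fin d → Grassmann R (Fin d ⊕ₗ Fin d),
      ∑ i, f i = ∑ α, f (ρ α) + ∑ β, f (ρ' β))
    (hdet : IsUnit (Matrix.of fun α β : Fin d => body R (Fin d ⊕ₗ Fin d)
      (grDeriv (ρ' β) (grDeriv (ρ α) (Y.coeff (-1))))).det)
    {𝒯 : Subring (LaurentSeries (Module.End ℂ (Grassmann R (Fin d ⊕ₗ Fin d))))}
    (hgen : ∀ α, shift 0 (C (LinearMap.mulLeft ℂ (gen R (ρ α)) : Module.End ℂ _)) ∈ 𝒯)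
    (hder : ∀ α, shift 1 (C (grDeriv (ρ α))) ∈ 𝒯)
    (hfun : ∀ a : R, ∃ T : LaurentSeries (Module.End ℂ R), (∀ r : ℤ, T.coeff r ∈ ordId R r) ∧
      act T 1 = C a ∧ T.map (extendLin R (Fin d ⊕ₗ Fin d)) ∈ 𝒯) :
    symbols isParity_grParity (exp_mul_exp_neg_self hY.nilpotent)
      (exp_neg_mul_exp_self hY.nilpotent) 𝒯 = ⊤ := by
  set u := exp Y
  set u' := exp (-Y)
  have h : u * u' = 1 := exp_mul_exp_neg_self hY.nilpotent
  have h' : u' * u = 1 := exp_neg_mul_exp_self hY.nilpotent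
  have hnat {T : LaurentSeries (Module.End ℂ (Grassmann R (Fin d ⊕ₗ Fin d)))}
      (hT : T ∈ naturalOps (grParity R (Fin d ⊕ₗ Fin d))) :
      conjOp h h' T ∈ naturalOps (grParity R (Fin d ⊕ₗ Fin d)) :=
    exp_conj_mem_naturalOps hY.pole hY.even hY.nilpotent hT
  have hcoeff (T : LaurentSeries (Module.End ℂ (Grassmann R (Fin d ⊕ₗ Fin d)))) :
      (conjOp h h' T).coeff 0 1 = (u' * act T u).coeff 0 := by
    rw [← coeff_act_one, act_conjOp, mul_one]
  have hmem {T : LaurentSeries (Module.End ℂ (Grassmann R (Fin d ⊕ₗ Fin d)))} (hT : T ∈ 𝒯)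
      (hTn : T ∈ naturalOps (grParity R (Fin d ⊕ₗ Fin d))) :
      (u' * act T u).coeff 0 ∈ symbols isParity_grParity h h' 𝒯 :=
    ⟨T, hT, hnat hTn, hcoeff T⟩
  refine subring_eq_top_of_hessian hcases hsum (y := Y.coeff (-1)) ?_ hdet (fun a => ?_)
    (fun α => ?_) (fun α => ?_)
  · conv_rhs => rw [← hY.even]
    rw [map_coeff]
  · obtain ⟨T, hT, hTa, hT𝒯⟩ := hfun a
    refine ⟨_, hmem hT𝒯 fun k => ?_, ?_⟩
    · rw [map_coeff]; exact extend_mem_ord (hT k)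
    · have hu1 : mapHom (body R (Fin d ⊕ₗ Fin d)).toRingHom u = 1 := by
        rw [← coefs_empty]; exact coefs_exp_empty hY.nilpotent
      have hu2 : mapHom (body R (Fin d ⊕ₗ Fin d)).toRingHom u' = 1 := by
        have := congrArg (mapHom (body R (Fin d ⊕ₗ Fin d)).toRingHom) h
        rwa [map_mul, hu1, one_mul, map_one] at this
      -- On bodies both exponentials are `1`, and the operator acts there as `T` on `1`.
      have hb : mapHom (body R (Fin d ⊕ₗ Fin d)).toRingHom
          (u' * act (T.map (extendLin R (Fin d ⊕ₗ Fin d))) u) = C a := by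
        rw [map_mul, hu2, one_mul, ← coefs_empty, coefs_act_extend, coefs_empty, hu1, hTa]
      have h3 : (C a : LaurentSeries R).coeff 0 = a := by simp [C_apply]
      have h4 : body R (Fin d ⊕ₗ Fin d)
          ((u' * act (T.map (extendLin R (Fin d ⊕ₗ Fin d))) u).coeff 0) = a :=
        (congrArg (fun f => coeff f 0) hb).trans h3
      have h5 := sub_body_mem_grFil ((u' * act (T.map (extendLin R (Fin d ⊕ₗ Fin d))) u).coeff 0)
      rw [h4] at h5
      rw [← neg_sub]
      exact neg_mem h5
  · have hC : act (shift 0 (C (LinearMap.mulLeft ℂ (gen R (ρ α)) : Module.End ℂ _))) u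
        = C (gen R (ρ α)) * u := by
      rw [act_shift_C, shift_zero_left]
      ext1; ext1 n
      rw [coeff_C_mul]; rfl
    have h1 := hmem (hgen α) (shift_C_mem_naturalOps (mulLeft_mem_ord isParity_grParity _))
    have h2 : C (gen R (ρ α)) * u = u * C (gen R (ρ α)) :=
      (even_mul_comm isParity_grParity (map_grParity_exp hY.even hY.nilpotent) _).symm
    rw [hC, h2, ← mul_assoc, h', one_mul] at h1
    simpa [C_apply] using h1
  · have h1 := hmem (hder α) (shift_C_mem_naturalOps (grDeriv_mem_ord _))
    have hd : u.map (grDeriv (ρ α)) = u * Y.map (grDeriv (ρ α)) :=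
      map_grDeriv_exp hY.even hY.nilpotent _
    rwa [act_shift_C, hd, mul_shift, ← mul_assoc, h', one_mul,
      coeff_shift, map_coeff] at h1

variable {star : LaurentSeries R → LaurentSeries R → LaurentSeries R}

/-- A star product on functions all of whose multiplication operators are natural. -/
structure IsNaturalStar (star : LaurentSeries R → LaurentSeries R → LaurentSeries R) : Prop
    extends IsStarProduct LinearMap.id star where
  left (a : R) (r : ℤ) : (leftOp toIsStarProduct.isBounded₂ a).coeff r ∈ ordId R r
  right (a : R) (r : ℤ) : (rightOp toIsStarProduct.isBounded₂ a).coeff r ∈ ordId R r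

omit [Algebra ℂ R] [Module ℚ (LaurentSeries (Grassmann R (Fin d ⊕ₗ Fin d)))] in
lemma sum_idx (f : Fin d ⊕ₗ Fin d → Grassmann R (Fin d ⊕ₗ Fin d)) :
    ∑ i, f i = ∑ α, f (thetaIdx α) + ∑ β, f (thetaBarIdx β) := by
  rw [← Fintype.sum_sum_type (fun i => f (toLex i))]
  exact (Fintype.sum_equiv toLex _ _ fun _ => rfl).symm

lemma leftSymbols_eq_top [IsReduced (LaurentSeries R)] (hs : IsNaturalStar star)
    (hY : IsPotential Y) :
    symbols isParity_grParity (exp_mul_exp_neg_self hY.nilpotent)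
      (exp_neg_mul_exp_self hY.nilpotent) (leftOps d hs.toIsStarProduct) = ⊤ := by
  refine symbols_eq_top hY (ρ := thetaIdx) (ρ' := thetaBarIdx)
    (idx_cases (fun α => Or.inl ⟨α, rfl⟩) (fun β => Or.inr ⟨β, rfl⟩)) sum_idx hY.hessian
    (fun α => ?_) (fun α => ?_) (fun a => ⟨_, hs.left a, ?_, extend_leftOp_mem_leftOps _ a⟩)
  · obtain ⟨ε, hε⟩ := gen_theta_mul_mono (R := R) α
    exact shift_C_mem_leftOps _ _ (fun r f => mul_smul_comm _ _ _) hε le_rfl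
  · obtain ⟨ε, hε⟩ := grDeriv_theta_mono (R := R) α
    exact shift_C_mem_leftOps _ _ (grDeriv_smul _) hε zero_le_one
  · rw [leftOp, IsBounded.act_toOp, hs.mul_one]

lemma rightSymbols_eq_top [IsReduced (LaurentSeries R)] (hs : IsNaturalStar star)
    (hY : IsPotential Y) :
    symbols isParity_grParity (exp_mul_exp_neg_self hY.nilpotent)
      (exp_neg_mul_exp_self hY.nilpotent) (rightOps d hs.toIsStarProduct) = ⊤ := by
  refine symbols_eq_top hY (ρ := thetaBarIdx) (ρ' := thetaIdx)
    (idx_cases (fun α => Or.inr ⟨α, rfl⟩) (fun β => Or.inl ⟨β, rfl⟩))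
    (fun f => (sum_idx f).trans (add_comm _ _)) ?_
    (fun α => ?_) (fun α => ?_) (fun a => ⟨_, hs.right a, ?_, extend_rightOp_mem_rightOps _ a⟩)
  · have := hY.hessian
    set N := Matrix.of fun α β : Fin d => body R (Fin d ⊕ₗ Fin d)
      (grDeriv (thetaBarIdx β) (grDeriv (thetaIdx α) (Y.coeff (-1)))) with hN
    -- Odd derivatives anticommute, so exchanging the roles of `θ` and `θbar` replaces the Hessian
    -- by minus its transpose.
    have e : (Matrix.of fun α β : Fin d => body R (Fin d ⊕ₗ Fin d)
        (grDeriv (thetaIdx β) (grDeriv (thetaBarIdx α) (Y.coeff (-1))))) = -N.transpose := by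
      ext α β
      simp only [hN, Matrix.of_apply, Matrix.neg_apply, Matrix.transpose_apply]
      rw [grDeriv_comm, map_neg]
    rw [e, Matrix.det_neg, Matrix.det_transpose]
    exact (isUnit_one.neg.pow _).mul this
  · obtain ⟨ε, hε, hε'⟩ := gen_thetaBar_mul_mono (R := R) α
    exact shift_C_mem_rightOps _ _ (fun r f => mul_smul_comm _ _ _) hε hε' le_rfl
  · obtain ⟨ε, hε, hε'⟩ := grDeriv_thetaBar_mono (R := R) α
    exact shift_C_mem_rightOps _ _ (grDeriv_smul _) hε hε' zero_le_one
  · rw [rightOp, IsBounded.act_toOp, hs.one_mul]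

omit [Module ℚ (LaurentSeries (Grassmann R (Fin d ⊕ₗ Fin d)))] in
lemma vanishesBelow_ofCoefs {s : ℤ}
    {A : Matrix (Finset (Fin d)) (Finset (Fin d)) (LaurentSeries R)}
    (hA : ∀ K L, VanishesBelow s (A K L)) : VanishesBelow s (ofCoefs A) := fun n hn => by
  rw [coeff_ofCoefs]
  exact Finset.sum_eq_zero fun K _ => Finset.sum_eq_zero fun L _ => by rw [hA K L n hn, zero_smul]

omit [Module ℚ (LaurentSeries (Grassmann R (Fin d ⊕ₗ Fin d)))] in
lemma ofCoefs_isBounded {V : Type*} [Ring V] [Algebra ℂ V]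
    {A : LaurentSeries V → Matrix (Finset (Fin d)) (Finset (Fin d)) (LaurentSeries R)}
    (hA : ∀ K L, IsBounded (fun f => A f K L)) : IsBounded (fun f => ofCoefs (A f)) :=
  IsBounded.sum fun K => IsBounded.sum fun L => (IsBounded.map _).comp (hA K L)

omit [Module ℚ (LaurentSeries (Grassmann R (Fin d ⊕ₗ Fin d)))] in
lemma matMul_isBounded_left (h : IsBounded₂ star) {V : Type*} [Ring V] [Algebra ℂ V]
    {A : LaurentSeries V → Matrix (Finset (Fin d)) (Finset (Fin d)) (LaurentSeries R)}
    (B : Matrix (Finset (Fin d)) (Finset (Fin d)) (LaurentSeries R))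
    (hA : ∀ K L, IsBounded (fun f => A f K L)) (K L : Finset (Fin d)) :
    IsBounded (fun f => matMul star (A f) B K L) :=
  IsBounded.sum fun I => (h.left _).comp (hA K I)

omit [Module ℚ (LaurentSeries (Grassmann R (Fin d ⊕ₗ Fin d)))] in
lemma matMul_isBounded_right (h : IsBounded₂ star) {V : Type*} [Ring V] [Algebra ℂ V]
    (A : Matrix (Finset (Fin d)) (Finset (Fin d)) (LaurentSeries R))
    {B : LaurentSeries V → Matrix (Finset (Fin d)) (Finset (Fin d)) (LaurentSeries R)}
    (hB : ∀ K L, IsBounded (fun f => B f K L)) (K L : Finset (Fin d)) :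
    IsBounded (fun f => matMul star A (B f) K L) :=
  IsBounded.sum fun I => (h.right _).comp (hB I L)

omit [Module ℚ (LaurentSeries (Grassmann R (Fin d ⊕ₗ Fin d)))] in
lemma ofCoefs_injective : Function.Injective (ofCoefs (d := d) (R := R)) :=
  Function.LeftInverse.injective coefs_ofCoefs

/-- The coefficient matrix of the exponential of a potential is invertible. -/
lemma exists_coefs_inverse [IsReduced (LaurentSeries R)] (hs : IsNaturalStar star)
    (hY : IsPotential Y) :
    ∃ v : Matrix (Finset (Fin d)) (Finset (Fin d)) (LaurentSeries R),
      matMul star (coefs (exp Y)) v = 1 ∧ matMul star v (coefs (exp Y)) = 1 := by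
  have hsp := hs.toIsStarProduct
  have hb := hsp.isBounded₂
  have h : exp Y * exp (-Y) = 1 := exp_mul_exp_neg_self hY.nilpotent
  have h' : exp (-Y) * exp Y = 1 := exp_neg_mul_exp_self hY.nilpotent
  have he : matParity (coefs (exp Y)) = coefs (exp Y) := by
    rw [← coefs_map_parity, map_grParity_exp hY.even hY.nilpotent]
  have hcancel {x y : LaurentSeries (Grassmann R (Fin d ⊕ₗ Fin d))}
      (hxy : exp (-Y) * x = exp (-Y) * y) : x = y := by
    simpa [← mul_assoc, h] using congrArg (exp Y * ·) hxy
  have hlead {T : LaurentSeries (Module.End ℂ (Grassmann R (Fin d ⊕ₗ Fin d)))}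
      (hT : conjOp h h' T ∈ naturalOps (grParity R (Fin d ⊕ₗ Fin d))) :
      VanishesBelow 0 (exp (-Y) * act T (exp Y)) := fun n hn => by
    rw [← mul_one (exp Y), ← act_conjOp h h', coeff_act_one,
      vanishesBelow_of_mem_naturalOps hT n hn, LinearMap.zero_apply]
  -- Surjectivity needs only leading terms, and these are the symbols of the conjugated left
  -- operators.
  have hleft : Function.Surjective fun f : LaurentSeries (Grassmann R (Fin d ⊕ₗ Fin d)) =>
      exp (-Y) * ofCoefs (matMul star (coefs f) (coefs (exp Y))) := by
    refine surjective_of_leading ((IsBounded.mul_left _).comp (ofCoefs_isBounded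
      (matMul_isBounded_left hb _ coefs_isBounded))) fun f => ?_
    obtain ⟨T, ⟨F, hF, hT⟩, hTn, hTf⟩ := (leftSymbols_eq_top hs hY).ge (Subring.mem_top f)
    refine ⟨ofCoefs F, vanishesBelow_ofCoefs hF, ?_, ?_⟩ <;>
      simp only [coefs_ofCoefs] <;> rw [← hT, ofCoefs_coefs]
    · exact hlead hTn
    · rw [← hTf, ← coeff_act_one, act_conjOp, mul_one]
  have hright : Function.Surjective fun f : LaurentSeries (Grassmann R (Fin d ⊕ₗ Fin d)) =>
      exp (-Y) * ofCoefs (matMul star (coefs (exp Y)) (coefs f)) := by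
    refine surjective_of_leading ((IsBounded.mul_left _).comp (ofCoefs_isBounded
      (matMul_isBounded_right hb _ coefs_isBounded))) fun f => ?_
    obtain ⟨T, ⟨G₀, G₁, ⟨h0, h1, -, -⟩, hT⟩, hTn, hTf⟩ :=
      (rightSymbols_eq_top hs hY).ge (Subring.mem_top f)
    have hT' := hT (exp Y)
    -- The matrix of `exp Y` is even, so on it graded right multiplication is plain multiplication
    -- by `G₀ + G₁`.
    rw [he, ← matMul_add hb] at hT'
    refine ⟨ofCoefs (G₀ + G₁), vanishesBelow_ofCoefs fun K L => (h0 K L).add (h1 K L), ?_, ?_⟩ <;>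
      simp only [coefs_ofCoefs] <;> rw [← hT', ofCoefs_coefs]
    · exact hlead hTn
    · rw [← hTf, ← coeff_act_one, act_conjOp, mul_one]
  obtain ⟨f, hf⟩ := hleft (exp (-Y) * ofCoefs 1)
  obtain ⟨g, hg⟩ := hright (exp (-Y) * ofCoefs 1)
  have hf' := ofCoefs_injective (hcancel hf)
  have hg' := ofCoefs_injective (hcancel hg)
  refine ⟨coefs g, hg', ?_⟩
  -- A left and a right inverse coincide.
  have : coefs g = coefs f := by
    rw [← one_matMul hsp (A := coefs g), ← hf', matMul_assoc hsp, hg', matMul_one hsp]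
  rw [this, hf']

end Potential

/-! ### The product associated with the exponential of a potential -/

section Product

open HahnSeries IsNilpotent

variable {d : ℕ} {R : Type*} [CommRing R] [Algebra ℂ R]

/-- The product of matrices transferred to formal functions along
`f ↦ (coefs (u f)) ⋆ v`, where `u'` and `v` are the inverses of `u` and of its coefficient
matrix. -/
def transferMul (star : LaurentSeries R → LaurentSeries R → LaurentSeries R)
    (u u' : LaurentSeries (Grassmann R (Fin d ⊕ₗ Fin d)))
    (v : Matrix (Finset (Fin d)) (Finset (Fin d)) (LaurentSeries R))
    (f g : LaurentSeries (Grassmann R (Fin d ⊕ₗ Fin d))) :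
    LaurentSeries (Grassmann R (Fin d ⊕ₗ Fin d)) :=
  u' * ofCoefs (matMul star (matMul star (coefs (u * f)) v) (coefs (u * g)))

variable {star : LaurentSeries R → LaurentSeries R → LaurentSeries R}

lemma matMul_vanishesBelow_add (hs : IsStarProduct LinearMap.id star)
    {A B : Matrix (Finset (Fin d)) (Finset (Fin d)) (LaurentSeries R)} {s t : ℤ}
    (hA : ∀ K L, VanishesBelow s (A K L)) (hB : ∀ K L, VanishesBelow t (B K L))
    (K L : Finset (Fin d)) : VanishesBelow (s + t) (matMul star A B K L) :=
  VanishesBelow.sum fun I _ => hs.vanishesBelow (hA K I) (hB I L)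

lemma transferMul_isBounded₂ (hs : IsStarProduct LinearMap.id star)
    (u u' : LaurentSeries (Grassmann R (Fin d ⊕ₗ Fin d)))
    (v : Matrix (Finset (Fin d)) (Finset (Fin d)) (LaurentSeries R)) :
    IsBounded₂ (transferMul star u u' v) where
  left g := (IsBounded.mul_left _).comp (ofCoefs_isBounded (matMul_isBounded_left hs.isBounded₂ _
    (matMul_isBounded_left hs.isBounded₂ _ fun K L =>
      (coefs_isBounded K L).comp (IsBounded.mul_left _))))
  right f := (IsBounded.mul_left _).comp (ofCoefs_isBounded (matMul_isBounded_right hs.isBounded₂ _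
    fun K L => (coefs_isBounded K L).comp (IsBounded.mul_left _)))
  bound := by
    obtain ⟨a, ha⟩ := exists_vanishesBelow u
    obtain ⟨b, hb⟩ := exists_vanishesBelow u'
    obtain ⟨c, hc⟩ := exists_vanishesBelow (ofCoefs v)
    have hv (K L : Finset (Fin d)) : VanishesBelow c (v K L) := by
      rw [← coefs_ofCoefs v]; exact hc.map _
    refine ⟨b + (a + c + a), fun s t f g hf hg => ?_⟩
    have := hb.mul (vanishesBelow_ofCoefs (matMul_vanishesBelow_add hs
      (matMul_vanishesBelow_add hs (fun K L => (ha.mul hf).map (monoCoord K L)) hv)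
      (fun K L => (ha.mul hg).map (monoCoord K L))))
    exact this.mono (by omega)

/-- `f ↦ coefs (u * f) ⋆ v` inverts `e` on both sides, so it is `Function.invFun e`; the last `v`
then cancels against `coefs u`. -/
lemma transferMul_eq (hs : IsStarProduct LinearMap.id star)
    {u u' : LaurentSeries (Grassmann R (Fin d ⊕ₗ Fin d))} (h : u * u' = 1) (h' : u' * u = 1)
    {v : Matrix (Finset (Fin d)) (Finset (Fin d)) (LaurentSeries R)}
    (hv : matMul star (coefs u) v = 1) (hv' : matMul star v (coefs u) = 1)
    {e : Matrix (Finset (Fin d)) (Finset (Fin d)) (LaurentSeries R) →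
      LaurentSeries (Grassmann R (Fin d ⊕ₗ Fin d))}
    (he : ∀ A, e A = u' * ofCoefs (matMul star A (coefs u)))
    (f g : LaurentSeries (Grassmann R (Fin d ⊕ₗ Fin d))) :
    e (matMul star (Function.invFun e f) (Function.invFun e g)) = transferMul star u u' v f g := by
  have hright (f : LaurentSeries (Grassmann R (Fin d ⊕ₗ Fin d))) :
      e (matMul star (coefs (u * f)) v) = f := by
    rw [he, matMul_assoc hs, hv', matMul_one hs, ofCoefs_coefs, ← mul_assoc, h', one_mul]
  have hinj : Function.Injective e := by
    intro A B hAB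
    rw [he, he] at hAB
    have h1 := congrArg (fun f => matMul star (coefs (u * f)) v) hAB
    simpa only [← mul_assoc, h, one_mul, coefs_ofCoefs, matMul_assoc hs, hv, matMul_one hs]
      using h1
  have hinv (f : LaurentSeries (Grassmann R (Fin d ⊕ₗ Fin d))) :
      Function.invFun e f = matMul star (coefs (u * f)) v :=
    hinj ((Function.invFun_eq ⟨_, hright f⟩).trans (hright f).symm)
  rw [hinv, hinv, he, transferMul, ← matMul_assoc hs, matMul_assoc hs (B := v) (D := coefs u), hv',
    matMul_one hs]

lemma ofCoefs_add (A B : Matrix (Finset (Fin d)) (Finset (Fin d)) (LaurentSeries R)) :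
    ofCoefs (A + B) = ofCoefs A + ofCoefs B :=
  coefs_injective (by rw [coefs_add, coefs_ofCoefs, coefs_ofCoefs, coefs_ofCoefs])

lemma ofCoefs_matParity (A : Matrix (Finset (Fin d)) (Finset (Fin d)) (LaurentSeries R)) :
    ofCoefs (matParity A) = (ofCoefs A).map (grParity R (Fin d ⊕ₗ Fin d)) :=
  coefs_injective (by rw [coefs_map_parity, coefs_ofCoefs, coefs_ofCoefs])

lemma ofCoefs_neg (A : Matrix (Finset (Fin d)) (Finset (Fin d)) (LaurentSeries R)) :
    ofCoefs (-A) = -ofCoefs A :=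
  coefs_injective (by rw [coefs_neg, coefs_ofCoefs, coefs_ofCoefs])

/-- The product associated with the exponential of a potential is a natural star product. -/
theorem transferMul_isNaturalStarProduct
    [Module ℚ (LaurentSeries (Grassmann R (Fin d ⊕ₗ Fin d)))] [IsReduced (LaurentSeries R)]
    {Y : LaurentSeries (Grassmann R (Fin d ⊕ₗ Fin d))} (hs : IsNaturalStar star)
    (hY : IsPotential Y) {v : Matrix (Finset (Fin d)) (Finset (Fin d)) (LaurentSeries R)}
    (hv : matMul star (coefs (exp Y)) v = 1) (hv' : matMul star v (coefs (exp Y)) = 1) :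
    IsNaturalStarProduct (grParity R (Fin d ⊕ₗ Fin d))
      (transferMul star (exp Y) (exp (-Y)) v) := by
  have hsp := hs.toIsStarProduct
  have hσ : IsParity (grParity R (Fin d ⊕ₗ Fin d)) := isParity_grParity
  have h : exp Y * exp (-Y) = 1 := exp_mul_exp_neg_self hY.nilpotent
  have h' : exp (-Y) * exp Y = 1 := exp_neg_mul_exp_self hY.nilpotent
  have hl : symbols hσ h h' (leftOps d hsp) = ⊤ := leftSymbols_eq_top hs hY
  have hr : symbols hσ h h' (rightOps d hsp) = ⊤ := rightSymbols_eq_top hs hY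
  have hb := hsp.isBounded₂
  have he : (exp Y).map (grParity R (Fin d ⊕ₗ Fin d)) = exp Y :=
    map_grParity_exp hY.even hY.nilpotent
  have he' : (exp (-Y)).map (grParity R (Fin d ⊕ₗ Fin d)) = exp (-Y) :=
    map_grParity_exp (by rw [map_grParity_eq, map_neg, ← map_grParity_eq, hY.even])
      hY.nilpotent.neg
  revert h h' hl hr
  generalize exp Y = u at *
  generalize exp (-Y) = u' at *
  intro h h' hl hr
  have hM : matParity (coefs u) = coefs u := by rw [← coefs_map_parity, he]
  -- The inverse of an even matrix is even, by uniqueness of inverses.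
  have hvP : matParity v = v := by
    have h1 : matMul star (matParity v) (coefs u) = 1 := by
      rw [← hM, ← matParity_matMul hb, hv']; exact matParity_diagonal 1
    rw [← matMul_one hsp (A := matParity v), ← hv, ← matMul_assoc hsp, h1, one_matMul hsp]
  have hPB := transferMul_isBounded₂ hsp u u' v
  have hP (f g : LaurentSeries (Grassmann R (Fin d ⊕ₗ Fin d))) :
      transferMul star u u' v f g
        = u' * ofCoefs (matMul star (matMul star (coefs (u * f)) v) (coefs (u * g))) := rfl
  have hu (A : Matrix (Finset (Fin d)) (Finset (Fin d)) (LaurentSeries R)) :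
      coefs (u * (u' * ofCoefs A)) = A := by
    rw [← mul_assoc, h, one_mul, coefs_ofCoefs]
  have hu' (f : LaurentSeries (Grassmann R (Fin d ⊕ₗ Fin d))) :
      u' * ofCoefs (coefs (u * f)) = f := by
    rw [ofCoefs_coefs, ← mul_assoc, h', one_mul]
  refine isNaturalStarProduct_of_coeffMap hσ hPB (gradedRight_isBounded₂ hPB) ?_ ?_ ?_ ?_ ?_ ?_
  · intro f g
    have hc (f : LaurentSeries (Grassmann R (Fin d ⊕ₗ Fin d))) :
        coefs (u * f.map (grParity R (Fin d ⊕ₗ Fin d))) = matParity (coefs (u * f)) := by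
      rw [← coefs_map_parity, map_grParity_mul, he]
    rw [hP, hP, hc, hc, map_grParity_mul, he', ← ofCoefs_matParity, matParity_matMul hb,
      matParity_matMul hb, hvP]
  · intro f g k
    rw [hP (transferMul star u u' v f g), hP f (transferMul star u u' v g k), hP f g,
      hP g k, hu, hu]
    simp only [matMul_assoc hsp]
  · intro f
    rw [hP, mul_one, hv, one_matMul hsp, hu']
  · intro f
    rw [hP, mul_one, matMul_assoc hsp, hv', matMul_one hsp, hu']
  · refine coeffMap_mem_ord hPB fun f => ?_
    obtain ⟨T, ⟨F, -, hT⟩, hTn, hTf⟩ := hl.ge (Subring.mem_top f)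
    -- The conjugate of `T` is left multiplication by its value at `1`, whose matrix is `F ⋆ coefs
    -- u`: the factor `coefs u` cancels `v`.
    refine ⟨_, hTn, fun g => ?_, (coeff_act_one _ _).trans hTf⟩
    have h1 (g : LaurentSeries (Grassmann R (Fin d ⊕ₗ Fin d))) :
        act (conjOp h h' T) g = u' * ofCoefs (matMul star F (coefs (u * g))) := by
      rw [act_conjOp, ← hT, ofCoefs_coefs]
    rw [h1 1, mul_one, hP, hu, matMul_assoc hsp (A := F), hv, matMul_one hsp, h1]
  · refine coeffMap_mem_ord (gradedRight_isBounded₂ hPB) fun f => ?_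
    obtain ⟨T, ⟨G₀, G₁, ⟨-, -, h0, h1⟩, hT⟩, hTn, hTf⟩ := hr.ge (Subring.mem_top f)
    refine ⟨_, hTn, fun g => ?_, (coeff_act_one _ _).trans hTf⟩
    have h2 (g : LaurentSeries (Grassmann R (Fin d ⊕ₗ Fin d))) :
        act (conjOp h h' T) g = u' * ofCoefs (matMul star (coefs (u * g)) G₀)
          + u' * ofCoefs (matMul star (matParity (coefs (u * g))) G₁) := by
      rw [act_conjOp, ← mul_add, ← ofCoefs_add, ← hT, ofCoefs_coefs]
    -- As `u` is even, `G₀` and `G₁` produce the even and odd parts of the value at `1`; the two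
    -- terms of `gradedRight` are then the two terms of `T`.
    set f₀ := u' * ofCoefs (matMul star (coefs u) G₀) with hf₀
    set f₁ := u' * ofCoefs (matMul star (coefs u) G₁) with hf₁
    have h3 : act (conjOp h h' T) 1 = f₀ + f₁ := by rw [h2, mul_one, hM]
    have h4 : f₀.map (grParity R (Fin d ⊕ₗ Fin d)) = f₀ := by
      rw [hf₀, map_grParity_mul, he', ← ofCoefs_matParity, matParity_matMul hb, hM, h0]
    have h5 : f₁.map (grParity R (Fin d ⊕ₗ Fin d)) = -f₁ := by
      rw [hf₁, map_grParity_mul, he', ← ofCoefs_matParity, matParity_matMul hb, hM, h1,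
        matMul_neg hb, ofCoefs_neg, mul_neg]
    have h4' (n : ℤ) : grParity R (Fin d ⊕ₗ Fin d) (f₀.coeff n) = f₀.coeff n :=
      congrArg (fun f => coeff f n) h4
    have h5' (n : ℤ) : grParity R (Fin d ⊕ₗ Fin d) (f₁.coeff n) = -f₁.coeff n :=
      congrArg (fun f => coeff f n) h5
    have h6 : (f₀ + f₁).map (evenPart (grParity R (Fin d ⊕ₗ Fin d))) = f₀ := by
      ext1; ext1 n
      rw [map_coeff, coeff_add, map_add, evenPart_of_fixed (h4' n), evenPart_of_neg (h5' n),
        add_zero]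
    have h7 : (f₀ + f₁).map (oddPart (grParity R (Fin d ⊕ₗ Fin d))) = f₁ := by
      ext1; ext1 n
      rw [map_coeff, coeff_add, map_add, oddPart_of_fixed (h4' n), oddPart_of_neg (h5' n),
        zero_add]
    have h8 : coefs (u * g.map (grParity R (Fin d ⊕ₗ Fin d))) = matParity (coefs (u * g)) := by
      rw [← coefs_map_parity, map_grParity_mul, he]
    rw [h3, gradedRight, h6, h7, hP, hP, h8, hf₀, hf₁, hu, hu, h2, matMul_assoc hsp,
      matMul_assoc hsp, ← matMul_assoc hsp (A := v), ← matMul_assoc hsp (A := v), hv',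
      one_matMul hsp, one_matMul hsp]

end Product

/-! ### Functions on `U × ℂ^{0|d}` -/

section Smooth

open HahnSeries

/-- The leading coefficient of a series squares to a coefficient of its square, so it is nilpotent
if the square is zero. -/
lemma isReduced_laurentSeries {R : Type*} [CommRing R] [IsReduced R] :
    IsReduced (LaurentSeries R) := by
  rw [isReduced_iff_pow_one_lt 2 one_lt_two]
  intro f hf
  have h := coeff_mul_order_add_order f f
  rw [← sq, hf, coeff_zero] at h
  exact leadingCoeff_eq_zero.1 (IsReduced.eq_zero _ ⟨2, by rw [sq, ← h]⟩)

variable {m d : ℕ} {U : TopologicalSpace.Opens (Fin m → ℂ)}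

lemma isReduced_smooth : IsReduced (Smooth U) :=
  isReduced_of_injective (smoothFunctions U).val Subtype.val_injective

lemma isUnit_smooth {f : Smooth U} (hf : ∀ x, f.1 x ≠ 0) : IsUnit f := by
  obtain ⟨F, hF, hFf⟩ := f.2
  have hne (x : Fin m → ℂ) (hx : x ∈ U) : F x ≠ 0 := by
    rw [hFf ⟨x, hx⟩]; exact hf _
  let g : Smooth U := ⟨fun x => (f.1 x)⁻¹, fun x => (F x)⁻¹, hF.inv hne,
    fun x => congrArg _ (hFf x)⟩
  refine IsUnit.of_mul_eq_one g ?_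
  ext x
  exact mul_inv_cancel₀ (hf x)

/-- Only the part of degree one contributes to the bodies, and there left and right derivatives
agree. The Hessian of the potential may thus be computed with left derivatives throughout. -/
lemma body_contractRight {R I : Type*} [CommRing R] [Algebra ℂ R] [LinearOrder I] [Fintype I]
    (i : I) (f : Grassmann R I) :
    body R I (CliffordAlgebra.contractRight (Q := (0 : QuadraticForm R (I → R))) f
      (LinearMap.proj i)) = body R I (grDeriv i f) := by
  induction f using CliffordAlgebra.right_induction with
  | algebraMap r =>
    rw [CliffordAlgebra.contractRight_algebraMap]
    change body R I 0 = body R I (grDeriv i (algebraMap R (Grassmann R I) r))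
    rw [grDeriv_algebraMap]
  | add x y hx hy => rw [map_add, LinearMap.add_apply, map_add, map_add, map_add, hx, hy]
  | mul_ι v x _ =>
    rw [CliffordAlgebra.contractRight_mul_ι]
    change body R I (v i • x - _ * ExteriorAlgebra.ι R v)
      = body R I (grDeriv i (x * ExteriorAlgebra.ι R v))
    rw [mul_ι_eq, mul_ι_eq x, grDeriv_ι_mul, map_sub, map_sub, map_mul, map_mul,
      body_ι, zero_mul, zero_mul, map_smul, map_smul, body_grParity]

/-- The value at a point. -/
def evalAt (x : U) : Smooth U →+* ℂ :=
  (Pi.evalRingHom (fun _ : U => ℂ) x).comp (smoothFunctions U).val.toRingHom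

lemma IsNondegenerateNilpotentPotential.isPotential {Y : LaurentSeries (SuperFun U d)}
    (hY : IsNondegenerateNilpotentPotential Y) : IsPotential (R := Smooth U) Y where
  pole := hY.pole
  even := hY.even
  nilpotent := hY.nilpotent
  hessian := by
    refine isUnit_smooth fun x => ?_
    change evalAt x _ ≠ 0
    rw [RingHom.map_det]
    convert hY.nondegenerate x using 2
    ext α β
    exact congrArg (evalAt x) (body_contractRight (R := Smooth U) (thetaBarIdx β)
      (leftDerivTheta α (Y.coeff (-1)))).symm

lemma IsSeparatedStarProduct.isNaturalStar
    {star : LaurentSeries (Smooth U) → LaurentSeries (Smooth U) → LaurentSeries (Smooth U)}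
    (h : IsSeparatedStarProduct star) : IsNaturalStar star where
  toIsStarProduct := h.toIsStarProduct
  left := h.isCoordSeparated.left_natural
  right := h.isCoordSeparated.right_natural

lemma assocProduct_eq
    {star : LaurentSeries (Smooth U) → LaurentSeries (Smooth U) → LaurentSeries (Smooth U)}
    (hs : IsStarProduct LinearMap.id star)
    {u u' : LaurentSeries (SuperFun U d)} (h : u * u' = 1) (h' : u' * u = 1)
    {v : Matrix (Finset (Fin d)) (Finset (Fin d)) (LaurentSeries (Smooth U))}
    (hv : matMul star (coefs (R := Smooth U) u) v = 1)
    (hv' : matMul star v (coefs (R := Smooth U) u) = 1) :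
    assocProduct star u = transferMul (R := Smooth U) star u u' v := by
  have hinv : Ring.inverse u = u' :=
    Ring.inverse_unit (⟨u, u', h, h'⟩ : (LaurentSeries (SuperFun U d))ˣ)
  funext f g
  refine transferMul_eq hs h h' hv hv' (e := matrixToFun star u) (fun A => ?_) f g
  rw [matrixToFun, hinv]
  rfl

lemma admissible_exp
    {star : LaurentSeries (Smooth U) → LaurentSeries (Smooth U) → LaurentSeries (Smooth U)}
    {Y : LaurentSeries (SuperFun U d)} [IsReduced (LaurentSeries (Smooth U))]
    (hY : IsPotential (R := Smooth U) Y)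
    {v : Matrix (Finset (Fin d)) (Finset (Fin d)) (LaurentSeries (Smooth U))}
    (hv : matMul star (coefs (R := Smooth U) (IsNilpotent.exp Y)) v = 1)
    (hv' : matMul star v (coefs (R := Smooth U) (IsNilpotent.exp Y)) = 1) :
    Admissible star (IsNilpotent.exp Y) :=
  ⟨map_grParity_exp hY.even hY.nilpotent, coefs_exp_empty hY.nilpotent, v, hv, hv'⟩

end Smooth

end SuperStar

end

theorem corollaryC {m d : ℕ} (U : TopologicalSpace.Opens (Fin m → ℂ))
    (star : LaurentSeries (SuperStar.Smooth U) → LaurentSeries (SuperStar.Smooth U) →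
      LaurentSeries (SuperStar.Smooth U))
    (hstar : SuperStar.IsSeparatedStarProduct star)
    (Y : LaurentSeries (SuperStar.SuperFun U d))
    (hY : SuperStar.IsNondegenerateNilpotentPotential Y) :
    SuperStar.Admissible star (IsNilpotent.exp Y) ∧
      SuperStar.IsStarProduct (SuperStar.parity U d)
        (SuperStar.assocProduct star (IsNilpotent.exp Y)) ∧
      SuperStar.IsNaturalStarProduct (SuperStar.parity U d)
        (SuperStar.assocProduct star (IsNilpotent.exp Y)) := by
  have hs := hstar.isNaturalStar
  have hp := hY.isPotential
  have := SuperStar.isReduced_smooth (U := U)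
  have := SuperStar.isReduced_laurentSeries (R := SuperStar.Smooth U)
  obtain ⟨v, hv, hv'⟩ := SuperStar.exists_coefs_inverse hs hp
  have hnat : SuperStar.IsNaturalStarProduct (SuperStar.parity U d)
      (SuperStar.assocProduct star (IsNilpotent.exp Y)) := by
    rw [SuperStar.assocProduct_eq hs.toIsStarProduct
      (IsNilpotent.exp_mul_exp_neg_self hY.nilpotent)
      (IsNilpotent.exp_neg_mul_exp_self hY.nilpotent) hv hv']
    exact SuperStar.transferMul_isNaturalStarProduct hs hp hv hv'
  exact ⟨SuperStar.admissible_exp hp hv hv', hnat.toIsStarProduct, hnat⟩
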